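/- Let $\beta>0$, $h>0$, let $Z,Z',Z''$ denote independent standard Gaussian variables with expectation $E$, let $\operatorname{Th}(x):=\tanh(h+\beta x)$, and let $q\ge 0$ be the solution of $q=E\tanh^2(h+\beta\sqrt q\,Z)$. Put $$\psi(t):=E\big[\operatorname{Th}(\sqrt t\,Z+\sqrt{q-t}\,Z')\operatorname{Th}(\sqrt t\,Z+\sqrt{q-t}\,Z'')\big],\qquad 0\le t\le q,$$ $\gamma_1:=E\tanh(h+\beta\sqrt q\,Z)$, $\rho_1:=\sqrt q\,\gamma_1$, and for $k\ge 2$ $$\rho_k:=\psi(\rho_{k-1}),\qquad \gamma_k:=\frac{\rho_k-\Gamma_{k-1}^2}{\sqrt{q-\Gamma_{k-1}^2}},\qquad \Gamma_k^2:=\sum_{j=1}^{k}\gamma_j^2,\quad \Gamma_0^2:=0.$$ For each $N\ge 1$ let $\mathbf g=(g_{ij})_{1\le i,j\le N}$ be a matrix of i.i.d. centered Gaussian variables of variance $1/N$, defined on a probability space with probability $\mathbb P$. On $\mathbb R^N$ use $\langle \mathbf x,\mathbf y\rangle:=\frac1N\sum_{i=1}^N x_iy_i$, $\|\mathbf x\|:=\sqrt{\langle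 \mathbf x,\mathbf x\rangle}$, and $(\mathbf a\otimes\mathbf b)_{ij}:=a_ib_j/N$; functions $\mathbb R\to\mathbb R$ act on vectors componentwise. Define $\mathbf g^{(1)}:=\mathbf g$, $\boldsymbol\phi^{(1)}:=\mathbf 1$, $\mathbf m^{(1)}:=\sqrt q\,\mathbf 1$, and recursively for $k\ge 1$ $$\boldsymbol\xi^{(k)}:=\mathbf g^{(k)}\boldsymbol\phi^{(k)},\qquad \boldsymbol\eta^{(k)}:=(\mathbf g^{(k)})^{T}\boldsymbol\phi^{(k)},\qquad \boldsymbol\zeta^{(k)}:=\frac{\boldsymbol\xi^{(k)}+\boldsymbol\eta^{(k)}}{\sqrt2},$$ $$\mathbf m^{(k+1)}:=\tanh\Big(h\mathbf 1+\beta\sum_{s=1}^{k-1}\gamma_s\boldsymbol\zeta^{(s)}+\beta\sqrt{q-\Gamma_{k-1}^2}\,\boldsymbol\zeta^{(k)}\Big),$$ $$\boldsymbol\phi^{(k+1)}:=\frac{\mathbf r^{(k+1)}}{\|\mathbf r^{(k+1)}\|},\qquad \mathbf r^{(k+1)}:=\mathbf m^{(k+1)}-\sum_{s=1}^{k}\langle\mathbf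 m^{(k+1)},\boldsymbol\phi^{(s)}\rangle\boldsymbol\phi^{(s)},$$ $$\mathbf g^{(k+1)}:=\mathbf g^{(k)}-\Big(\boldsymbol\xi^{(k)}\otimes\boldsymbol\phi^{(k)}+\boldsymbol\phi^{(k)}\otimes\boldsymbol\eta^{(k)}-\langle\boldsymbol\phi^{(k)},\boldsymbol\xi^{(k)}\rangle\,\boldsymbol\phi^{(k)}\otimes\boldsymbol\phi^{(k)}\Big),$$ where $\boldsymbol\phi^{(k+1)}:=\mathbf 0$ if $\mathbf r^{(k+1)}=\mathbf 0$ (for $N>k$ this happens with probability $0$). For sequences of random variables write $X_N\simeq Y_N$ if there are constants $C,c>0$, which may depend on $\beta,h$ and on the indices $k,j$ but not on $N$, such that $$\mathbb P(|X_N-Y_N|\ge t)\le C\exp(-c\,t^2N)\qquad\text{for all } N\ge1,\ t\ge 0.$$ Then: a) for all $1\le j<k$, $\ \langle\mathbf m^{(k)},\boldsymbol\phi^{(j)}\rangle\simeq\gamma_j$; b) for all $k\ge1$, $\ \|\mathbf m^{(k)}\|^2\simeq q$, and for all $1\le j<k$, $\ \langle\mathbf m^{(k)},\mathbf m^{(j)}\rangle\simeq\rho_j$.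 -/

import Mathlib

open MeasureTheory ProbabilityTheory
open scoped Matrix NNReal

noncomputable section

namespace TAP

/-! ### The normalized Euclidean structure on `ℝ^N` -/

/-- `⟨x, y⟩ = N⁻¹ ∑ i, x i * y i`. -/
def ip {N : ℕ} (x y : Fin N → ℝ) : ℝ := (1 / (N : ℝ)) * ∑ i, x i * y i

/-- `‖x‖ = √⟨x, x⟩` for the normalized inner product. -/
def nrm {N : ℕ} (x : Fin N → ℝ) : ℝ := √(ip x x)

/-- `(a ⊗ b) i j = a i * b j / N`. -/
def tens {N : ℕ} (a b : Fin N → ℝ) : Matrix (Fin N) (Fin N) ℝ :=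
  Matrix.of fun i j => a i * b j / (N : ℝ)

/-! ### The deterministic sequences -/

/-- `Th x = tanh (h + β x)`. -/
def Th (β h x : ℝ) : ℝ := Real.tanh (h + β * x)

/-- `q` is a (nonnegative) solution of `q = E tanh² (h + β √q Z)`, `Z` standard Gaussian. -/
def IsFixedPoint (β h q : ℝ) : Prop :=
  0 ≤ q ∧ q = ∫ x, Real.tanh (h + β * √q * x) ^ 2 ∂(gaussianReal 0 1)

/-- `ψ t = E [Th (√t Z + √(q-t) Z') Th (√t Z + √(q-t) Z'')]` with `Z, Z', Z''` independent
standard Gaussians. -/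
def psi (β h q t : ℝ) : ℝ :=
  ∫ z, ∫ z', ∫ z'', Th β h (√t * z + √(q - t) * z') * Th β h (√t * z + √(q - t) * z'')
    ∂(gaussianReal 0 1) ∂(gaussianReal 0 1) ∂(gaussianReal 0 1)

/-- `γ₁ = E tanh (h + β √q Z)`. -/
def gammaOne (β h q : ℝ) : ℝ := ∫ x, Real.tanh (h + β * √q * x) ∂(gaussianReal 0 1)

/-- The sequence `ρ₁ = √q γ₁`, `ρ_k = ψ (ρ_{k-1})`. Indices start at `1`; the value at `0` is
unused. -/
def rho (β h q : ℝ) : ℕ → ℝ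
  | 0 => 0
  | 1 => √q * gammaOne β h q
  | k + 2 => psi β h q (rho β h q (k + 1))

/-- The right-hand side of the recursion for `γ_k`, `k ≥ 2`, as a function of the earlier values
`c 1, …, c (k-1)`. -/
def gammaStep (β h q : ℝ) (k : ℕ) (c : ℕ → ℝ) : ℝ :=
  (rho β h q k - ∑ j ∈ Finset.Ico 1 k, c j ^ 2) / √(q - ∑ j ∈ Finset.Ico 1 k, c j ^ 2)

/-- The sequence `γ₁`,
`γ_k = (ρ_k - ∑_{j<k} γ_j²) / √(q - ∑_{j<k} γ_j²)`. Indices start at `1`; the value at `0` is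
unused. -/
def gamma (β h q : ℝ) : ℕ → ℝ
  | 0 => 0
  | 1 => gammaOne β h q
  | k + 2 => gammaStep β h q (k + 2) fun j => if _hj : j < k + 2 then gamma β h q j else 0
termination_by k => k

theorem gamma_one (β h q : ℝ) : gamma β h q 1 = gammaOne β h q := by
  rw [gamma]

theorem gamma_add_two (β h q : ℝ) (k : ℕ) :
    gamma β h q (k + 2) =
      (rho β h q (k + 2) - ∑ j ∈ Finset.Ico 1 (k + 2), gamma β h q j ^ 2) /
        √(q - ∑ j ∈ Finset.Ico 1 (k + 2), gamma β h q j ^ 2) := by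
  have key : ∑ j ∈ Finset.Ico 1 (k + 2),
      (if _hj : j < k + 2 then gamma β h q j else 0) ^ 2 =
        ∑ j ∈ Finset.Ico 1 (k + 2), gamma β h q j ^ 2 := by
    refine Finset.sum_congr rfl fun j hj => ?_
    rw [dif_pos (Finset.mem_Ico.1 hj).2]
  rw [gamma, gammaStep, key]

/-! ### The iterative construction -/

/-- The data `(g^(k), φ^(k), m^(k))` at one level of the construction. -/
structure Level (N : ℕ) where
  /-- the modified interaction matrix -/
  g : Matrix (Fin N) (Fin N) ℝ
  /-- the unit vector -/
  φ : Fin N → ℝ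
  /-- the approximate TAP solution -/
  m : Fin N → ℝ

namespace Level

variable {N : ℕ}

/-- `ξ = g φ`. -/
def ξ (L : Level N) : Fin N → ℝ := L.g *ᵥ L.φ

/-- `η = gᵀ φ`. -/
def η (L : Level N) : Fin N → ℝ := L.gᵀ *ᵥ L.φ

/-- `ζ = (ξ + η) / √2`. -/
def ζ (L : Level N) : Fin N → ℝ := (1 / √2) • (L.ξ + L.η)

/-- `ξ ⊗ φ + φ ⊗ η - ⟨φ, ξ⟩ φ ⊗ φ`. -/
def correction (L : Level N) : Matrix (Fin N) (Fin N) ℝ :=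
  tens L.ξ L.φ + tens L.φ L.η - ip L.φ L.ξ • tens L.φ L.φ

end Level

/-- `h^(k+1) = h 1 + β ∑_{s<k} γ_s ζ^(s) + β √(q - ∑_{s<k} γ_s²) ζ^(k)`, computed from the levels
`1, …, k`. -/
def fieldNext {N : ℕ} (β h q : ℝ) (k : ℕ) (L : ℕ → Level N) : Fin N → ℝ :=
  fun i => h + β * ∑ s ∈ Finset.Ico 1 k, gamma β h q s * (L s).ζ i +
    β * √(q - ∑ s ∈ Finset.Ico 1 k, gamma β h q s ^ 2) * (L k).ζ i

/-- `m^(k+1) = tanh (h^(k+1))`. -/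
def mNext {N : ℕ} (β h q : ℝ) (k : ℕ) (L : ℕ → Level N) : Fin N → ℝ :=
  fun i => Real.tanh (fieldNext β h q k L i)

/-- `m^(k+1) - ∑_{s≤k} ⟨m^(k+1), φ^(s)⟩ φ^(s)`. -/
def residual {N : ℕ} (β h q : ℝ) (k : ℕ) (L : ℕ → Level N) : Fin N → ℝ :=
  mNext β h q k L - ∑ s ∈ Finset.Icc 1 k, ip (mNext β h q k L) (L s).φ • (L s).φ

/-- The level `k+1`, computed from the levels `1, …, k`. The vector `φ^(k+1)` is the normalized
residual, and `0` where the residual vanishes. -/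
def levelNext {N : ℕ} (β h q : ℝ) (k : ℕ) (L : ℕ → Level N) : Level N where
  g := (L k).g - (L k).correction
  φ := (nrm (residual β h q k L))⁻¹ • residual β h q k L
  m := mNext β h q k L

/-- The levels of the construction started from the interaction matrix `g`:
`g^(1) = g`, `φ^(1) = 1`, `m^(1) = √q 1`, and level `k+1` from the levels `1, …, k`.
Indices start at `1`; the value at `0` is unused. -/
def level {N : ℕ} (β h q : ℝ) (g : Matrix (Fin N) (Fin N) ℝ) : ℕ → Level N
  | 0 => ⟨0, 0, 0⟩
  | 1 => ⟨g, fun _ => 1, fun _ => √q⟩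
  | k + 2 => levelNext β h q (k + 1)
      fun s => if _hs : s < k + 2 then level β h q g s else ⟨0, 0, 0⟩
termination_by k => k

theorem level_one {N : ℕ} (β h q : ℝ) (g : Matrix (Fin N) (Fin N) ℝ) :
    level β h q g 1 = ⟨g, fun _ => 1, fun _ => √q⟩ := by
  rw [level]

theorem levelNext_congr {N : ℕ} (β h q : ℝ) (k : ℕ) (hk : 1 ≤ k) (L L' : ℕ → Level N)
    (hL : ∀ s, 1 ≤ s → s ≤ k → L s = L' s) :
    levelNext β h q k L = levelNext β h q k L' := by
  have h0 : L k = L' k := hL k hk le_rfl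
  have h1 : mNext β h q k L = mNext β h q k L' := by
    funext i
    have : ∑ s ∈ Finset.Ico 1 k, gamma β h q s * (L s).ζ i =
        ∑ s ∈ Finset.Ico 1 k, gamma β h q s * (L' s).ζ i := by
      refine Finset.sum_congr rfl fun s hs => ?_
      rw [hL s (Finset.mem_Ico.1 hs).1 (Finset.mem_Ico.1 hs).2.le]
    rw [mNext, mNext, fieldNext, fieldNext, this, h0]
  have h2 : residual β h q k L = residual β h q k L' := by
    rw [residual, residual, h1]
    congr 1
    refine Finset.sum_congr rfl fun s hs => ?_
    rw [hL s (Finset.mem_Icc.1 hs).1 (Finset.mem_Icc.1 hs).2]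
  rw [levelNext, levelNext, h0, h1, h2]

theorem level_add_one {N : ℕ} (β h q : ℝ) (g : Matrix (Fin N) (Fin N) ℝ) (k : ℕ) (hk : 1 ≤ k) :
    level β h q g (k + 1) = levelNext β h q k (level β h q g) := by
  obtain ⟨k, rfl⟩ := Nat.exists_eq_add_of_le' hk
  rw [level]
  refine levelNext_congr β h q (k + 1) hk _ _ fun s _ hs => ?_
  rw [dif_pos (Nat.lt_succ_of_le hs)]

/-- `m^(k)`, as a function of the interaction matrix. -/
def m {N : ℕ} (β h q : ℝ) (g : Matrix (Fin N) (Fin N) ℝ) (k : ℕ) : Fin N → ℝ :=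
  (level β h q g k).m

/-- `φ^(k)`, as a function of the interaction matrix. -/
def φ {N : ℕ} (β h q : ℝ) (g : Matrix (Fin N) (Fin N) ℝ) (k : ℕ) : Fin N → ℝ :=
  (level β h q g k).φ

/-! ### Exponential closeness -/

/-- `X_N ≃ Y_N`: there are constants `C, c > 0`, not depending on `N`, such that
`P (|X_N - Y_N| ≥ t) ≤ C exp (-c t² N)` for all `N ≥ 1` and `t ≥ 0`. -/
def ExpClose {Ω : Type*} [MeasurableSpace Ω] (P : Measure Ω) (X Y : ℕ → Ω → ℝ) : Prop :=
  ∃ C : ℝ, 0 < C ∧ ∃ c : ℝ, 0 < c ∧ ∀ N : ℕ, 1 ≤ N → ∀ t : ℝ, 0 ≤ t →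
    P.real {ω | t ≤ |X N ω - Y N ω|} ≤ C * Real.exp (-(c * t ^ 2 * (N : ℝ)))

end TAP

end

noncomputable section

namespace TAP

/-! ### Algebra of the normalized inner product -/

section Algebra

variable {N : ℕ}

/-! The construction explores the Gaussian matrix one row and one column at a time, in random
directions. The matrix of level `k + 1` is the compression of `g` to the complement of the first `k`
directions, so it should carry only fresh randomness. Heuristically, `ζ` of each level is then,
given the past, a standard Gaussian vector except for its components along the finitely many known
directions, and those components have normalized size of order `N^(-1/2)`. Hence `m` of each level
is close, in normalized norm, to a fixed function applied site by site to i.i.d. Gaussian data, and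
overlaps are empirical averages, which concentrate by Hoeffding's inequality.

Conditioning is replaced by a forward simulation. Step `k + 1` of `sim` adds a matrix `incr` built
from two fresh Gaussian vectors, which annihilates the earlier directions on both sides. By
`level_add` it leaves all earlier `ζ` and all known directions unchanged. Completing the simulation
by the compression of an independent copy of `g` reproduces the law of `g`. This is `map_simFull`,
proved with characteristic functions: `integral_charFun_sim` is an induction whose step is the
Pythagorean identity `OrthoSys.frob_projC`. In the simulation `ζ` is explicit (`level_sim_ζ`): the
fresh vector `z`, corrected along known directions.

In the limit the fields are jointly Gaussian with variance `q`. The recursion for `gamma` is exactly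
what makes the covariance of the fields `j` and `k`, `j < k`, equal to `rho j`
(`sum_coef_mul_coef`), so applying `Th` gives covariance `psi (rho j) = rho (j + 1)`
(`integral_Th_mul_Th`, `integral_mlim_mul`). Gram-Schmidt applied to the `m` obeys the same
recursion as `gamma`, whence the limits of the inner products with `φ` (`expClose_ip_m_φ`).

Dividing by residual norms requires `q - ∑ γ² > 0` (`defect_pos`). This number is the squared
distance in `L²` from a limiting variable to the span of the earlier ones. It is positive because
the newest Gaussian coordinate is uncorrelated with the earlier variables but positively correlated
with the new one, `Th` being strictly increasing.

The approximation of `m` and the Gram-Schmidt limits feed each other; the loop is closed by the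
induction on levels in `expClose_nrm_m_sub_mhat`. -/

theorem ip_eq_dotProduct (x y : Fin N → ℝ) : ip x y = (1 / (N : ℝ)) * (x ⬝ᵥ y) := rfl

theorem ip_comm (x y : Fin N → ℝ) : ip x y = ip y x := by
  rw [ip_eq_dotProduct, ip_eq_dotProduct, dotProduct_comm]

theorem ip_add_left (x y w : Fin N → ℝ) : ip (x + y) w = ip x w + ip y w := by
  simp only [ip_eq_dotProduct, add_dotProduct, mul_add]

theorem ip_sub_left (x y w : Fin N → ℝ) : ip (x - y) w = ip x w - ip y w := by
  simp only [ip_eq_dotProduct, sub_dotProduct, mul_sub]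

theorem ip_smul_left (c : ℝ) (x w : Fin N → ℝ) : ip (c • x) w = c * ip x w := by
  simp only [ip_eq_dotProduct, smul_dotProduct, smul_eq_mul]; ring

theorem ip_zero_left (w : Fin N → ℝ) : ip 0 w = 0 := by
  simp [ip_eq_dotProduct]

theorem ip_sum_left {ι : Type*} (s : Finset ι) (f : ι → Fin N → ℝ) (w : Fin N → ℝ) :
    ip (∑ a ∈ s, f a) w = ∑ a ∈ s, ip (f a) w := by
  simp only [ip_eq_dotProduct, sum_dotProduct, Finset.mul_sum]

theorem ip_add_right (x y w : Fin N → ℝ) : ip w (x + y) = ip w x + ip w y := by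
  rw [ip_comm, ip_add_left, ip_comm x, ip_comm y]

theorem ip_sub_right (x y w : Fin N → ℝ) : ip w (x - y) = ip w x - ip w y := by
  rw [ip_comm, ip_sub_left, ip_comm x, ip_comm y]

theorem ip_smul_right (c : ℝ) (x w : Fin N → ℝ) : ip w (c • x) = c * ip w x := by
  rw [ip_comm, ip_smul_left, ip_comm]

theorem ip_zero_right (w : Fin N → ℝ) : ip w 0 = 0 := by rw [ip_comm, ip_zero_left]

theorem ip_sum_right {ι : Type*} (s : Finset ι) (f : ι → Fin N → ℝ) (w : Fin N → ℝ) :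
    ip w (∑ a ∈ s, f a) = ∑ a ∈ s, ip w (f a) := by
  rw [ip_comm, ip_sum_left]; exact Finset.sum_congr rfl fun _ _ => ip_comm _ _

theorem ip_self_nonneg (x : Fin N → ℝ) : 0 ≤ ip x x :=
  mul_nonneg (by positivity) (Finset.sum_nonneg fun i _ => mul_self_nonneg (x i))

theorem ip_mulVec_left (A : Matrix (Fin N) (Fin N) ℝ) (x y : Fin N → ℝ) :
    ip (A *ᵥ x) y = ip x (Aᵀ *ᵥ y) := by
  rw [ip_eq_dotProduct, ip_eq_dotProduct, Matrix.dotProduct_mulVec, Matrix.vecMul_transpose]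

theorem nrm_sq (x : Fin N → ℝ) : nrm x ^ 2 = ip x x := Real.sq_sqrt (ip_self_nonneg x)

theorem nrm_nonneg (x : Fin N → ℝ) : 0 ≤ nrm x := Real.sqrt_nonneg _

theorem nrm_eq_norm (x : Fin N → ℝ) : nrm x = (√(N : ℝ))⁻¹ * ‖WithLp.toLp 2 x‖ := by
  rw [nrm, ip, EuclideanSpace.norm_eq, Real.sqrt_mul (by positivity), Real.sqrt_div zero_le_one,
    Real.sqrt_one, one_div]
  simp [sq]

theorem nrm_add_le (x y : Fin N → ℝ) : nrm (x + y) ≤ nrm x + nrm y := by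
  rw [nrm_eq_norm, nrm_eq_norm, nrm_eq_norm, ← mul_add, WithLp.toLp_add]
  exact mul_le_mul_of_nonneg_left (norm_add_le _ _) (by positivity)

theorem nrm_smul (c : ℝ) (x : Fin N → ℝ) : nrm (c • x) = |c| * nrm x := by
  rw [nrm_eq_norm, nrm_eq_norm, WithLp.toLp_smul, norm_smul, Real.norm_eq_abs]; ring

theorem nrm_zero : nrm (0 : Fin N → ℝ) = 0 := by simp [nrm, ip_zero_left]

theorem nrm_sub_le (x y : Fin N → ℝ) : nrm (x - y) ≤ nrm x + nrm y := by
  have := nrm_add_le x ((-1 : ℝ) • y)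
  rw [nrm_smul] at this
  simpa [sub_eq_add_neg] using this

theorem nrm_sum_le {ι : Type*} (s : Finset ι) (f : ι → Fin N → ℝ) :
    nrm (∑ a ∈ s, f a) ≤ ∑ a ∈ s, nrm (f a) := by
  classical
  induction s using Finset.induction_on with
  | empty => simp [nrm_zero]
  | insert a s ha ih =>
    rw [Finset.sum_insert ha, Finset.sum_insert ha]
    exact (nrm_add_le _ _).trans (by linarith)

theorem abs_ip_le (x y : Fin N → ℝ) : |ip x y| ≤ nrm x * nrm y := by
  have h : ip x y ^ 2 ≤ (nrm x * nrm y) ^ 2 := by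
    rw [mul_pow, nrm_sq, nrm_sq]
    simp only [ip]
    have := Finset.sum_mul_sq_le_sq_mul_sq Finset.univ x y
    have hN : (0 : ℝ) ≤ (1 / (N : ℝ)) ^ 2 := by positivity
    simp only [← sq]
    calc (1 / (N : ℝ) * ∑ i, x i * y i) ^ 2 = (1 / (N : ℝ)) ^ 2 * (∑ i, x i * y i) ^ 2 := by ring
      _ ≤ (1 / (N : ℝ)) ^ 2 * ((∑ i, x i ^ 2) * ∑ i, y i ^ 2) :=
        mul_le_mul_of_nonneg_left this hN
      _ = _ := by ring
  exact abs_le_of_sq_le_sq h (mul_nonneg (nrm_nonneg _) (nrm_nonneg _))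

theorem nrm_le_of_abs_le {x y : Fin N → ℝ} (h : ∀ i, |x i| ≤ |y i|) : nrm x ≤ nrm y := by
  refine Real.sqrt_le_sqrt (mul_le_mul_of_nonneg_left (Finset.sum_le_sum fun i _ => ?_)
    (by positivity))
  rw [← abs_mul_abs_self, ← abs_mul_abs_self (y i)]
  exact mul_self_le_mul_self (abs_nonneg _) (h i)

theorem nrm_const (hN : 1 ≤ N) (c : ℝ) : nrm (fun _ : Fin N => c) = |c| := by
  have : (N : ℝ) ≠ 0 := by positivity
  simp only [nrm, ip, Finset.sum_const, Finset.card_univ, Fintype.card_fin, nsmul_eq_mul]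
  rw [← mul_assoc, one_div_mul_cancel this, one_mul, ← sq, Real.sqrt_sq_eq_abs]

theorem nrm_le_one {x : Fin N → ℝ} (h : ∀ i, |x i| ≤ 1) : nrm x ≤ 1 := by
  rcases Nat.eq_zero_or_pos N with rfl | hN
  · simp [nrm, ip]
  · calc nrm x ≤ nrm (fun _ : Fin N => (1 : ℝ)) := nrm_le_of_abs_le (by simpa using h)
      _ = 1 := by rw [nrm_const hN, abs_one]

/-! ### Rank one matrices -/

theorem tens_eq_smul_vecMulVec (a b : Fin N → ℝ) :
    tens a b = (1 / (N : ℝ)) • Matrix.vecMulVec a b := by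
  ext i j; simp [tens, Matrix.vecMulVec_apply]; ring

theorem tens_mulVec (a b c : Fin N → ℝ) : tens a b *ᵥ c = ip b c • a := by
  rw [tens_eq_smul_vecMulVec, Matrix.smul_mulVec, Matrix.vecMulVec_mulVec, ip_eq_dotProduct]
  ext i; simp; ring

theorem tens_transpose (a b : Fin N → ℝ) : (tens a b)ᵀ = tens b a := by
  ext i j; simp [tens, mul_comm]

theorem mul_tens (A : Matrix (Fin N) (Fin N) ℝ) (a b : Fin N → ℝ) :
    A * tens a b = tens (A *ᵥ a) b := by
  rw [tens_eq_smul_vecMulVec, tens_eq_smul_vecMulVec, Matrix.mul_smul, Matrix.mul_vecMulVec]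

theorem tens_mul (A : Matrix (Fin N) (Fin N) ℝ) (a b : Fin N → ℝ) :
    tens a b * A = tens a (Aᵀ *ᵥ b) := by
  rw [tens_eq_smul_vecMulVec, tens_eq_smul_vecMulVec, Matrix.smul_mul, Matrix.vecMulVec_mul,
    Matrix.mulVec_transpose]

theorem tens_smul_left (c : ℝ) (a b : Fin N → ℝ) : tens (c • a) b = c • tens a b := by
  ext i j; simp [tens]; ring

theorem tens_zero_left (b : Fin N → ℝ) : tens 0 b = 0 := by
  ext i j; simp [tens]

theorem tens_zero_right (b : Fin N → ℝ) : tens b 0 = 0 := by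
  ext i j; simp [tens]

/-! ### The Frobenius pairing -/

/-- The Frobenius pairing of two matrices. -/
def pair (A B : Matrix (Fin N) (Fin N) ℝ) : ℝ := ∑ i, ∑ j, A i j * B i j

/-- The squared Frobenius norm. -/
def frob (A : Matrix (Fin N) (Fin N) ℝ) : ℝ := ∑ i, ∑ j, A i j ^ 2

theorem pair_add_right (A B C : Matrix (Fin N) (Fin N) ℝ) :
    pair A (B + C) = pair A B + pair A C := by
  simp [pair, mul_add, Finset.sum_add_distrib]

theorem pair_sub_right (A B C : Matrix (Fin N) (Fin N) ℝ) :
    pair A (B - C) = pair A B - pair A C := by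
  simp [pair, mul_sub, Finset.sum_sub_distrib]

theorem pair_smul_right (A B : Matrix (Fin N) (Fin N) ℝ) (c : ℝ) :
    pair A (c • B) = c * pair A B := by
  simp only [pair, Finset.mul_sum, Matrix.smul_apply, smul_eq_mul]
  exact Finset.sum_congr rfl fun _ _ => Finset.sum_congr rfl fun _ _ => by ring

theorem pair_tens (A : Matrix (Fin N) (Fin N) ℝ) (a b : Fin N → ℝ) :
    pair A (tens a b) = ip a (A *ᵥ b) := by
  simp only [pair, tens, ip, Matrix.mulVec, dotProduct, Finset.mul_sum, Matrix.of_apply]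
  exact Finset.sum_congr rfl fun _ _ => Finset.sum_congr rfl fun _ _ => by ring

theorem pair_eq_trace (A B : Matrix (Fin N) (Fin N) ℝ) : pair A B = (A * Bᵀ).trace := by
  simp [pair, Matrix.trace, Matrix.mul_apply]

theorem frob_eq_trace (A : Matrix (Fin N) (Fin N) ℝ) : frob A = (A * Aᵀ).trace := by
  rw [← pair_eq_trace]; simp [pair, frob, sq]

/-- Compression by a symmetric matrix is self-adjoint for the pairing. This moves the random
projections from the independent matrix onto the test matrix of a characteristic function. -/
theorem pair_mul_mul {Q : Matrix (Fin N) (Fin N) ℝ} (hQ : Qᵀ = Q)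
    (A B : Matrix (Fin N) (Fin N) ℝ) : pair A (Q * B * Q) = pair (Q * A * Q) B := by
  rw [pair_eq_trace, pair_eq_trace, Matrix.transpose_mul, Matrix.transpose_mul, hQ,
    Matrix.trace_mul_comm, Matrix.mul_assoc, Matrix.mul_assoc, Matrix.mul_assoc,
    Matrix.trace_mul_comm, Matrix.mul_assoc, Matrix.mul_assoc, Matrix.mul_assoc,
    Matrix.trace_mul_comm, Matrix.mul_assoc, Matrix.mul_assoc]

theorem frob_tens (a b : Fin N → ℝ) : frob (tens a b) = ip a a * ip b b := by
  simp only [frob, tens, ip, Matrix.of_apply]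
  rw [show (1 / (N : ℝ) * ∑ i, a i * a i) * (1 / (N : ℝ) * ∑ i, b i * b i)
    = (1 / (N : ℝ)) * (1 / (N : ℝ)) * ((∑ i, a i * a i) * ∑ i, b i * b i) by ring,
    Finset.sum_mul_sum, Finset.mul_sum]
  simp only [Finset.mul_sum]
  exact Finset.sum_congr rfl fun _ _ => Finset.sum_congr rfl fun _ _ => by ring

theorem frob_transpose (A : Matrix (Fin N) (Fin N) ℝ) : frob Aᵀ = frob A := by
  simp only [frob, Matrix.transpose_apply]; exact Finset.sum_comm

/-- Pythagoras: `A * P` and `A * (1 - P)` are orthogonal for the Frobenius pairing when `P` is an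
orthogonal projection. -/
theorem frob_mul_proj (A P : Matrix (Fin N) (Fin N) ℝ) (hP : Pᵀ = P) (hPP : P * P = P) :
    frob A = frob (A * P) + frob (A * (1 - P)) := by
  simp only [frob_eq_trace, Matrix.transpose_mul, Matrix.transpose_sub, hP, Matrix.transpose_one]
  rw [← Matrix.trace_add]
  congr 1
  have h1 : A * P * (P * Aᵀ) = A * P * Aᵀ := by
    rw [Matrix.mul_assoc, ← Matrix.mul_assoc P, hPP, Matrix.mul_assoc]
  have h2 : A * (1 - P) * ((1 - P) * Aᵀ) = A * (1 - P) * Aᵀ := by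
    have : (1 - P) * (1 - P) = 1 - P := by
      rw [Matrix.mul_sub, Matrix.mul_one, Matrix.sub_mul, Matrix.one_mul, hPP]; simp
    rw [Matrix.mul_assoc, ← Matrix.mul_assoc (1 - P), this, Matrix.mul_assoc]
  rw [h1, h2, Matrix.mul_sub, Matrix.mul_one, Matrix.sub_mul]
  abel

/-! ### Orthonormal systems, up to vanishing vectors -/

/-- The vectors `φ 1, φ 2, …` are orthogonal, and each of them is a unit vector or zero. -/
structure OrthoSys (φ : ℕ → Fin N → ℝ) : Prop where
  idem : ∀ s, 1 ≤ s → ip (φ s) (φ s) • φ s = φ s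
  orth : ∀ s t, 1 ≤ s → 1 ≤ t → s ≠ t → ip (φ s) (φ t) = 0

/-- The projection to the complement of `φ 1, …, φ k`. -/
def projC (φ : ℕ → Fin N → ℝ) (k : ℕ) : Matrix (Fin N) (Fin N) ℝ :=
  1 - ∑ s ∈ Finset.Icc 1 k, tens (φ s) (φ s)

theorem projC_zero (φ : ℕ → Fin N → ℝ) : projC φ 0 = 1 := by simp [projC]

theorem projC_succ (φ : ℕ → Fin N → ℝ) (k : ℕ) :
    projC φ (k + 1) = projC φ k - tens (φ (k + 1)) (φ (k + 1)) := by
  rw [projC, projC, Finset.sum_Icc_succ_top (by omega), sub_add_eq_sub_sub]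

theorem projC_congr {φ φ' : ℕ → Fin N → ℝ} {k : ℕ} (h : ∀ s, 1 ≤ s → s ≤ k → φ s = φ' s) :
    projC φ k = projC φ' k := by
  rw [projC, projC]
  congr 1
  refine Finset.sum_congr rfl fun s hs => ?_
  rw [h s (Finset.mem_Icc.1 hs).1 (Finset.mem_Icc.1 hs).2]

theorem projC_transpose (φ : ℕ → Fin N → ℝ) (k : ℕ) : (projC φ k)ᵀ = projC φ k := by
  simp [projC, Matrix.transpose_sum, tens_transpose]

theorem ip_projC (φ : ℕ → Fin N → ℝ) (k : ℕ) (x y : Fin N → ℝ) :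
    ip (projC φ k *ᵥ x) y = ip x (projC φ k *ᵥ y) := by
  rw [ip_mulVec_left, projC_transpose]

theorem projC_mulVec (φ : ℕ → Fin N → ℝ) (k : ℕ) (x : Fin N → ℝ) :
    projC φ k *ᵥ x = x - ∑ s ∈ Finset.Icc 1 k, ip (φ s) x • φ s := by
  rw [projC, Matrix.sub_mulVec, Matrix.one_mulVec, Matrix.sum_mulVec]
  simp only [tens_mulVec]

namespace OrthoSys

variable {φ : ℕ → Fin N → ℝ}

theorem ip_self_mul (H : OrthoSys φ) {s : ℕ} (hs : 1 ≤ s) (x : Fin N → ℝ) :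
    ip (φ s) (φ s) * ip x (φ s) = ip x (φ s) := by
  rw [← ip_smul_right, H.idem s hs]

theorem projC_mulVec_of_le (H : OrthoSys φ) {s k : ℕ} (hs : 1 ≤ s) (hk : s ≤ k) : projC φ k *ᵥ φ s = 0 := by
  rw [projC_mulVec, Finset.sum_eq_single s, H.idem s hs, sub_self]
  · intro t ht hts
    rw [H.orth t s (Finset.mem_Icc.1 ht).1 hs hts, zero_smul]
  · intro h; exact absurd (Finset.mem_Icc.2 ⟨hs, hk⟩) h

theorem projC_mulVec_of_lt (H : OrthoSys φ) {s k : ℕ} (hk : k < s) : projC φ k *ᵥ φ s = φ s := by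
  rw [projC_mulVec, Finset.sum_eq_zero, sub_zero]
  intro t ht
  obtain ⟨h1, h2⟩ := Finset.mem_Icc.1 ht
  rw [H.orth t s h1 (by omega) (by omega), zero_smul]

theorem tens_mul_tens (H : OrthoSys φ) {s : ℕ} (hs : 1 ≤ s) :
    tens (φ s) (φ s) * tens (φ s) (φ s) = tens (φ s) (φ s) := by
  rw [mul_tens, tens_mulVec, H.idem s hs]

theorem one_sub_mul_projC (H : OrthoSys φ) (k : ℕ) :
    (1 - tens (φ (k + 1)) (φ (k + 1))) * projC φ k = projC φ (k + 1) := by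
  rw [Matrix.sub_mul, Matrix.one_mul, tens_mul, projC_transpose,
    H.projC_mulVec_of_lt (Nat.lt_succ_self k), projC_succ]

theorem projC_mul_one_sub (H : OrthoSys φ) (k : ℕ) :
    projC φ k * (1 - tens (φ (k + 1)) (φ (k + 1))) = projC φ (k + 1) := by
  rw [Matrix.mul_sub, Matrix.mul_one, mul_tens,
    H.projC_mulVec_of_lt (Nat.lt_succ_self k), projC_succ]

/-- Pythagoras for the residual of a matrix when one more direction is removed. -/
theorem frob_projC (H : OrthoSys φ) (A : Matrix (Fin N) (Fin N) ℝ) (k : ℕ) :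
    frob (projC φ k * A * projC φ k) =
      frob (projC φ (k + 1) * A * projC φ (k + 1)) +
        ip (projC φ k *ᵥ (A *ᵥ φ (k + 1))) (projC φ k *ᵥ (A *ᵥ φ (k + 1))) +
        ip (projC φ (k + 1) *ᵥ (Aᵀ *ᵥ φ (k + 1))) (projC φ (k + 1) *ᵥ (Aᵀ *ᵥ φ (k + 1))) := by
  set u := φ (k + 1) with hu
  set Q := projC φ k with hQ
  have hPt : (tens u u)ᵀ = tens u u := tens_transpose u u
  have hPP : tens u u * tens u u = tens u u := H.tens_mul_tens (Nat.succ_pos k)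
  have h1 : Q *ᵥ u = u := H.projC_mulVec_of_lt (Nat.lt_succ_self k)
  have hQt : Qᵀ = Q := projC_transpose φ k
  have hid : ip u u • u = u := H.idem _ (Nat.succ_pos k)
  have e1 : frob (Q * A * Q * tens u u) = ip (Q *ᵥ (A *ᵥ u)) (Q *ᵥ (A *ᵥ u)) := by
    rw [mul_tens, frob_tens, ← Matrix.mulVec_mulVec, h1, ← Matrix.mulVec_mulVec, mul_comm,
      ← ip_smul_left, ← Matrix.mulVec_smul, ← Matrix.mulVec_smul, hid]
  have e2 : projC φ (k + 1) * A * projC φ (k + 1) =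
      (1 - tens u u) * (Q * A * Q * (1 - tens u u)) := by
    rw [← H.one_sub_mul_projC k, Matrix.mul_assoc (Q * A), H.projC_mul_one_sub k,
      ← H.one_sub_mul_projC k]
    simp only [Matrix.mul_assoc, ← hu, ← hQ]
  have e3 : tens u u * (Q * A * Q * (1 - tens u u)) = tens u (projC φ (k + 1) *ᵥ (Aᵀ *ᵥ u)) := by
    rw [tens_mul, Matrix.mul_assoc (Q * A), H.projC_mul_one_sub k, Matrix.transpose_mul,
      Matrix.transpose_mul, hQt, projC_transpose, ← Matrix.mulVec_mulVec, ← Matrix.mulVec_mulVec,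
      h1]
  -- Split off the direction `u` on the right, then transpose and split it off on the left. The
  -- second column-row piece meets a matrix already projected on one side, hence `projC φ (k + 1)`
  -- in one term and `projC φ k` in the other.
  rw [frob_mul_proj (Q * A * Q) (tens u u) hPt hPP, e1,
    ← frob_transpose (Q * A * Q * (1 - tens u u)),
    frob_mul_proj (Q * A * Q * (1 - tens u u))ᵀ (tens u u) hPt hPP]
  rw [← frob_transpose (_ * tens u u), ← frob_transpose (_ * (1 - tens u u)),
    Matrix.transpose_mul, Matrix.transpose_transpose, hPt, e3,
    Matrix.transpose_mul, Matrix.transpose_transpose, Matrix.transpose_sub, hPt,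
    Matrix.transpose_one, ← e2, frob_tens, ← ip_smul_left, ← Matrix.mulVec_smul,
    ← Matrix.mulVec_smul, hid]
  ring

end OrthoSys

end Algebra

/-! ### Structure of the levels -/

section Levels

variable {N : ℕ} (β h q : ℝ) (g : Matrix (Fin N) (Fin N) ℝ)

theorem m_one : m β h q g 1 = fun _ => √q := by rw [m, level_one]

theorem φ_one : φ β h q g 1 = fun _ => 1 := by rw [φ, level_one]

theorem m_succ {k : ℕ} (hk : 1 ≤ k) : m β h q g (k + 1) = mNext β h q k (level β h q g) := by
  rw [m, level_add_one β h q g k hk, levelNext]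

theorem residual_level {k : ℕ} (hk : 1 ≤ k) : residual β h q k (level β h q g) =
    m β h q g (k + 1) - ∑ s ∈ Finset.Icc 1 k,
      ip (m β h q g (k + 1)) (φ β h q g s) • φ β h q g s := by
  rw [residual, m_succ β h q g hk]; rfl

theorem φ_succ {k : ℕ} (hk : 1 ≤ k) : φ β h q g (k + 1) =
    (nrm (residual β h q k (level β h q g)))⁻¹ • residual β h q k (level β h q g) := by
  rw [φ, level_add_one β h q g k hk, levelNext]

theorem level_g_succ {k : ℕ} (hk : 1 ≤ k) : (level β h q g (k + 1)).g =
    (level β h q g k).g - (level β h q g k).correction := by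
  rw [level_add_one β h q g k hk, levelNext]

theorem ip_one_one (hN : 1 ≤ N) : ip (fun _ : Fin N => (1 : ℝ)) (fun _ => 1) = 1 := by
  have : (N : ℝ) ≠ 0 := by positivity
  simp [ip, this]

theorem nrm_inv_smul_idem (r : Fin N → ℝ) :
    ip ((nrm r)⁻¹ • r) ((nrm r)⁻¹ • r) • ((nrm r)⁻¹ • r) = (nrm r)⁻¹ • r := by
  rcases eq_or_ne (nrm r) 0 with h0 | h0
  · simp [h0]
  · rw [ip_smul_left, ip_smul_right, ← nrm_sq]
    have : (nrm r)⁻¹ * ((nrm r)⁻¹ * nrm r ^ 2) = 1 := by field_simp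
    rw [this, one_smul]

/-- This form of "unit vector or zero" lets the algebra run without separating the degenerate cases
`N = 0` and vanishing residual. -/
theorem ip_φ_smul_φ {s : ℕ} (hs : 1 ≤ s) :
    ip (φ β h q g s) (φ β h q g s) • φ β h q g s = φ β h q g s := by
  obtain ⟨k, rfl⟩ := Nat.exists_eq_add_of_le' hs
  rcases Nat.eq_zero_or_pos k with rfl | hk
  · rw [zero_add, φ_one]
    rcases Nat.eq_zero_or_pos N with rfl | hN
    · exact Subsingleton.elim _ _
    · rw [ip_one_one hN, one_smul]
  · rw [φ_succ β h q g hk]; exact nrm_inv_smul_idem _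

theorem ip_φ_φ_of_lt {s t : ℕ} (hs : 1 ≤ s) (hst : s < t) :
    ip (φ β h q g t) (φ β h q g s) = 0 := by
  induction t using Nat.strong_induction_on generalizing s with
  | _ t ih =>
    obtain ⟨k, rfl⟩ := Nat.exists_eq_add_of_le' (show 1 ≤ t by omega)
    have hk : 1 ≤ k := by omega
    rw [φ_succ β h q g hk, ip_smul_left, residual_level β h q g hk, ip_sub_left, ip_sum_left,
      Finset.sum_eq_single (a := s) (f := fun a =>
        ip (ip (m β h q g (k + 1)) (φ β h q g a) • φ β h q g a) (φ β h q g s))]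
    · rw [ip_smul_left, mul_comm (ip _ (φ β h q g s)), ← ip_smul_right,
        ip_φ_smul_φ β h q g hs, sub_self, mul_zero]
    · intro r hr hrs
      obtain ⟨h1, h2⟩ := Finset.mem_Icc.1 hr
      rw [ip_smul_left]
      rcases lt_or_gt_of_ne hrs with hlt | hlt
      · rw [ip_comm (φ β h q g r), ih s (by omega) h1 hlt, mul_zero]
      · rw [ih r (by omega) hs hlt, mul_zero]
    · intro hn; exact absurd (Finset.mem_Icc.2 ⟨hs, by omega⟩) hn

theorem orthoSys_φ : OrthoSys (φ β h q g) where
  idem s hs := ip_φ_smul_φ β h q g hs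
  orth s t hs ht hst := by
    rcases lt_or_gt_of_ne hst with hlt | hlt
    · rw [ip_comm, ip_φ_φ_of_lt β h q g hs hlt]
    · exact ip_φ_φ_of_lt β h q g ht hlt

theorem nrm_φ_le_one {s : ℕ} (hs : 1 ≤ s) : nrm (φ β h q g s) ≤ 1 := by
  have h1 : ip (φ β h q g s) (φ β h q g s) * ip (φ β h q g s) (φ β h q g s) =
      ip (φ β h q g s) (φ β h q g s) := (orthoSys_φ β h q g).ip_self_mul hs _
  rw [← nrm_sq] at h1
  have h0 := nrm_nonneg (φ β h q g s)
  by_contra! hc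
  nlinarith [sq_nonneg (nrm (φ β h q g s) - 1), pow_pos (zero_lt_one.trans hc) 2]

theorem abs_m_le_one (hq : q ≤ 1) {k : ℕ} (hk : 1 ≤ k) (i : Fin N) : |m β h q g k i| ≤ 1 := by
  obtain ⟨k, rfl⟩ := Nat.exists_eq_add_of_le' hk
  rcases Nat.eq_zero_or_pos k with rfl | hk
  · rw [m_one, abs_of_nonneg (Real.sqrt_nonneg _)]
    exact Real.sqrt_le_one.2 hq
  · rw [m_succ β h q g hk, mNext]
    exact (Real.abs_tanh_lt_one _).le

/-- Removing the rows and columns in the direction `u` from a matrix. -/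
theorem sub_correction_eq (L : Level N) : L.g - L.correction =
    (1 - tens L.φ L.φ) * L.g * (1 - tens L.φ L.φ) := by
  rw [Matrix.sub_mul, Matrix.one_mul, Matrix.sub_mul, Matrix.mul_sub, Matrix.mul_sub,
    Matrix.mul_one, Matrix.mul_one, mul_tens, mul_tens, tens_mul, tens_mulVec, Level.correction,
    Level.ξ, Level.η, tens_smul_left, ip_mulVec_left, Matrix.transpose_transpose]
  abel

/-- The correction term is precisely what turns the subtraction into a two-sided compression by the
projection off the current direction. -/
theorem level_g_succ' {k : ℕ} (hk : 1 ≤ k) : (level β h q g (k + 1)).g =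
    (1 - tens (φ β h q g k) (φ β h q g k)) * (level β h q g k).g *
      (1 - tens (φ β h q g k) (φ β h q g k)) := by
  rw [level_g_succ β h q g hk, sub_correction_eq]; rfl

theorem mNext_congr {k : ℕ} (hk : 1 ≤ k) {L L' : ℕ → Level N}
    (hL : ∀ s, 1 ≤ s → s ≤ k → (L s).ζ = (L' s).ζ) :
    mNext β h q k L = mNext β h q k L' := by
  funext i
  have : ∑ s ∈ Finset.Ico 1 k, gamma β h q s * (L s).ζ i =
      ∑ s ∈ Finset.Ico 1 k, gamma β h q s * (L' s).ζ i := by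
    refine Finset.sum_congr rfl fun s hs => ?_
    rw [hL s (Finset.mem_Ico.1 hs).1 (Finset.mem_Ico.1 hs).2.le]
  rw [mNext, mNext, fieldNext, fieldNext, this, hL k hk le_rfl]

/-- A perturbation that vanishes on the first `k` directions does not change the first `k + 1`
levels, except that it is added to the matrix. -/
theorem level_add {k : ℕ} {B : Matrix (Fin N) (Fin N) ℝ}
    (hB : ∀ s, 1 ≤ s → s ≤ k → B *ᵥ φ β h q g s = 0)
    (hBt : ∀ s, 1 ≤ s → s ≤ k → Bᵀ *ᵥ φ β h q g s = 0) {s : ℕ} (hs : 1 ≤ s) (hsk : s ≤ k + 1) :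
    level β h q (g + B) s =
      ⟨(level β h q g s).g + B, (level β h q g s).φ, (level β h q g s).m⟩ := by
  induction s using Nat.strong_induction_on with
  | _ s ih =>
    obtain ⟨s, rfl⟩ := Nat.exists_eq_add_of_le' hs
    rcases Nat.eq_zero_or_pos s with rfl | hs0
    · simp [level_one]
    have hξ : ∀ r, 1 ≤ r → r ≤ s →
        (level β h q (g + B) r).ξ = (level β h q g r).ξ := fun r h1 h2 => by
      rw [ih r (by omega) h1 (by omega), Level.ξ, Level.ξ, Matrix.add_mulVec]
      exact (congrArg _ (hB r h1 (by omega))).trans (add_zero _)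
    have hη : ∀ r, 1 ≤ r → r ≤ s →
        (level β h q (g + B) r).η = (level β h q g r).η := fun r h1 h2 => by
      rw [ih r (by omega) h1 (by omega), Level.η, Level.η, Matrix.transpose_add,
        Matrix.add_mulVec]
      exact (congrArg _ (hBt r h1 (by omega))).trans (add_zero _)
    have hφ : ∀ r, 1 ≤ r → r ≤ s →
        (level β h q (g + B) r).φ = (level β h q g r).φ := fun r h1 h2 => by
      rw [ih r (by omega) h1 (by omega)]
    have hm : mNext β h q s (level β h q (g + B)) = mNext β h q s (level β h q g) :=
      mNext_congr β h q hs0 fun r h1 h2 => by rw [Level.ζ, Level.ζ, hξ r h1 h2, hη r h1 h2]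
    have hr : residual β h q s (level β h q (g + B)) = residual β h q s (level β h q g) := by
      rw [residual, residual, hm]
      congr 1
      refine Finset.sum_congr rfl fun r hr => ?_
      rw [hφ r (Finset.mem_Icc.1 hr).1 (Finset.mem_Icc.1 hr).2]
    have hg : (level β h q (g + B) s).g = (level β h q g s).g + B := by
      rw [ih s (by omega) hs0 (by omega)]
    rw [level_add_one β h q _ s hs0, level_add_one β h q g s hs0, levelNext, levelNext, hm, hr,
      Level.correction, Level.correction, hξ s hs0 le_rfl, hη s hs0 le_rfl, hφ s hs0 le_rfl, hg]
    simp only [Level.mk.injEq, and_self, and_true]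
    abel

theorem φ_add {k : ℕ} {B : Matrix (Fin N) (Fin N) ℝ}
    (hB : ∀ s, 1 ≤ s → s ≤ k → B *ᵥ φ β h q g s = 0)
    (hBt : ∀ s, 1 ≤ s → s ≤ k → Bᵀ *ᵥ φ β h q g s = 0) {s : ℕ} (hs : 1 ≤ s) (hsk : s ≤ k + 1) :
    φ β h q (g + B) s = φ β h q g s := by
  rw [φ, level_add β h q g hB hBt hs hsk, φ]

theorem m_add {k : ℕ} {B : Matrix (Fin N) (Fin N) ℝ}
    (hB : ∀ s, 1 ≤ s → s ≤ k → B *ᵥ φ β h q g s = 0)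
    (hBt : ∀ s, 1 ≤ s → s ≤ k → Bᵀ *ᵥ φ β h q g s = 0) {s : ℕ} (hs : 1 ≤ s) (hsk : s ≤ k + 1) :
    m β h q (g + B) s = m β h q g s := by
  rw [m, level_add β h q g hB hBt hs hsk, m]

end Levels

/-! ### The forward simulation -/

section Simulation

variable {N : ℕ}

/-- The part of the interaction matrix revealed in the direction `φ (k + 1)`, built from fresh
Gaussian vectors `z` and `v`. -/
def incr (φ : ℕ → Fin N → ℝ) (k : ℕ) (z v : Fin N → ℝ) : Matrix (Fin N) (Fin N) ℝ :=
  tens (projC φ k *ᵥ ((1 / √2) • (z + v))) (φ (k + 1)) +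
    tens (φ (k + 1)) (projC φ (k + 1) *ᵥ ((1 / √2) • (z - v)) +
      ip (φ (k + 1)) ((1 / √2) • (z + v)) • φ (k + 1)) -
    ip (φ (k + 1)) ((1 / √2) • (z + v)) • tens (φ (k + 1)) (φ (k + 1))

variable {φ : ℕ → Fin N → ℝ}

theorem incr_mulVec (H : OrthoSys φ) {k s : ℕ} (hs : 1 ≤ s) (hk : s ≤ k) (z v : Fin N → ℝ) :
    incr φ k z v *ᵥ φ s = 0 := by
  have h1 := H.orth (k + 1) s (by omega) hs (by omega)
  rw [incr, Matrix.sub_mulVec, Matrix.add_mulVec, Matrix.smul_mulVec, tens_mulVec, tens_mulVec,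
    tens_mulVec, ip_add_left, ip_smul_left, ip_projC, H.projC_mulVec_of_le hs (by omega), h1,
    ip_zero_right]
  simp

theorem incr_transpose_mulVec (H : OrthoSys φ) {k s : ℕ} (hs : 1 ≤ s) (hk : s ≤ k)
    (z v : Fin N → ℝ) : (incr φ k z v)ᵀ *ᵥ φ s = 0 := by
  have h1 := H.orth (k + 1) s (by omega) hs (by omega)
  rw [incr, Matrix.transpose_sub, Matrix.transpose_add, Matrix.transpose_smul, tens_transpose,
    tens_transpose, tens_transpose, Matrix.sub_mulVec, Matrix.add_mulVec, Matrix.smul_mulVec,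
    tens_mulVec, tens_mulVec, tens_mulVec, ip_projC, H.projC_mulVec_of_le hs (by omega), h1,
    ip_zero_right]
  simp

/-- Every term of the increment has `φ (k + 1)` as its left or right factor, so the two-sided
compression kills it. -/
theorem residual_incr (H : OrthoSys φ) (k : ℕ) (z v : Fin N → ℝ) :
    (1 - tens (φ (k + 1)) (φ (k + 1))) * incr φ k z v *
      (1 - tens (φ (k + 1)) (φ (k + 1))) = 0 := by
  have h1 : (1 - tens (φ (k + 1)) (φ (k + 1))) *ᵥ φ (k + 1) = 0 := by
    rw [Matrix.sub_mulVec, Matrix.one_mulVec, tens_mulVec, H.idem _ (by omega), sub_self]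
  have h2 : (1 - tens (φ (k + 1)) (φ (k + 1)))ᵀ = 1 - tens (φ (k + 1)) (φ (k + 1)) := by
    rw [Matrix.transpose_sub, tens_transpose, Matrix.transpose_one]
  generalize 1 - tens (φ (k + 1)) (φ (k + 1)) = P at h1 h2 ⊢
  rw [incr, Matrix.mul_sub, Matrix.mul_add, Matrix.mul_smul, mul_tens, mul_tens, mul_tens, h1,
    tens_zero_left, tens_zero_left, smul_zero, add_zero, sub_zero, tens_mul, h2, h1,
    tens_zero_right]

/-- The entry in the direction `φ (k + 1) ⊗ φ (k + 1)` occurs in both the column and the row and is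
subtracted once. What remains is a linear form in the two fresh vectors. -/
theorem pair_incr (A : Matrix (Fin N) (Fin N) ℝ) (k : ℕ) (z v : Fin N → ℝ) :
    pair A (incr φ k z v) = ip ((1 / √2) • (z + v)) (projC φ k *ᵥ (A *ᵥ φ (k + 1))) +
      ip ((1 / √2) • (z - v)) (projC φ (k + 1) *ᵥ (Aᵀ *ᵥ φ (k + 1))) := by
  rw [incr]
  generalize (1 / √2) • (z + v) = x
  generalize (1 / √2) • (z - v) = y
  rw [pair_sub_right, pair_add_right, pair_smul_right, pair_tens, pair_tens, pair_tens,
    ip_projC, Matrix.mulVec_add, ip_add_right, Matrix.mulVec_smul, ip_smul_right,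
    ip_comm _ (A *ᵥ (projC φ (k + 1) *ᵥ y)), ip_mulVec_left, ip_projC]
  ring

/-- With `x = (z + v) / √2` and `y = (z - v) / √2`, the symmetrized row and column involve `x + y =
√2 z`, except along `φ (k + 1)`, where `x - y = √2 v` also enters. For a unit direction the row and
column share their entry there, so the variance along it doubles; `v` supplies the extra unit. -/
theorem incr_mulVec_add (H : OrthoSys φ) (k : ℕ) (z v : Fin N → ℝ) :
    (1 / √2) • (incr φ k z v *ᵥ φ (k + 1) + (incr φ k z v)ᵀ *ᵥ φ (k + 1)) =
      ip (φ (k + 1)) (φ (k + 1)) • (projC φ k *ᵥ z + ip (φ (k + 1)) v • φ (k + 1)) := by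
  set u := φ (k + 1) with hu
  have hid : ip u u • u = u := H.idem _ (by omega)
  have h1 : projC φ k *ᵥ u = u := H.projC_mulVec_of_lt (by omega)
  have h2 : projC φ (k + 1) *ᵥ u = 0 := H.projC_mulVec_of_le (by omega) le_rfl
  have h3 : (1 / √2) * (1 / √2) = (1 / 2 : ℝ) := by
    rw [div_mul_div_comm, Real.mul_self_sqrt (by norm_num), one_mul]
  have key : ∀ x y : Fin N → ℝ,
      (tens (projC φ k *ᵥ x) u + tens u (projC φ (k + 1) *ᵥ y + ip u x • u) -
        ip u x • tens u u) *ᵥ u +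
      (tens (projC φ k *ᵥ x) u + tens u (projC φ (k + 1) *ᵥ y + ip u x • u) -
        ip u x • tens u u)ᵀ *ᵥ u =
      ip u u • (projC φ k *ᵥ (x + y) + ip u (x - y) • u) := by
    intro x y
    have hc : ∀ c : ℝ, ip u u • (c • u) = c • u := fun c => by rw [smul_comm, hid]
    rw [Matrix.transpose_sub, Matrix.transpose_add, Matrix.transpose_smul, tens_transpose,
      tens_transpose, tens_transpose, Matrix.sub_mulVec, Matrix.add_mulVec, Matrix.smul_mulVec,
      Matrix.sub_mulVec, Matrix.add_mulVec, Matrix.smul_mulVec, tens_mulVec, tens_mulVec,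
      tens_mulVec, tens_mulVec, tens_mulVec, ip_add_left, ip_projC, h2, ip_projC, h1,
      ip_zero_right, hid, ip_smul_left, projC_succ, Matrix.sub_mulVec, ← hu, tens_mulVec,
      ip_comm x u, ip_sub_right, Matrix.mulVec_add, zero_add, mul_smul, hid, sub_smul]
    simp only [smul_add, smul_sub, hc]
    abel
  have hk : incr φ k z v = tens (projC φ k *ᵥ ((1 / √2) • (z + v))) u +
      tens u (projC φ (k + 1) *ᵥ ((1 / √2) • (z - v)) + ip u ((1 / √2) • (z + v)) • u) -
        ip u ((1 / √2) • (z + v)) • tens u u := rfl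
  have e1 : (1 / √2) • ((1 / √2) • (z + v) + (1 / √2) • (z - v)) = z := by
    rw [← smul_add, smul_smul, h3, add_add_sub_cancel, ← two_smul ℝ z, smul_smul]; norm_num
  have e2 : (1 / √2) * ip u ((1 / √2) • (z + v) - (1 / √2) • (z - v)) = ip u v := by
    rw [← smul_sub, ip_smul_right, ← mul_assoc, h3, ip_sub_right, ip_add_right, ip_sub_right]
    ring
  rw [hk, key, smul_comm, smul_add, ← Matrix.mulVec_smul, e1, smul_smul, e2]

variable (β h q : ℝ)

/-- The part of the interaction matrix revealed in the first `k` steps of the construction, when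
the vectors `z k` and `v k` are used as the fresh randomness of step `k`. -/
def sim (z v : ℕ → Fin N → ℝ) : ℕ → Matrix (Fin N) (Fin N) ℝ
  | 0 => 0
  | k + 1 => sim z v k + incr (TAP.φ β h q (sim z v k)) k (z (k + 1)) (v (k + 1))

theorem φ_sim_succ (z v : ℕ → Fin N → ℝ) {k s : ℕ} (hs : 1 ≤ s) (hk : s ≤ k + 1) :
    TAP.φ β h q (sim β h q z v (k + 1)) s = TAP.φ β h q (sim β h q z v k) s :=
  φ_add β h q _ (fun _ h1 h2 => incr_mulVec (orthoSys_φ β h q _) h1 h2 _ _)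
    (fun _ h1 h2 => incr_transpose_mulVec (orthoSys_φ β h q _) h1 h2 _ _) hs hk

/-- The direction of index `k + 1` is already determined after `k` steps, before the noise of step
`k + 1` is used. -/
theorem φ_sim (z v : ℕ → Fin N → ℝ) {k l s : ℕ} (hs : 1 ≤ s) (hk : s ≤ k + 1) (hkl : k ≤ l) :
    TAP.φ β h q (sim β h q z v l) s = TAP.φ β h q (sim β h q z v k) s := by
  induction l, hkl using Nat.le_induction with
  | base => rfl
  | succ l hl ih => rw [φ_sim_succ β h q z v hs (by omega), ih]

/-- After `k` steps the simulated matrix is exhausted: it contains nothing beyond what the first `k`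
levels have revealed. -/
theorem level_sim_g (z v : ℕ → Fin N → ℝ) (k : ℕ) :
    (level β h q (sim β h q z v k) (k + 1)).g = 0 := by
  induction k with
  | zero => rw [level_one, sim]
  | succ k ih =>
    rw [level_g_succ' β h q _ (by omega), φ_sim_succ β h q z v (by omega) le_rfl]
    conv_lhs => enter [1, 2]; rw [sim, level_add β h q _ (k := k)
      (fun _ h1 h2 => incr_mulVec (orthoSys_φ β h q _) h1 h2 _ _)
      (fun _ h1 h2 => incr_transpose_mulVec (orthoSys_φ β h q _) h1 h2 _ _)
      (by omega) le_rfl]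
    rw [ih, zero_add]
    exact residual_incr (orthoSys_φ β h q _) k _ _

theorem level_sim_ζ_self (z v : ℕ → Fin N → ℝ) (k : ℕ) :
    (level β h q (sim β h q z v (k + 1)) (k + 1)).ζ =
      ip (TAP.φ β h q (sim β h q z v k) (k + 1)) (TAP.φ β h q (sim β h q z v k) (k + 1)) •
        (projC (TAP.φ β h q (sim β h q z v k)) k *ᵥ z (k + 1) +
          ip (TAP.φ β h q (sim β h q z v k) (k + 1)) (v (k + 1)) •
            TAP.φ β h q (sim β h q z v k) (k + 1)) := by
  rw [Level.ζ, Level.ξ, Level.η, sim, level_add β h q _ (k := k)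
      (fun _ h1 h2 => incr_mulVec (orthoSys_φ β h q _) h1 h2 _ _)
      (fun _ h1 h2 => incr_transpose_mulVec (orthoSys_φ β h q _) h1 h2 _ _)
      (by omega) le_rfl, level_sim_g, zero_add]
  exact incr_mulVec_add (orthoSys_φ β h q _) k _ _

/-- Later increments annihilate `φ (k + 1)` on both sides, so `ζ` keeps the value it received when
it was created. -/
theorem level_sim_ζ (z v : ℕ → Fin N → ℝ) {k l : ℕ} (hkl : k + 1 ≤ l) :
    (level β h q (sim β h q z v l) (k + 1)).ζ =
      ip (TAP.φ β h q (sim β h q z v k) (k + 1)) (TAP.φ β h q (sim β h q z v k) (k + 1)) •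
        (projC (TAP.φ β h q (sim β h q z v k)) k *ᵥ z (k + 1) +
          ip (TAP.φ β h q (sim β h q z v k) (k + 1)) (v (k + 1)) •
            TAP.φ β h q (sim β h q z v k) (k + 1)) := by
  rw [← level_sim_ζ_self]
  induction l, hkl using Nat.le_induction with
  | base => rfl
  | succ l hl ih =>
    rw [← ih]
    have hB := fun s (h1 : 1 ≤ s) (h2 : s ≤ l) => incr_mulVec
      (orthoSys_φ β h q (sim β h q z v l)) h1 h2 (z (l + 1)) (v (l + 1))
    have hBt := fun s (h1 : 1 ≤ s) (h2 : s ≤ l) => incr_transpose_mulVec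
      (orthoSys_φ β h q (sim β h q z v l)) h1 h2 (z (l + 1)) (v (l + 1))
    rw [Level.ζ, Level.ζ, Level.ξ, Level.ξ, Level.η, Level.η, sim,
      level_add β h q _ hB hBt (by omega) (by omega), Matrix.transpose_add, Matrix.add_mulVec,
      Matrix.add_mulVec]
    have e1 := hB (k + 1) (by omega) (by omega)
    have e2 := hBt (k + 1) (by omega) (by omega)
    rw [TAP.φ] at e1 e2
    rw [e1, e2, add_zero, add_zero]

theorem projC_mul_mul_mulVec (H : OrthoSys φ) {k s : ℕ} (hs : 1 ≤ s) (hk : s ≤ k)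
    (B : Matrix (Fin N) (Fin N) ℝ) : (projC φ k * B * projC φ k) *ᵥ φ s = 0 := by
  rw [← Matrix.mulVec_mulVec, H.projC_mulVec_of_le hs hk, Matrix.mulVec_zero]

theorem projC_mul_mul_transpose_mulVec (H : OrthoSys φ) {k s : ℕ} (hs : 1 ≤ s) (hk : s ≤ k)
    (B : Matrix (Fin N) (Fin N) ℝ) : (projC φ k * B * projC φ k)ᵀ *ᵥ φ s = 0 := by
  rw [Matrix.transpose_mul, Matrix.transpose_mul, projC_transpose, ← Matrix.mulVec_mulVec,
    ← Matrix.mulVec_mulVec, H.projC_mulVec_of_le hs hk, Matrix.mulVec_zero, Matrix.mulVec_zero]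

/-- The simulated interaction matrix: `k` steps of the simulation, completed by the residual of an
independent matrix `B`. -/
def simFull (z v : ℕ → Fin N → ℝ) (k : ℕ) (B : Matrix (Fin N) (Fin N) ℝ) :
    Matrix (Fin N) (Fin N) ℝ :=
  sim β h q z v k + projC (TAP.φ β h q (sim β h q z v k)) k * B *
    projC (TAP.φ β h q (sim β h q z v k)) k

theorem φ_simFull (z v : ℕ → Fin N → ℝ) {k s : ℕ} (B : Matrix (Fin N) (Fin N) ℝ) (hs : 1 ≤ s)
    (hk : s ≤ k + 1) :
    TAP.φ β h q (simFull β h q z v k B) s = TAP.φ β h q (sim β h q z v k) s :=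
  φ_add β h q _ (fun _ h1 h2 => projC_mul_mul_mulVec (orthoSys_φ β h q _) h1 h2 _)
    (fun _ h1 h2 => projC_mul_mul_transpose_mulVec (orthoSys_φ β h q _) h1 h2 _) hs hk

theorem m_simFull (z v : ℕ → Fin N → ℝ) {k s : ℕ} (B : Matrix (Fin N) (Fin N) ℝ) (hs : 1 ≤ s)
    (hk : s ≤ k + 1) :
    TAP.m β h q (simFull β h q z v k B) s = TAP.m β h q (sim β h q z v k) s :=
  m_add β h q _ (fun _ h1 h2 => projC_mul_mul_mulVec (orthoSys_φ β h q _) h1 h2 _)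
    (fun _ h1 h2 => projC_mul_mul_transpose_mulVec (orthoSys_φ β h q _) h1 h2 _) hs hk

end Simulation

/-! ### The hyperbolic tangent -/

theorem hasDerivAt_tanh (x : ℝ) : HasDerivAt Real.tanh (1 - Real.tanh x ^ 2) x := by
  have h := (Real.hasDerivAt_sinh x).div (Real.hasDerivAt_cosh x) (Real.cosh_pos x).ne'
  have e : Real.tanh = Real.sinh / Real.cosh := by
    funext y; exact Real.tanh_eq_sinh_div_cosh y
  have h2 : (Real.cosh x * Real.cosh x - Real.sinh x * Real.sinh x) / Real.cosh x ^ 2 =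
      1 - Real.tanh x ^ 2 := by
    have := (Real.cosh_pos x).ne'
    rw [Real.tanh_eq_sinh_div_cosh]
    field_simp
  rw [h2] at h
  rwa [e] at h ⊢

theorem continuous_tanh : Continuous Real.tanh :=
  continuous_iff_continuousAt.2 fun x => (hasDerivAt_tanh x).continuousAt

theorem abs_tanh_sub_le (x y : ℝ) : |Real.tanh x - Real.tanh y| ≤ |x - y| := by
  have h : LipschitzWith 1 Real.tanh :=
    lipschitzWith_of_nnnorm_deriv_le (fun x => (hasDerivAt_tanh x).differentiableAt) fun x => by
      rw [(hasDerivAt_tanh x).deriv, ← NNReal.coe_le_coe, coe_nnnorm, Real.norm_eq_abs,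
        NNReal.coe_one, abs_of_pos (by linarith [Real.tanh_sq_lt_one x])]
      linarith [sq_nonneg (Real.tanh x)]
  simpa [Real.dist_eq] using h.dist_le_mul x y

theorem strictMono_tanh : StrictMono Real.tanh :=
  strictMono_of_deriv_pos fun x => by
    rw [(hasDerivAt_tanh x).deriv]; linarith [Real.tanh_sq_lt_one x]

/-! ### Measurability -/

section Measurability

variable {N : ℕ} {α : Type*} [MeasurableSpace α]

instance matrixMeasurableSpace : MeasurableSpace (Matrix (Fin N) (Fin N) ℝ) :=
  inferInstanceAs (MeasurableSpace (Fin N → Fin N → ℝ))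

theorem measurable_matrix {f : α → Matrix (Fin N) (Fin N) ℝ}
    (hf : ∀ i j, Measurable fun a => f a i j) : Measurable f :=
  measurable_pi_lambda _ fun i => measurable_pi_lambda _ fun j => hf i j

theorem measurable_entry {f : α → Matrix (Fin N) (Fin N) ℝ} (hf : Measurable f) (i j : Fin N) :
    Measurable fun a => f a i j :=
  (measurable_pi_apply j).comp ((measurable_pi_apply (X := fun _ => Fin N → ℝ) i).comp hf)

theorem measurable_ip {x y : α → Fin N → ℝ} (hx : Measurable x) (hy : Measurable y) :
    Measurable fun a => ip (x a) (y a) := by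
  unfold ip; fun_prop

theorem measurable_nrm {x : α → Fin N → ℝ} (hx : Measurable x) :
    Measurable fun a => nrm (x a) :=
  Real.continuous_sqrt.measurable.comp (measurable_ip hx hx)

theorem measurable_tens {x y : α → Fin N → ℝ} (hx : Measurable x) (hy : Measurable y) :
    Measurable fun a => tens (x a) (y a) := by
  refine measurable_matrix fun i j => ?_
  simp only [tens, Matrix.of_apply]; fun_prop

theorem measurable_mulVec {A : α → Matrix (Fin N) (Fin N) ℝ} {x : α → Fin N → ℝ}
    (hA : Measurable A) (hx : Measurable x) : Measurable fun a => A a *ᵥ x a := by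
  refine measurable_pi_lambda _ fun i => ?_
  simp only [Matrix.mulVec, dotProduct]
  exact Finset.measurable_sum _ fun j _ =>
    (measurable_entry hA i j).mul ((measurable_pi_apply j).comp hx)

theorem measurable_matrix_transpose {A : α → Matrix (Fin N) (Fin N) ℝ} (hA : Measurable A) :
    Measurable fun a => (A a)ᵀ :=
  measurable_matrix fun i j => measurable_entry hA j i

theorem measurable_matrix_add {A B : α → Matrix (Fin N) (Fin N) ℝ} (hA : Measurable A)
    (hB : Measurable B) : Measurable fun a => A a + B a :=
  measurable_matrix fun i j => (measurable_entry hA i j).add (measurable_entry hB i j)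

theorem measurable_matrix_sub {A B : α → Matrix (Fin N) (Fin N) ℝ} (hA : Measurable A)
    (hB : Measurable B) : Measurable fun a => A a - B a :=
  measurable_matrix fun i j => (measurable_entry hA i j).sub (measurable_entry hB i j)

theorem measurable_matrix_smul {c : α → ℝ} {B : α → Matrix (Fin N) (Fin N) ℝ} (hc : Measurable c)
    (hB : Measurable B) : Measurable fun a => c a • B a :=
  measurable_matrix fun i j => hc.mul (measurable_entry hB i j)

theorem measurable_matrix_mul {A B : α → Matrix (Fin N) (Fin N) ℝ} (hA : Measurable A)
    (hB : Measurable B) : Measurable fun a => A a * B a := by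
  refine measurable_matrix fun i j => ?_
  simp only [Matrix.mul_apply]
  exact Finset.measurable_sum _ fun l _ => (measurable_entry hA i l).mul (measurable_entry hB l j)

theorem measurable_frob {A : α → Matrix (Fin N) (Fin N) ℝ} (hA : Measurable A) :
    Measurable fun a => frob (A a) :=
  Finset.measurable_sum _ fun i _ => Finset.measurable_sum _ fun j _ =>
    (measurable_entry hA i j).pow_const 2

theorem measurable_pair {A : α → Matrix (Fin N) (Fin N) ℝ} (B : Matrix (Fin N) (Fin N) ℝ)
    (hA : Measurable A) : Measurable fun a => pair B (A a) :=
  Finset.measurable_sum _ fun i _ => Finset.measurable_sum _ fun j _ =>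
    (measurable_entry hA i j).const_mul _

theorem measurable_projC {φ : α → ℕ → Fin N → ℝ} (hφ : ∀ s, 1 ≤ s → Measurable fun a => φ a s)
    (k : ℕ) : Measurable fun a => projC (φ a) k := by
  refine measurable_matrix fun i j => ?_
  simp only [projC, Matrix.sub_apply, Matrix.sum_apply]
  refine measurable_const.sub (Finset.measurable_sum _ fun s hs => ?_)
  have := hφ s (Finset.mem_Icc.1 hs).1
  exact measurable_entry (measurable_tens this this) i j

theorem measurable_incr {φ : α → ℕ → Fin N → ℝ} (hφ : ∀ s, 1 ≤ s → Measurable fun a => φ a s)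
    (k : ℕ) {z v : α → Fin N → ℝ} (hz : Measurable z) (hv : Measurable v) :
    Measurable fun a => incr (φ a) k (z a) (v a) := by
  have hu := hφ (k + 1) (by omega)
  have hx : Measurable fun a => (1 / √2) • (z a + v a) := (hz.add hv).const_smul (1 / √2)
  have hy : Measurable fun a => (1 / √2) • (z a - v a) := (hz.sub hv).const_smul (1 / √2)
  exact measurable_matrix_sub (measurable_matrix_add
    (measurable_tens (measurable_mulVec (measurable_projC hφ k) hx) hu)
    (measurable_tens hu ((measurable_mulVec (measurable_projC hφ (k + 1)) hy).add
      ((measurable_ip hu hx).smul hu))))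
    (measurable_matrix_smul (measurable_ip hu hx) (measurable_tens hu hu))

variable (β h q : ℝ)

/-- Freezing the simulated past against fresh noise requires the levels to be measurable functions
of the matrix. Normalization causes no trouble because inversion with `0⁻¹ = 0` is measurable. -/
theorem measurable_level (k : ℕ) (hk : 1 ≤ k) :
    (Measurable fun g : Matrix (Fin N) (Fin N) ℝ => (level β h q g k).g) ∧
    (Measurable fun g : Matrix (Fin N) (Fin N) ℝ => (level β h q g k).φ) ∧
    (Measurable fun g : Matrix (Fin N) (Fin N) ℝ => (level β h q g k).m) := by
  induction k using Nat.strong_induction_on with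
  | _ k ih =>
    obtain ⟨k, rfl⟩ := Nat.exists_eq_add_of_le' hk
    rcases Nat.eq_zero_or_pos k with rfl | hk0
    · simp only [zero_add, level_one]
      exact ⟨measurable_id, measurable_const, measurable_const⟩
    have hg := fun s (h1 : 1 ≤ s) (h2 : s ≤ k) => (ih s (by omega) h1).1
    have hφ := fun s (h1 : 1 ≤ s) (h2 : s ≤ k) => (ih s (by omega) h1).2.1
    have hξ := fun s (h1 : 1 ≤ s) (h2 : s ≤ k) => measurable_mulVec (hg s h1 h2) (hφ s h1 h2)
    have hη := fun s (h1 : 1 ≤ s) (h2 : s ≤ k) =>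
      measurable_mulVec (measurable_matrix_transpose (hg s h1 h2)) (hφ s h1 h2)
    have hζ := fun s (h1 : 1 ≤ s) (h2 : s ≤ k) =>
      ((hξ s h1 h2).add (hη s h1 h2)).const_smul (1 / √2)
    have hm : Measurable fun g : Matrix (Fin N) (Fin N) ℝ => mNext β h q k (level β h q g) := by
      refine measurable_pi_lambda _ fun i => ?_
      refine continuous_tanh.measurable.comp (Measurable.add (measurable_const.add
        (Measurable.const_mul (Finset.measurable_sum _ fun s hs => ?_) _)) ?_)
      · obtain ⟨h1, h2⟩ := Finset.mem_Ico.1 hs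
        exact ((measurable_pi_apply i).comp (hζ s h1 h2.le)).const_mul _
      · exact ((measurable_pi_apply i).comp (hζ k hk0 le_rfl)).const_mul _
    have hr : Measurable fun g : Matrix (Fin N) (Fin N) ℝ =>
        residual β h q k (level β h q g) := by
      refine hm.sub (Finset.measurable_fun_sum _ fun s hs => ?_)
      obtain ⟨h1, h2⟩ := Finset.mem_Icc.1 hs
      exact (measurable_ip hm (hφ s h1 h2)).smul (hφ s h1 h2)
    simp only [level_add_one β h q _ k hk0, levelNext]
    refine ⟨measurable_matrix_sub (hg k hk0 le_rfl) ?_, (measurable_nrm hr).inv.smul hr, hm⟩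
    exact measurable_matrix_sub (measurable_matrix_add
      (measurable_tens (hξ k hk0 le_rfl) (hφ k hk0 le_rfl))
      (measurable_tens (hφ k hk0 le_rfl) (hη k hk0 le_rfl)))
      (measurable_matrix_smul (measurable_ip (hφ k hk0 le_rfl) (hξ k hk0 le_rfl))
        (measurable_tens (hφ k hk0 le_rfl) (hφ k hk0 le_rfl)))

theorem measurable_φ {k : ℕ} (hk : 1 ≤ k) :
    Measurable fun g : Matrix (Fin N) (Fin N) ℝ => φ β h q g k :=
  (measurable_level β h q k hk).2.1

theorem measurable_m {k : ℕ} (hk : 1 ≤ k) :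
    Measurable fun g : Matrix (Fin N) (Fin N) ℝ => m β h q g k :=
  (measurable_level β h q k hk).2.2

theorem measurable_sim {z v : α → ℕ → Fin N → ℝ} (hz : Measurable z) (hv : Measurable v) (k : ℕ) :
    Measurable fun a => sim β h q (z a) (v a) k := by
  induction k with
  | zero => exact measurable_const
  | succ k ih =>
    exact measurable_matrix_add ih (measurable_incr (fun s hs => (measurable_φ β h q hs).comp ih) k
      ((measurable_pi_apply (k + 1)).comp hz) ((measurable_pi_apply (k + 1)).comp hv))

end Measurability

/-! ### Probabilistic preliminaries -/

section Prelim

variable {Ω : Type*} [MeasurableSpace Ω] {P : Measure Ω}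

theorem hasLaw_sum_gaussianReal [IsProbabilityMeasure P] {ι : Type*} {X : ι → Ω → ℝ} {v : ℝ≥0}
    (hX : ∀ i, HasLaw (X i) (gaussianReal 0 v) P) (hI : iIndepFun X P) (s : Finset ι) (a : ι → ℝ)
    {w : ℝ≥0} (hw : (w : ℝ) = v * ∑ i ∈ s, a i ^ 2) :
    HasLaw (fun ω => ∑ i ∈ s, a i * X i ω) (gaussianReal 0 w) P := by
  classical
  have hY : ∀ i, HasLaw (fun ω => a i * X i ω)
      (gaussianReal 0 (.mk (a i ^ 2) (sq_nonneg _) * v)) P :=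
    fun i => by simpa using gaussianReal_const_mul (hX i) (a i)
  have hI' : iIndepFun (fun i ω => a i * X i ω) P :=
    hI.comp (fun i x => a i * x) fun i => measurable_const_mul (a i)
  induction s using Finset.induction_on generalizing w with
  | empty =>
    have hw0 : w = 0 := by simpa using hw
    simp only [Finset.sum_empty, hw0, gaussianReal_zero_var]
    exact ⟨aemeasurable_const, by simp⟩
  | insert i s hi ih =>
    have ih := ih (w := v * ∑ i ∈ s, .mk (a i ^ 2) (sq_nonneg _)) (by push_cast; rfl)
    have hind := (hI'.indepFun_finsetSum_of_notMem₀ (fun j => (hY j).aemeasurable) hi).symm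
    have e : (∑ j ∈ s, fun ω => a j * X j ω) = fun ω => ∑ j ∈ s, a j * X j ω := by
      ext ω; simp
    rw [e] at hind
    have := gaussianReal_add_gaussianReal_of_indepFun hind (hY i).map_eq ih.map_eq
    refine ⟨?_, ?_⟩
    · simp only [Finset.sum_insert hi]; exact (hY i).aemeasurable.add ih.aemeasurable
    · have e2 : (fun ω => ∑ j ∈ insert i s, a j * X j ω) =
          (fun ω => a i * X i ω) + fun ω => ∑ j ∈ s, a j * X j ω := by
        ext ω; simp [Finset.sum_insert hi]
      rw [e2, this, add_zero]
      congr 1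
      rw [← NNReal.coe_inj, hw, Finset.sum_insert hi]
      push_cast
      ring

theorem integral_exp_of_hasLaw_gaussianReal {U : Ω → ℝ} {v : ℝ≥0}
    (hU : HasLaw U (gaussianReal 0 v) P) :
    ∫ ω, Complex.exp (U ω * Complex.I) ∂P = Complex.exp (-(v : ℝ) / 2 : ℝ) := by
  have h1 := charFun_gaussianReal (μ := 0) (v := v) 1
  rw [charFun_apply_real] at h1
  have h2 := hU.integral_comp (f := fun x : ℝ => Complex.exp (x * Complex.I))
    (by fun_prop)
  simp only [Function.comp_def] at h2
  rw [h2]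
  simp only [Complex.ofReal_one, one_mul] at h1
  rw [h1]
  congr 1
  push_cast
  ring

theorem measureReal_abs_ge_le_of_hasLaw_gaussianReal [IsProbabilityMeasure P] {U : Ω → ℝ}
    {v : ℝ≥0} {c : ℝ} (hU : HasLaw U (gaussianReal 0 v) P) (hc : 0 ≤ c) (hv : v * c ≤ 1) {t : ℝ}
    (ht : 0 ≤ t) : P.real {ω | t ≤ |U ω|} ≤ 2 * Real.exp (-(1 / 2 * t ^ 2 * c)) := by
  -- For `c = 0` the bound is `2` and there is nothing to prove; otherwise the variance is at most
  -- `c⁻¹` and the Chernoff bound applies.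
  rcases hc.eq_or_lt with rfl | hc
  · simp only [mul_zero, neg_zero, Real.exp_zero]
    exact measureReal_le_one.trans (by norm_num)
  have key : ∀ W : Ω → ℝ, HasLaw W (gaussianReal 0 v) P →
      P.real {ω | t ≤ W ω} ≤ Real.exp (-(1 / 2 * t ^ 2 * c)) := fun W hW => by
    have hsub : HasSubgaussianMGF W (.mk c⁻¹ (by positivity)) P :=
      { integrable_exp_mul := fun s => by
          have := integrable_exp_mul_gaussianReal (μ := 0) (v := v) s
          rw [← hW.map_eq] at this
          exact this.comp_aemeasurable hW.aemeasurable
        mgf_le := fun s => by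
          rw [mgf_gaussianReal hW.map_eq, zero_mul, zero_add]
          refine Real.exp_le_exp.2 ?_
          have : (v : ℝ) ≤ c⁻¹ := by rw [← one_div]; exact (le_div_iff₀ hc).2 hv
          have h2 : (v : ℝ) * s ^ 2 ≤ c⁻¹ * s ^ 2 := by gcongr
          simp only [NNReal.coe_mk]
          linarith }
    refine (hsub.measure_ge_le ht).trans (le_of_eq ?_)
    congr 1
    simp only [NNReal.coe_mk]
    field_simp
  have hneg : HasLaw (fun ω => -U ω) (gaussianReal 0 v) P := by
    have := gaussianReal_neg hU
    rwa [neg_zero] at this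
  calc P.real {ω | t ≤ |U ω|} ≤ P.real ({ω | t ≤ U ω} ∪ {ω | t ≤ -U ω}) :=
        measureReal_mono fun ω hω => by simpa [le_abs] using hω
    _ ≤ _ := measureReal_union_le _ _
    _ ≤ _ := by linarith [key U hU, key _ hneg]

/-- Fubini in the form used to freeze the past `X` while integrating over the fresh noise `Y`. -/
theorem integral_of_indepFun [IsProbabilityMeasure P] {α γ : Type*} [MeasurableSpace α]
    [MeasurableSpace γ] {X : Ω → α} {Y : Ω → γ} (hXY : IndepFun X Y P) (hX : Measurable X)
    (hY : Measurable Y) {F : α × γ → ℂ} (hF : Measurable F) (hb : ∀ p, ‖F p‖ ≤ 1) :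
    ∫ ω, F (X ω, Y ω) ∂P = ∫ ω, ∫ ω', F (X ω, Y ω') ∂P ∂P := by
  have h1 := hXY.map_prod_eq_prod_map_map hX.aemeasurable hY.aemeasurable
  have : IsProbabilityMeasure (P.map X) := Measure.isProbabilityMeasure_map hX.aemeasurable
  have : IsProbabilityMeasure (P.map Y) := Measure.isProbabilityMeasure_map hY.aemeasurable
  rw [← integral_map (φ := fun ω => (X ω, Y ω)) (hX.prodMk hY).aemeasurable
    hF.aestronglyMeasurable, h1, integral_prod _ (Integrable.of_bound hF.aestronglyMeasurable 1
      (ae_of_all _ hb)), integral_map hX.aemeasurable]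
  · refine integral_congr_ae (ae_of_all _ fun ω => ?_)
    exact integral_map hY.aemeasurable (hF.comp measurable_prodMk_left).aestronglyMeasurable
  · exact (hF.stronglyMeasurable.integral_prod_right' (ν := P.map Y)).aestronglyMeasurable

/-- A tail bound uniform over frozen values of `X` survives averaging over `X`. This replaces a
conditional probability. -/
theorem measureReal_le_of_indepFun [IsProbabilityMeasure P] {α γ : Type*} [MeasurableSpace α]
    [MeasurableSpace γ] {X : Ω → α} {Y : Ω → γ} (hXY : IndepFun X Y P) (hX : Measurable X)
    (hY : Measurable Y) {p : α → γ → Prop} (hp : MeasurableSet {x : α × γ | p x.1 x.2}) {c : ℝ}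
    (hc : 0 ≤ c) (hb : ∀ ω, P.real {ω' | p (X ω) (Y ω')} ≤ c) :
    P.real {ω | p (X ω) (Y ω)} ≤ c := by
  have h1 := hXY.map_prod_eq_prod_map_map hX.aemeasurable hY.aemeasurable
  have : IsProbabilityMeasure (P.map X) := Measure.isProbabilityMeasure_map hX.aemeasurable
  have : IsProbabilityMeasure (P.map Y) := Measure.isProbabilityMeasure_map hY.aemeasurable
  have h2 : P {ω | p (X ω) (Y ω)} = (P.map fun ω => (X ω, Y ω)) {x | p x.1 x.2} :=
    (Measure.map_apply (hX.prodMk hY) hp).symm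
  rw [measureReal_def, h2, h1, Measure.prod_apply hp,
    lintegral_map (measurable_measure_prodMk_left hp) hX]
  refine ENNReal.toReal_le_of_le_ofReal hc ?_
  calc ∫⁻ ω, (P.map Y) (Prod.mk (X ω) ⁻¹' {x | p x.1 x.2}) ∂P ≤ ∫⁻ _, ENNReal.ofReal c ∂P := by
        refine lintegral_mono fun ω => ?_
        rw [Measure.map_apply hY (measurable_prodMk_left hp)]
        rw [← ENNReal.ofReal_toReal (measure_ne_top P _)]
        exact ENNReal.ofReal_le_ofReal (hb ω)
    _ = ENNReal.ofReal c := by simp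

end Prelim

/-! ### The noise space -/

/-- Sample space of the simulation: `ω i (k, true)` and `ω i (k, false)` are the `i`-th coordinates
of the two Gaussian vectors used at level `k`. -/
abbrev Noise : Type := ℕ → ℕ × Bool → ℝ

/-- The law of a standard Gaussian array. -/
def noise : Measure Noise :=
  Measure.infinitePi fun _ : ℕ => Measure.infinitePi fun _ : ℕ × Bool => gaussianReal 0 1

instance isProbabilityMeasure_noise : IsProbabilityMeasure noise := by
  unfold noise; infer_instance

theorem iIndepFun_coord : iIndepFun (fun (p : ℕ × ℕ × Bool) (ω : Noise) => ω p.1 p.2) noise :=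
  iIndepFun_uncurry_infinitePi' (X := fun (_ : ℕ) (_ : ℕ × Bool) (x : ℝ) => x)
    (fun _ _ => gaussianReal 0 1) fun _ _ => measurable_id

theorem iIndepFun_comp_coord {γ : Type*} [MeasurableSpace γ] {f : (ℕ × Bool → ℝ) → γ}
    (hf : Measurable f) : iIndepFun (fun (i : ℕ) (ω : Noise) => f (ω i)) noise :=
  iIndepFun_infinitePi (X := fun _ => f) fun _ => hf

theorem measurable_coord (p : ℕ × ℕ × Bool) : Measurable fun ω : Noise => ω p.1 p.2 := by
  fun_prop

theorem hasLaw_row (i : ℕ) : HasLaw (fun ω : Noise => ω i)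
    (Measure.infinitePi fun _ : ℕ × Bool => gaussianReal 0 1) noise :=
  (measurePreserving_eval_infinitePi
    (fun _ : ℕ => Measure.infinitePi fun _ : ℕ × Bool => gaussianReal 0 1) i).hasLaw

theorem hasLaw_coord (p : ℕ × ℕ × Bool) :
    HasLaw (fun ω : Noise => ω p.1 p.2) (gaussianReal 0 1) noise :=
  (measurePreserving_eval_infinitePi (fun _ : ℕ × Bool => gaussianReal 0 1) p.2).hasLaw.comp
    (hasLaw_row p.1)

theorem comap_le_iSup_coord {α : Type*} [MeasurableSpace α] {F : Noise → α} (hF : Measurable F)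
    {U : Set (ℕ × ℕ × Bool)}
    (hU : ∀ ω ω' : Noise, (∀ p ∈ U, ω p.1 p.2 = ω' p.1 p.2) → F ω = F ω') :
    MeasurableSpace.comap F inferInstance ≤
      ⨆ p ∈ U, MeasurableSpace.comap (fun ω : Noise => ω p.1 p.2) inferInstance := by
  classical
  -- Resetting the coordinates outside `U` to zero does not change `F`, and the reset map is
  -- measurable for the σ-algebra generated by the coordinates in `U`.
  let r : Noise → Noise := fun ω i p => if (i, p) ∈ U then ω i p else 0
  have hr : F = F ∘ r := funext fun ω => hU _ _ fun p hp => by simp [r, hp]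
  have hrm : @Measurable _ _ (⨆ p ∈ U, MeasurableSpace.comap
      (fun ω : Noise => ω p.1 p.2) inferInstance) _ r := by
    refine @measurable_pi_lambda _ _ _ (_) _ _ fun i => @measurable_pi_lambda _ _ _ (_) _ _
      fun p => ?_
    by_cases hp : (i, p) ∈ U
    · simp only [r, hp, if_true]
      refine Measurable.mono (comap_measurable fun ω : Noise => ω i p) ?_ le_rfl
      exact le_iSup₂_of_le (i, p) hp le_rfl
    · simp only [r, hp, if_false]
      exact @measurable_const _ _ _ (_) _
  rw [hr]
  exact (@Measurable.comp _ _ _ (_) _ _ _ _ hF hrm).comap_le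

/-- Functions of disjoint sets of coordinates are independent. -/
theorem indepFun_of_disjoint {α γ : Type*} [MeasurableSpace α] [MeasurableSpace γ]
    {f : Noise → α} {f' : Noise → γ} (hf : Measurable f) (hf' : Measurable f')
    {S T : Set (ℕ × ℕ × Bool)} (hST : Disjoint S T)
    (hfS : ∀ ω ω' : Noise, (∀ p ∈ S, ω p.1 p.2 = ω' p.1 p.2) → f ω = f ω')
    (hfT : ∀ ω ω' : Noise, (∀ p ∈ T, ω p.1 p.2 = ω' p.1 p.2) → f' ω = f' ω') :
    IndepFun f f' noise := by
  rw [IndepFun_iff_Indep]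
  exact indep_of_indep_of_le_left (indep_of_indep_of_le_right
    (indep_iSup_of_disjoint (fun p => (measurable_coord p).comap_le) iIndepFun_coord hST)
    (comap_le_iSup_coord hf' hfT)) (comap_le_iSup_coord hf hfS)

/-- The vector `z k` of the noise. -/
def noiseZ (N : ℕ) (ω : Noise) (k : ℕ) : Fin N → ℝ := fun i => ω i (k, true)

/-- The vector `v k` of the noise. -/
def noiseV (N : ℕ) (ω : Noise) (k : ℕ) : Fin N → ℝ := fun i => ω i (k, false)

theorem measurable_noiseZ (N : ℕ) : Measurable (noiseZ N) := by unfold noiseZ; fun_prop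

theorem measurable_noiseV (N : ℕ) : Measurable (noiseV N) := by unfold noiseV; fun_prop

/-! ### The simulation driven by the noise and its characteristic function -/

section

variable {N : ℕ} (β h q : ℝ)

theorem sim_congr {z z' v v' : ℕ → Fin N → ℝ} {k : ℕ} (hz : ∀ s ≤ k, z s = z' s)
    (hv : ∀ s ≤ k, v s = v' s) : sim β h q z v k = sim β h q z' v' k := by
  induction k with
  | zero => rfl
  | succ k ih =>
    rw [sim, sim, ih (fun s hs => hz s (by omega)) (fun s hs => hv s (by omega)),
      hz _ le_rfl, hv _ le_rfl]

variable (N) in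
/-- The simulation driven by the noise. -/
def simN (ω : Noise) (k : ℕ) : Matrix (Fin N) (Fin N) ℝ :=
  sim β h q (noiseZ N ω) (noiseV N ω) k

theorem measurable_simN (k : ℕ) : Measurable fun ω => simN N β h q ω k :=
  measurable_sim β h q (measurable_noiseZ N) (measurable_noiseV N) k

/-- The first `k` steps read noise of index at most `k` only. -/
theorem indepFun_simN (k : ℕ) : IndepFun (fun ω => simN N β h q ω k)
    (fun ω => (noiseZ N ω (k + 1), noiseV N ω (k + 1))) noise := by
  refine indepFun_of_disjoint (S := {p | p.2.1 ≤ k}) (T := {p | p.2.1 = k + 1})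
    (measurable_simN β h q k)
    (((measurable_pi_apply (k + 1)).comp (measurable_noiseZ N)).prodMk
      ((measurable_pi_apply (k + 1)).comp (measurable_noiseV N))) ?_ ?_ ?_
  · rw [Set.disjoint_left]
    intro p hp hp'
    simp only [Set.mem_ofPred_eq] at hp hp'
    omega
  · intro ω ω' hω
    exact sim_congr β h q (fun s hs => funext fun i => hω (i, s, true) hs)
      (fun s hs => funext fun i => hω (i, s, false) hs)
  · intro ω ω' hω
    refine Prod.ext (funext fun i => hω (i, k + 1, true) rfl)
      (funext fun i => hω (i, k + 1, false) rfl)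

theorem hasLaw_ip_noise (k : ℕ) (c d : Fin N → ℝ) {w : ℝ≥0}
    (hw : (w : ℝ) = (ip c c + ip d d) / N) :
    HasLaw (fun ω => ip c (noiseZ N ω k) + ip d (noiseV N ω k)) (gaussianReal 0 w) noise := by
  let e : Fin N × Bool → ℕ × ℕ × Bool := fun p => (p.1, k, p.2)
  have he : Function.Injective e := fun p p' hpp => by
    simp only [e, Prod.mk.injEq] at hpp
    exact Prod.ext (Fin.ext hpp.1) hpp.2.2
  let a : Fin N × Bool → ℝ := fun p => (1 / (N : ℝ)) * (if p.2 then c p.1 else d p.1)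
  have hlaw := hasLaw_sum_gaussianReal (P := noise) (v := 1) (w := w)
    (X := fun (p : Fin N × Bool) (ω : Noise) => ω (e p).1 (e p).2)
    (fun p => hasLaw_coord (e p)) (iIndepFun_coord.precomp he) Finset.univ a (by
      rw [hw, Fintype.sum_prod_type]
      simp only [a, Fintype.sum_bool, if_true, ip, Bool.false_eq_true, if_false, NNReal.coe_one,
        one_mul, Finset.sum_add_distrib, mul_pow, ← Finset.mul_sum, ← sq]
      ring)
  refine hlaw.congr (ae_of_all _ fun ω => ?_)
  simp only [Fintype.sum_prod_type, a, e, Fintype.sum_bool, if_true, ip, Bool.false_eq_true,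
    if_false, Finset.sum_add_distrib, Finset.mul_sum, mul_assoc, noiseZ, noiseV]

/-- The increment pairs with `A` as a centered Gaussian, whose variance is `1 / N` times the amount
by which the squared Frobenius norm of the compressed `A` drops when one more direction is removed.
-/
theorem integral_exp_pair_incr {φ : ℕ → Fin N → ℝ} (H : OrthoSys φ)
    (A : Matrix (Fin N) (Fin N) ℝ) (k : ℕ) :
    (∫ ω, Complex.exp (pair A (incr φ k (noiseZ N ω (k + 1)) (noiseV N ω (k + 1))) * Complex.I)
      ∂noise) * Complex.exp (-(frob (projC φ (k + 1) * A * projC φ (k + 1)) / (2 * N)) : ℝ) =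
    Complex.exp (-(frob (projC φ k * A * projC φ k) / (2 * N)) : ℝ) := by
  set a := projC φ k *ᵥ (A *ᵥ φ (k + 1)) with ha
  set b := projC φ (k + 1) *ᵥ (Aᵀ *ᵥ φ (k + 1)) with hb
  -- `c` and `d` are the coefficients of `z` and `v`. They come from `a` and `b` by an orthogonal
  -- change of coordinates, so the variance is unaffected.
  set c := (1 / √2) • (a + b) with hc
  set d := (1 / √2) • (a - b) with hd
  have h3 : (1 / √2) * (1 / √2) = (1 / 2 : ℝ) := by
    rw [div_mul_div_comm, Real.mul_self_sqrt (by norm_num), one_mul]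
  have hcd : ip c c + ip d d = ip a a + ip b b := by
    rw [hc, hd, ip_smul_left, ip_smul_right, ip_smul_left, ip_smul_right, ← mul_assoc,
      ← mul_assoc, h3]
    simp only [ip_add_left, ip_add_right, ip_sub_left, ip_sub_right]
    ring
  have hpair : ∀ ω : Noise, pair A (incr φ k (noiseZ N ω (k + 1)) (noiseV N ω (k + 1))) =
      ip c (noiseZ N ω (k + 1)) + ip d (noiseV N ω (k + 1)) := fun ω => by
    rw [pair_incr, ← ha, ← hb, hc, hd]
    simp only [ip_smul_left, ip_add_left, ip_sub_left]
    rw [ip_comm _ a, ip_comm _ b, ip_comm _ a, ip_comm _ b]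
    ring
  have hw0 : 0 ≤ (ip c c + ip d d) / N :=
    div_nonneg (add_nonneg (ip_self_nonneg c) (ip_self_nonneg d)) (Nat.cast_nonneg N)
  have hlaw := hasLaw_ip_noise (k + 1) c d (w := .mk _ hw0) rfl
  simp only [hpair]
  rw [integral_exp_of_hasLaw_gaussianReal hlaw, ← Complex.exp_add, ← Complex.ofReal_add]
  congr 2
  rw [NNReal.coe_mk, hcd, H.frob_projC A k, ← ha, ← hb]
  ring

theorem norm_exp_mul_exp_neg_le (x y : ℝ) (hy : 0 ≤ y) :
    ‖Complex.exp (x * Complex.I) * Complex.exp (-y : ℝ)‖ ≤ 1 := by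
  rw [norm_mul, Complex.norm_exp_ofReal_mul_I, one_mul, Complex.norm_exp_ofReal]
  exact Real.exp_le_one_iff.2 (by linarith)

theorem frob_nonneg (A : Matrix (Fin N) (Fin N) ℝ) : 0 ≤ frob A :=
  Finset.sum_nonneg fun _ _ => Finset.sum_nonneg fun _ _ => sq_nonneg _

/-- The characteristic function of the completed simulation does not depend on the number of
simulated steps. -/
theorem integral_charFun_sim (A : Matrix (Fin N) (Fin N) ℝ) (k : ℕ) :
    ∫ ω, Complex.exp (pair A (simN N β h q ω k) * Complex.I) *
      Complex.exp (-(frob (projC (φ β h q (simN N β h q ω k)) k * A *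
        projC (φ β h q (simN N β h q ω k)) k) / (2 * N)) : ℝ) ∂noise =
    Complex.exp (-(frob A / (2 * N)) : ℝ) := by
  induction k with
  -- Nothing has been simulated and nothing projected away, so the integrand is the constant on the
  -- right.
  | zero => simp [simN, sim, projC_zero, pair]
  | succ k ih =>
    rw [← ih]
    let D : Matrix (Fin N) (Fin N) ℝ → Matrix (Fin N) (Fin N) ℝ := fun S =>
      projC (φ β h q S) (k + 1) * A * projC (φ β h q S) (k + 1)
    let F : Matrix (Fin N) (Fin N) ℝ × (Fin N → ℝ) × (Fin N → ℝ) → ℂ := fun p =>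
      Complex.exp (pair A (p.1 + incr (φ β h q p.1) k p.2.1 p.2.2) * Complex.I) *
        Complex.exp (-(frob (D p.1) / (2 * N)) : ℝ)
    have hD : Measurable D := by
      have := measurable_projC (fun s hs => measurable_φ (N := N) β h q hs) (k + 1)
      exact measurable_matrix_mul (measurable_matrix_mul this measurable_const) this
    have hF : Measurable F := by
      have h1 : Measurable fun p : Matrix (Fin N) (Fin N) ℝ × (Fin N → ℝ) × (Fin N → ℝ) =>
          pair A (p.1 + incr (φ β h q p.1) k p.2.1 p.2.2) :=
        measurable_pair A (measurable_matrix_add measurable_fst (measurable_incr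
          (fun s hs => (measurable_φ β h q hs).comp measurable_fst) k
          (measurable_fst.comp measurable_snd) (measurable_snd.comp measurable_snd)))
      have h2 : Measurable fun p : Matrix (Fin N) (Fin N) ℝ × (Fin N → ℝ) × (Fin N → ℝ) =>
          frob (D p.1) := measurable_frob (hD.comp measurable_fst)
      fun_prop
    have hb : ∀ p, ‖F p‖ ≤ 1 := fun p => norm_exp_mul_exp_neg_le _ _
      (div_nonneg (frob_nonneg _) (by positivity))
    have hsucc : ∀ ω : Noise, Complex.exp (pair A (simN N β h q ω (k + 1)) * Complex.I) *
      Complex.exp (-(frob (projC (φ β h q (simN N β h q ω (k + 1))) (k + 1) * A *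
        projC (φ β h q (simN N β h q ω (k + 1))) (k + 1)) / (2 * N)) : ℝ) =
        F (simN N β h q ω k, (noiseZ N ω (k + 1), noiseV N ω (k + 1))) := fun ω => by
      -- The projection of index `k + 1` depends only on directions fixed after `k` steps, so the
      -- damping factor is a function of the frozen past.
      have hp : projC (φ β h q (simN N β h q ω (k + 1))) (k + 1) =
          projC (φ β h q (simN N β h q ω k)) (k + 1) :=
        projC_congr fun s h1 h2 => φ_sim_succ β h q _ _ h1 h2
      rw [hp]; rfl
    simp only [hsucc]
    rw [integral_of_indepFun (indepFun_simN β h q k) (measurable_simN β h q k)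
      (((measurable_pi_apply (k + 1)).comp (measurable_noiseZ N)).prodMk
      ((measurable_pi_apply (k + 1)).comp (measurable_noiseV N))) hF hb]
    refine integral_congr_ae (ae_of_all _ fun ω => ?_)
    simp only [F]
    rw [← integral_exp_pair_incr (orthoSys_φ β h q (simN N β h q ω k)) A k, ← mul_assoc,
      ← integral_const_mul, ← integral_mul_const]
    refine integral_congr_ae (ae_of_all _ fun ω' => ?_)
    simp only
    rw [pair_add_right, Complex.ofReal_add, add_mul, Complex.exp_add]

end

/-! ### The simulated matrix has the law of the interaction matrix -/

section Transfer

variable {Ω : Type*} [MeasurableSpace Ω] {P : Measure Ω} {N : ℕ}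
  {g : Ω → Matrix (Fin N) (Fin N) ℝ}

theorem aemeasurable_matrix (hg : ∀ i j : Fin N,
    HasLaw (fun ω => g ω i j) (gaussianReal 0 (1 / (N : ℝ≥0))) P) : AEMeasurable g P :=
  aemeasurable_pi_lambda (X := fun _ => Fin N → ℝ) (fun ω i => g ω i) fun i =>
    aemeasurable_pi_lambda (fun ω j => g ω i j) fun j => (hg i j).aemeasurable

variable [IsProbabilityMeasure P]

theorem integral_exp_pair (hg : ∀ i j : Fin N,
      HasLaw (fun ω => g ω i j) (gaussianReal 0 (1 / (N : ℝ≥0))) P)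
    (hI : iIndepFun (fun (p : Fin N × Fin N) (ω : Ω) => g ω p.1 p.2) P)
    (A : Matrix (Fin N) (Fin N) ℝ) :
    ∫ ω, Complex.exp (pair A (g ω) * Complex.I) ∂P =
      Complex.exp (-(frob A / (2 * N)) : ℝ) := by
  have hw0 : 0 ≤ (1 / (N : ℝ)) * ∑ p : Fin N × Fin N, A p.1 p.2 ^ 2 := by positivity
  have hlaw := hasLaw_sum_gaussianReal (fun p : Fin N × Fin N => hg p.1 p.2) hI Finset.univ
    (fun p : Fin N × Fin N => A p.1 p.2) (w := .mk _ hw0) (by simp)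
  have := integral_exp_of_hasLaw_gaussianReal hlaw
  simp only [Fintype.sum_prod_type] at this
  simp only [pair]
  rw [this, NNReal.coe_mk, frob]
  congr 2
  ring

/-- Every linear functional on matrices is a pairing with some matrix, so these integrals form the
full characteristic function. -/
theorem ext_of_integral_exp_pair {μ ν : Measure (Fin N → Fin N → ℝ)} [IsFiniteMeasure μ]
    [IsFiniteMeasure ν] (H : ∀ A : Matrix (Fin N) (Fin N) ℝ,
      ∫ B : Fin N → Fin N → ℝ, Complex.exp (pair A B * Complex.I) ∂μ =
        ∫ B : Fin N → Fin N → ℝ, Complex.exp (pair A B * Complex.I) ∂ν) : μ = ν := by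
  refine Measure.ext_of_charFunDual ?_
  ext L
  let A : Matrix (Fin N) (Fin N) ℝ := fun i j => L (Pi.single i (Pi.single j 1))
  have hL : ∀ B : Fin N → Fin N → ℝ, L B = pair A B := fun B => by
    have hB : B = ∑ i, ∑ j, B i j • (Pi.single i (Pi.single j (1 : ℝ)) : Fin N → Fin N → ℝ) := by
      ext a b
      simp only [Finset.sum_apply, Pi.smul_apply, Pi.single_apply, smul_eq_mul]
      rw [Finset.sum_eq_single a, Finset.sum_eq_single b]
      · simp
      · intro j _ hj; simp [hj.symm]
      · simp
      · intro i _ hi; simp [hi.symm]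
      · simp
    conv_lhs => rw [hB]
    simp only [map_sum, map_smul, smul_eq_mul, pair, A]
    exact Finset.sum_congr rfl fun _ _ => Finset.sum_congr rfl fun _ _ => mul_comm _ _
  rw [charFunDual_apply, charFunDual_apply]
  simp only [hL]
  exact H A

/-- The completed simulation has the same law as the interaction matrix. -/
theorem map_simFull (β h q : ℝ) (hg : ∀ i j : Fin N,
      HasLaw (fun ω => g ω i j) (gaussianReal 0 (1 / (N : ℝ≥0))) P)
    (hI : iIndepFun (fun (p : Fin N × Fin N) (ω : Ω) => g ω p.1 p.2) P) (k : ℕ) :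
    AEMeasurable (fun p : Noise × Ω =>
      simFull β h q (noiseZ N p.1) (noiseV N p.1) k (g p.2)) (noise.prod P) ∧
    (noise.prod P).map (fun p : Noise × Ω =>
      simFull β h q (noiseZ N p.1) (noiseV N p.1) k (g p.2)) = P.map g := by
  have hgm := aemeasurable_matrix hg
  let G : Noise × Matrix (Fin N) (Fin N) ℝ → Matrix (Fin N) (Fin N) ℝ := fun p =>
    simFull β h q (noiseZ N p.1) (noiseV N p.1) k p.2
  have hG : Measurable G := by
    have h1 : Measurable fun p : Noise × Matrix (Fin N) (Fin N) ℝ => simN N β h q p.1 k :=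
      (measurable_simN β h q k).comp measurable_fst
    have h2 := measurable_projC (fun s hs => (measurable_φ (N := N) β h q hs).comp h1) k
    exact measurable_matrix_add h1
      (measurable_matrix_mul (measurable_matrix_mul h2 measurable_snd) h2)
  have hae : AEMeasurable (fun p : Noise × Ω =>
      simFull β h q (noiseZ N p.1) (noiseV N p.1) k (g p.2)) (noise.prod P) :=
    hG.comp_aemeasurable (measurable_fst.aemeasurable.prodMk
      (hgm.comp_quasiMeasurePreserving Measure.quasiMeasurePreserving_snd))
  refine ⟨hae, ?_⟩
  have i1 : IsFiniteMeasure ((noise.prod P).map (fun p : Noise × Ω =>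
      simFull β h q (noiseZ N p.1) (noiseV N p.1) k (g p.2))) := inferInstance
  have i2 : IsFiniteMeasure (P.map g) := inferInstance
  refine @ext_of_integral_exp_pair N _ _ i1 i2 fun A => ?_
  have hm : Measurable fun B : Matrix (Fin N) (Fin N) ℝ =>
      Complex.exp (pair A B * Complex.I) := by
    have := measurable_pair A (measurable_id (α := Matrix (Fin N) (Fin N) ℝ))
    simp only [id] at this
    fun_prop
  have e1 := integral_map hgm hm.aestronglyMeasurable
  have e2 := integral_map hae hm.aestronglyMeasurable
  refine e2.trans (Eq.trans ?_ e1.symm)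
  rw [integral_exp_pair hg hI A, ← integral_charFun_sim β h q A k, integral_prod]
  · refine integral_congr_ae (ae_of_all _ fun ω => ?_)
    simp only [simFull, pair_add_right, Complex.ofReal_add, add_mul, Complex.exp_add]
    rw [integral_const_mul]
    congr 1
    -- For a frozen simulation, the independent completion contributes the Gaussian factor of the
    -- compressed test matrix, which is the damping factor in `integral_charFun_sim`.
    simp only [pair_mul_mul (projC_transpose _ _)]
    exact integral_exp_pair hg hI _
  · refine Integrable.of_bound ?_ 1 (ae_of_all _ fun p => ?_)
    · exact (hm.comp_aemeasurable hae).aestronglyMeasurable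
    · rw [Complex.norm_exp_ofReal_mul_I]

/-- Quantities that depend only on the simulated part have the same tails for the interaction
matrix and for the simulation. -/
theorem measureReal_eq_of_simN (β h q : ℝ) (hg : ∀ i j : Fin N,
      HasLaw (fun ω => g ω i j) (gaussianReal 0 (1 / (N : ℝ≥0))) P)
    (hI : iIndepFun (fun (p : Fin N × Fin N) (ω : Ω) => g ω p.1 p.2) P) (k : ℕ)
    {f : Matrix (Fin N) (Fin N) ℝ → ℝ} (hf : Measurable f)
    (hfk : ∀ (ω : Noise) (B : Matrix (Fin N) (Fin N) ℝ),
      f (simFull β h q (noiseZ N ω) (noiseV N ω) k B) = f (simN N β h q ω k)) {s : Set ℝ}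
    (hs : MeasurableSet s) :
    P.real {ω | f (g ω) ∈ s} = noise.real {ω | f (simN N β h q ω k) ∈ s} := by
  obtain ⟨hae, hmap⟩ := map_simFull (P := P) β h q hg hI k
  have h1 : (P.map g) (f ⁻¹' s) = P {ω | f (g ω) ∈ s} :=
    Measure.map_apply_of_aemeasurable (aemeasurable_matrix hg) (hf hs)
  have h2 := Measure.map_apply_of_aemeasurable hae (hf hs)
  rw [hmap, h1] at h2
  rw [measureReal_def, measureReal_def, h2]
  congr 1
  have h3 : (fun p : Noise × Ω => simFull β h q (noiseZ N p.1) (noiseV N p.1) k (g p.2)) ⁻¹'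
      (f ⁻¹' s) = Prod.fst ⁻¹' {ω | f (simN N β h q ω k) ∈ s} := by
    ext p; simp only [Set.mem_preimage, Set.mem_ofPred_eq, hfk]
  rw [h3]
  exact measurePreserving_fst.measure_preimage
    ((hf.comp (measurable_simN β h q k)) hs).nullMeasurableSet

end Transfer

/-! ### Calculus of exponential closeness -/

section ExpCloseCalculus

variable {Ω : Type*} [MeasurableSpace Ω] {P : Measure Ω}

theorem ExpClose.sub_self {X Y : ℕ → Ω → ℝ} (hX : ExpClose P X Y) :
    ExpClose P (fun N ω => X N ω - Y N ω) fun _ _ => 0 := by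
  simpa [ExpClose] using hX

variable [IsProbabilityMeasure P]

theorem ExpClose.of_abs_sub_le {X Y D : ℕ → Ω → ℝ} {M : ℝ} (hD : ExpClose P D fun _ _ => 0)
    (h : ∀ N, 1 ≤ N → ∀ ω, |X N ω - Y N ω| ≤ M * |D N ω|) : ExpClose P X Y := by
  obtain ⟨C, hC, c, hc, hP⟩ := hD
  -- `|M| + 1` serves as a strictly positive Lipschitz constant, whatever the sign of `M`.
  have hM : 0 < |M| + 1 := by positivity
  refine ⟨C, hC, c / (|M| + 1) ^ 2, by positivity, fun N hN t ht => ?_⟩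
  have h1 := hP N hN (t / (|M| + 1)) (by positivity)
  refine (measureReal_mono fun ω hω => ?_).trans (h1.trans (le_of_eq ?_))
  · have hω' : t ≤ |X N ω - Y N ω| := hω
    change t / (|M| + 1) ≤ |D N ω - 0|
    rw [sub_zero, div_le_iff₀ hM]
    have := h N hN ω
    nlinarith [abs_nonneg (D N ω), le_abs_self M]
  · congr 2
    field_simp

theorem ExpClose.refl (X : ℕ → Ω → ℝ) : ExpClose P X X := by
  refine ⟨1, one_pos, 1, one_pos, fun N _ t ht => ?_⟩
  rcases ht.eq_or_lt with rfl | ht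
  · simp
  · have : {ω : Ω | t ≤ |X N ω - X N ω|} = ∅ := by
      ext ω; simp [ht]
    rw [this, measureReal_empty]
    positivity

theorem ExpClose.abs_add_abs {D D' : ℕ → Ω → ℝ} (hD : ExpClose P D fun _ _ => 0)
    (hD' : ExpClose P D' fun _ _ => 0) :
    ExpClose P (fun N ω => |D N ω| + |D' N ω|) fun _ _ => 0 := by
  obtain ⟨C, hC, c, hc, hP⟩ := hD
  obtain ⟨C', hC', c', hc', hP'⟩ := hD'
  refine ⟨C + C', by positivity, min c c' / 4, by positivity, fun N hN t ht => ?_⟩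
  have h1 := hP N hN (t / 2) (by positivity)
  have h2 := hP' N hN (t / 2) (by positivity)
  have e : ∀ d : ℝ, min c c' ≤ d →
      Real.exp (-(d * (t / 2) ^ 2 * N)) ≤ Real.exp (-(min c c' / 4 * t ^ 2 * N)) := fun d hd => by
    refine Real.exp_le_exp.2 (neg_le_neg ?_)
    have : (0 : ℝ) ≤ t ^ 2 * N := by positivity
    nlinarith
  calc P.real {ω | t ≤ |(|D N ω| + |D' N ω|) - 0|}
      ≤ P.real ({ω | t / 2 ≤ |D N ω - 0|} ∪ {ω | t / 2 ≤ |D' N ω - 0|}) := by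
        refine measureReal_mono fun ω hω => ?_
        have hω' : t ≤ |(|D N ω| + |D' N ω|) - 0| := hω
        rw [sub_zero, abs_of_nonneg (by positivity)] at hω'
        by_cases hcase : t / 2 ≤ |D N ω|
        · left; simpa using hcase
        · right
          change t / 2 ≤ |D' N ω - 0|
          rw [sub_zero]; linarith
    _ ≤ _ := measureReal_union_le _ _
    _ ≤ (C + C') * Real.exp (-(min c c' / 4 * t ^ 2 * N)) := by
        rw [add_mul]
        exact add_le_add (h1.trans (mul_le_mul_of_nonneg_left (e c (min_le_left _ _)) hC.le))
          (h2.trans (mul_le_mul_of_nonneg_left (e c' (min_le_right _ _)) hC'.le))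

theorem ExpClose.sum_abs {ι : Type*} (s : Finset ι) {D : ι → ℕ → Ω → ℝ}
    (hD : ∀ a ∈ s, ExpClose P (D a) fun _ _ => 0) :
    ExpClose P (fun N ω => ∑ a ∈ s, |D a N ω|) fun _ _ => 0 := by
  classical
  induction s using Finset.induction_on with
  | empty => simpa using ExpClose.refl (P := P) fun _ _ => 0
  | insert a s ha ih =>
    have h1 := (hD a (Finset.mem_insert_self _ _)).abs_add_abs
      (ih fun b hb => hD b (Finset.mem_insert_of_mem hb))
    refine h1.of_abs_sub_le (M := 1) fun N _ ω => ?_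
    have h2 : 0 ≤ ∑ b ∈ s, |D b N ω| := Finset.sum_nonneg fun _ _ => abs_nonneg _
    rw [Finset.sum_insert ha, one_mul, sub_zero, abs_of_nonneg h2]

theorem ExpClose.of_abs_sub_le_sum {ι : Type*} (s : Finset ι) {X Y : ℕ → Ω → ℝ}
    {D : ι → ℕ → Ω → ℝ} {M : ℝ} (hD : ∀ a ∈ s, ExpClose P (D a) fun _ _ => 0)
    (h : ∀ N, 1 ≤ N → ∀ ω, |X N ω - Y N ω| ≤ M * ∑ a ∈ s, |D a N ω|) : ExpClose P X Y :=
  (ExpClose.sum_abs s hD).of_abs_sub_le (M := M) fun N hN ω => by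
    rw [abs_of_nonneg (a := ∑ a ∈ s, |D a N ω|) (Finset.sum_nonneg fun _ _ => abs_nonneg _)]
    exact h N hN ω

theorem ExpClose.of_abs_sub_le_add {X Y D D' : ℕ → Ω → ℝ} {M : ℝ}
    (hD : ExpClose P D fun _ _ => 0) (hD' : ExpClose P D' fun _ _ => 0)
    (h : ∀ N, 1 ≤ N → ∀ ω, |X N ω - Y N ω| ≤ M * (|D N ω| + |D' N ω|)) : ExpClose P X Y :=
  (hD.abs_add_abs hD').of_abs_sub_le (M := M) fun N hN ω => by
    rw [abs_of_nonneg (a := |D N ω| + |D' N ω|) (by positivity)]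
    exact h N hN ω

theorem ExpClose.trans {X Y W : ℕ → Ω → ℝ} (hX : ExpClose P X Y) (hY : ExpClose P Y W) :
    ExpClose P X W :=
  hX.sub_self.of_abs_sub_le_add hY.sub_self (M := 1) fun N _ ω => by
    rw [one_mul]
    exact abs_sub_le _ _ _

theorem ExpClose.sub {X Y X' Y' : ℕ → Ω → ℝ} (hX : ExpClose P X Y) (hX' : ExpClose P X' Y') :
    ExpClose P (fun N ω => X N ω - X' N ω) fun N ω => Y N ω - Y' N ω :=
  hX.sub_self.of_abs_sub_le_add hX'.sub_self (M := 1) fun N _ ω => by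
    rw [one_mul, sub_sub_sub_comm]
    exact abs_sub _ _

theorem ExpClose.sum {ι : Type*} (s : Finset ι) {X Y : ι → ℕ → Ω → ℝ}
    (hX : ∀ a ∈ s, ExpClose P (X a) (Y a)) :
    ExpClose P (fun N ω => ∑ a ∈ s, X a N ω) fun N ω => ∑ a ∈ s, Y a N ω :=
  .of_abs_sub_le_sum s (fun a ha => (hX a ha).sub_self) (M := 1) fun N _ ω => by
    rw [one_mul, ← Finset.sum_sub_distrib]
    exact Finset.abs_sum_le_sum_abs _ _

/-- A bound on one random factor suffices; the other is paired with the deterministic limit `a`. -/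
theorem ExpClose.mul {X X' : ℕ → Ω → ℝ} {a a' : ℝ} (hX : ExpClose P X fun _ _ => a)
    (hX' : ExpClose P X' fun _ _ => a') (hb : ∀ N ω, |X' N ω| ≤ 1) :
    ExpClose P (fun N ω => X N ω * X' N ω) fun _ _ => a * a' :=
  hX.sub_self.of_abs_sub_le_add hX'.sub_self (M := 1 + |a|) fun N _ ω => by
    have e : X N ω * X' N ω - a * a' = (X N ω - a) * X' N ω + a * (X' N ω - a') := by ring
    rw [e, add_mul, one_mul]
    refine (abs_add_le _ _).trans ?_
    rw [abs_mul, abs_mul, mul_add]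
    have h1 := mul_le_mul_of_nonneg_left (hb N ω) (abs_nonneg (X N ω - a))
    nlinarith [mul_nonneg (abs_nonneg a) (abs_nonneg (X N ω - a)), abs_nonneg (X' N ω - a')]

end ExpCloseCalculus

/-! ### Concentration for the noise -/

/-- The rows are i.i.d., so this is Hoeffding's inequality applied to the average and to its
negative. -/
theorem expClose_average {F : (ℕ × Bool → ℝ) → ℝ} (hF : Measurable F) (hb : ∀ w, |F w| ≤ 1) :
    ExpClose noise (fun N ω => (1 / (N : ℝ)) * ∑ i : Fin N, F (ω i))
      fun _ _ => ∫ ω, F (ω 0) ∂noise := by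
  have hrow : ∀ i : ℕ, ∫ ω, F (ω i) ∂noise = ∫ ω, F (ω 0) ∂noise := fun i => by
    have h1 := (hasLaw_row i).integral_comp hF.aestronglyMeasurable
    have h2 := (hasLaw_row 0).integral_comp hF.aestronglyMeasurable
    exact h1.trans h2.symm
  set μ := ∫ ω, F (ω 0) ∂noise with hμ
  have hFi : ∀ i : ℕ, Measurable fun ω : Noise => F (ω i) := fun i =>
    hF.comp (measurable_pi_apply i)
  have hsub : ∀ i : ℕ, HasSubgaussianMGF (fun ω => F (ω i) - μ) 1 noise := fun i => by
    have := hasSubgaussianMGF_of_mem_Icc (μ := noise) (a := -1) (b := 1) (hFi i).aemeasurable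
      (ae_of_all _ fun ω => abs_le.1 (hb (ω i)))
    rw [hrow i] at this
    -- The variance proxy of a variable with values in `[-1, 1]` is `((1 - (-1)) / 2)² = 1`.
    convert this
    rw [← NNReal.coe_inj]
    push_cast
    norm_num
  have hind : iIndepFun (fun (i : ℕ) (ω : Noise) => F (ω i) - μ) noise :=
    iIndepFun_comp_coord (f := fun w => F w - μ) (hF.sub_const μ)
  have hind' : iIndepFun (fun (i : ℕ) (ω : Noise) => -(F (ω i) - μ)) noise :=
    iIndepFun_comp_coord (f := fun w => -(F w - μ)) (hF.sub_const μ).neg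
  refine ⟨2, two_pos, 1 / 2, by norm_num, fun N hN t ht => ?_⟩
  have hN0 : (0 : ℝ) < N := by positivity
  have h1 := HasSubgaussianMGF.measure_sum_range_ge_le_of_iIndepFun hind (n := N) (c := 1)
    (fun i _ => hsub i) (ε := N * t) (by positivity)
  have h2 := HasSubgaussianMGF.measure_sum_range_ge_le_of_iIndepFun hind' (n := N) (c := 1)
    (fun i _ => (hsub i).neg) (ε := N * t) (by positivity)
  have he : Real.exp (-(N * t) ^ 2 / (2 * N * (1 : ℝ≥0))) =
      Real.exp (-(1 / 2 * t ^ 2 * N)) := by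
    congr 1
    rw [NNReal.coe_one]
    field_simp
  rw [he] at h1 h2
  have hsum : ∀ ω : Noise, (1 / (N : ℝ)) * ∑ i : Fin N, F (ω i) - μ =
      (1 / (N : ℝ)) * ∑ i ∈ Finset.range N, (F (ω i) - μ) := fun ω => by
    rw [Finset.sum_sub_distrib, Finset.sum_const, Finset.card_range, nsmul_eq_mul, mul_sub,
      ← mul_assoc, one_div_mul_cancel hN0.ne', one_mul, Finset.sum_range fun i => F (ω i)]
  calc noise.real {ω | t ≤ |(1 / (N : ℝ)) * ∑ i : Fin N, F (ω i) - μ|}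
      ≤ noise.real ({ω | N * t ≤ ∑ i ∈ Finset.range N, (F (ω i) - μ)} ∪
          {ω | N * t ≤ ∑ i ∈ Finset.range N, -(F (ω i) - μ)}) := by
        refine measureReal_mono fun ω hω => ?_
        have hω' : t ≤ |(1 / (N : ℝ)) * ∑ i : Fin N, F (ω i) - μ| := hω
        rw [hsum, abs_mul, abs_of_pos (by positivity : (0 : ℝ) < 1 / N), one_div,
          inv_mul_eq_div, le_div_iff₀ hN0, mul_comm] at hω'
        rw [Set.mem_union]
        rcases le_abs.1 hω' with hh | hh
        · exact Or.inl hh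
        · right
          change N * t ≤ ∑ i ∈ Finset.range N, -(F (ω i) - μ)
          rwa [Finset.sum_neg_distrib]
    _ ≤ _ := measureReal_union_le _ _
    _ ≤ _ := by linarith

/-! ### Fresh noise tested against frozen directions -/

section

variable (β h q : ℝ)

theorem measureReal_ip_noise_le {N : ℕ} (hN : 1 ≤ N) (k : ℕ) {x : Fin N → ℝ} (hx : nrm x ≤ 1)
    {t : ℝ} (ht : 0 ≤ t) :
    noise.real {ω | t ≤ |ip x (noiseZ N ω k)|} ≤ 2 * Real.exp (-(1 / 2 * t ^ 2 * N)) ∧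
    noise.real {ω | t ≤ |ip x (noiseV N ω k)|} ≤ 2 * Real.exp (-(1 / 2 * t ^ 2 * N)) := by
  have hN0 : (0 : ℝ) < N := by positivity
  have hv0 : 0 ≤ ip x x / N := div_nonneg (ip_self_nonneg x) hN0.le
  have hv1 : ip x x / N * N ≤ 1 := by
    rw [div_mul_cancel₀ _ hN0.ne', ← nrm_sq]
    exact pow_le_one₀ (nrm_nonneg x) hx
  have h1 := hasLaw_ip_noise (N := N) k x 0 (w := .mk _ hv0) (by simp [ip_zero_left])
  have h2 := hasLaw_ip_noise (N := N) k 0 x (w := .mk _ hv0) (by simp [ip_zero_left])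
  simp only [ip_zero_left, add_zero, zero_add] at h1 h2
  exact ⟨measureReal_abs_ge_le_of_hasLaw_gaussianReal h1 hN0.le hv1 ht,
    measureReal_abs_ge_le_of_hasLaw_gaussianReal h2 hN0.le hv1 ht⟩

/-- The fresh Gaussian vectors have small components along the previous directions. -/
theorem expClose_ip_φ_noise {k s : ℕ} (hs : 1 ≤ s) :
    ExpClose noise (fun N ω => ip (φ β h q (simN N β h q ω k) s) (noiseZ N ω (k + 1)))
      (fun _ _ => 0) ∧
    ExpClose noise (fun N ω => ip (φ β h q (simN N β h q ω k) s) (noiseV N ω (k + 1)))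
      (fun _ _ => 0) := by
  have hip : ∀ (N : ℕ) (t : ℝ) (pr : (Fin N → ℝ) × (Fin N → ℝ) → (Fin N → ℝ)), Measurable pr →
      MeasurableSet {x : Matrix (Fin N) (Fin N) ℝ × (Fin N → ℝ) × (Fin N → ℝ) |
        t ≤ |ip (φ β h q x.1 s) (pr x.2)|} := fun N t pr hpr =>
    measurableSet_le measurable_const (continuous_abs.measurable.comp (measurable_ip
      ((measurable_φ β h q hs).comp measurable_fst) (hpr.comp measurable_snd)))
  have hY : ∀ N : ℕ, Measurable fun ω => (noiseZ N ω (k + 1), noiseV N ω (k + 1)) := fun N =>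
    ((measurable_pi_apply (k + 1)).comp (measurable_noiseZ N)).prodMk
      ((measurable_pi_apply (k + 1)).comp (measurable_noiseV N))
  constructor
  · refine ⟨2, two_pos, 1 / 2, by norm_num, fun N hN t ht => ?_⟩
    simp only [sub_zero]
    exact measureReal_le_of_indepFun (indepFun_simN β h q k) (measurable_simN β h q k) (hY N)
      (p := fun S x => t ≤ |ip (φ β h q S s) x.1|) (hip N t Prod.fst measurable_fst)
      (by positivity)
      fun ω => (measureReal_ip_noise_le hN (k + 1) (nrm_φ_le_one β h q _ hs) ht).1
  · refine ⟨2, two_pos, 1 / 2, by norm_num, fun N hN t ht => ?_⟩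
    simp only [sub_zero]
    exact measureReal_le_of_indepFun (indepFun_simN β h q k) (measurable_simN β h q k) (hY N)
      (p := fun S x => t ≤ |ip (φ β h q S s) x.2|) (hip N t Prod.snd measurable_snd)
      (by positivity)
      fun ω => (measureReal_ip_noise_le hN (k + 1) (nrm_φ_le_one β h q _ hs) ht).2

end

/-! ### Gaussian integrals of `Th` -/

theorem measurable_Th (β h : ℝ) : Measurable (Th β h) :=
  continuous_tanh.measurable.comp (by fun_prop)

theorem abs_Th_le_one (β h x : ℝ) : |Th β h x| ≤ 1 := (Real.abs_tanh_lt_one _).le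

theorem strictMono_Th {β : ℝ} (hβ : 0 < β) (h : ℝ) : StrictMono (Th β h) := fun x y hxy =>
  strictMono_tanh (by nlinarith)

theorem integral_exp_mul_gaussianReal (a : ℝ) :
    ∫ x, Complex.exp (a * x * Complex.I) ∂(gaussianReal 0 1) = Complex.exp (-(a ^ 2) / 2 : ℝ) := by
  have h1 := charFun_gaussianReal (μ := 0) (v := 1) a
  rw [charFun_apply_real] at h1
  rw [h1]
  congr 1
  push_cast
  ring

/-- The product of three standard Gaussian measures. -/
def gauss3 : Measure (ℝ × ℝ × ℝ) :=
  (gaussianReal 0 1).prod ((gaussianReal 0 1).prod (gaussianReal 0 1))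

instance isProbabilityMeasure_gauss3 : IsProbabilityMeasure gauss3 := by
  unfold gauss3; infer_instance

theorem integral_exp_gauss3 (a b c : ℝ) :
    ∫ p, Complex.exp ((a * p.1 + b * p.2.1 + c * p.2.2 : ℝ) * Complex.I) ∂gauss3 =
      Complex.exp (-(a ^ 2 + b ^ 2 + c ^ 2) / 2 : ℝ) := by
  have e : ∀ p : ℝ × ℝ × ℝ, Complex.exp ((a * p.1 + b * p.2.1 + c * p.2.2 : ℝ) * Complex.I) =
      Complex.exp (a * p.1 * Complex.I) *
        (Complex.exp (b * p.2.1 * Complex.I) * Complex.exp (c * p.2.2 * Complex.I)) := fun p => by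
    rw [← Complex.exp_add, ← Complex.exp_add]
    push_cast
    ring_nf
  simp only [e]
  rw [gauss3, integral_prod_mul (fun x : ℝ => Complex.exp (a * x * Complex.I))
    (fun p : ℝ × ℝ => Complex.exp (b * p.1 * Complex.I) * Complex.exp (c * p.2 * Complex.I)),
    integral_prod_mul (fun x : ℝ => Complex.exp (b * x * Complex.I))
      (fun x : ℝ => Complex.exp (c * x * Complex.I)), integral_exp_mul_gaussianReal,
    integral_exp_mul_gaussianReal, integral_exp_mul_gaussianReal, ← Complex.exp_add,
    ← Complex.exp_add, ← Complex.ofReal_add, ← Complex.ofReal_add]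
  congr 2
  ring

theorem integral_gauss3 {F : ℝ × ℝ × ℝ → ℝ} (hF : Measurable F) (hb : ∀ p, |F p| ≤ 1) :
    ∫ p, F p ∂gauss3 = ∫ z, ∫ z', ∫ z'', F (z, z', z'')
      ∂(gaussianReal 0 1) ∂(gaussianReal 0 1) ∂(gaussianReal 0 1) := by
  rw [gauss3, integral_prod _ (Integrable.of_bound hF.aestronglyMeasurable 1 (ae_of_all _ hb))]
  refine integral_congr_ae (ae_of_all _ fun z => ?_)
  exact integral_prod _ (Integrable.of_bound
    (hF.comp measurable_prodMk_left).aestronglyMeasurable 1 (ae_of_all _ fun p => hb (z, p)))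

theorem psi_eq_integral_gauss3 (β h q t : ℝ) : psi β h q t =
    ∫ p, Th β h (√t * p.1 + √(q - t) * p.2.1) * Th β h (√t * p.1 + √(q - t) * p.2.2) ∂gauss3 := by
  rw [integral_gauss3, psi]
  · have := measurable_Th β h; fun_prop
  · intro p
    rw [abs_mul]
    exact mul_le_one₀ (abs_Th_le_one _ _ _) (abs_nonneg _) (abs_Th_le_one _ _ _)

/-- Given `z`, the two factors are independent with the same law, so the inner double integral is a
square. -/
theorem psi_nonneg (β h q t : ℝ) : 0 ≤ psi β h q t := by
  rw [psi]
  refine integral_nonneg fun z => ?_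
  simp only [integral_const_mul, integral_mul_const]
  exact mul_self_nonneg _

/-! ### Pairs of Gaussian fields and the function `psi` -/

section Bivariate

variable {Ω : Type*} [MeasurableSpace Ω] {P : Measure Ω}

theorem integral_comp_of_hasLaw_gaussianReal {X : Ω → ℝ} {w : ℝ≥0}
    (hX : HasLaw X (gaussianReal 0 w) P) {f : ℝ → ℝ} (hf : Measurable f) :
    ∫ ω, f (X ω) ∂P = ∫ x, f (√w * x) ∂(gaussianReal 0 1) := by
  have h1 := hX.integral_comp hf.aestronglyMeasurable
  have h2 : HasLaw (fun x : ℝ => √w * x) (gaussianReal 0 w) (gaussianReal 0 1) := by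
    have := gaussianReal_const_mul (HasLaw.id (μ := gaussianReal 0 1)) (√w)
    convert this using 2
    · rfl
    · rw [mul_zero]
    · rw [mul_one, ← NNReal.coe_inj, NNReal.coe_mk]
      exact (Real.sq_sqrt w.2).symm
  exact h1.trans (h2.integral_comp hf.aestronglyMeasurable).symm

variable [IsProbabilityMeasure P]

/-- `ψ` computes the correlation of `Th` along two Gaussian variables of variance `q` and
covariance `t`. -/
theorem integral_Th_mul_Th (β h : ℝ) {q t : ℝ} (ht0 : 0 ≤ t) (htq : t ≤ q) {X Y : Ω → ℝ}
    (hX : Measurable X) (hY : Measurable Y)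
    (hXY : ∀ a b : ℝ, ∀ w : ℝ≥0, (w : ℝ) = a ^ 2 * q + 2 * a * b * t + b ^ 2 * q →
      HasLaw (fun ω => a * X ω + b * Y ω) (gaussianReal 0 w) P) :
    ∫ ω, Th β h (X ω) * Th β h (Y ω) ∂P = psi β h q t := by
  let T : ℝ × ℝ × ℝ → ℝ × ℝ := fun p =>
    (√t * p.1 + √(q - t) * p.2.1, √t * p.1 + √(q - t) * p.2.2)
  have hT : Measurable T := by fun_prop
  -- By uniqueness of characteristic functions it suffices to compare linear combinations. `T`
  -- realizes the covariance `t` through one shared and two private Gaussians.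
  have hlaw : P.map (fun ω => (X ω, Y ω)) = gauss3.map T := by
    have i1 : IsProbabilityMeasure (P.map fun ω => (X ω, Y ω)) :=
      Measure.isProbabilityMeasure_map (hX.prodMk hY).aemeasurable
    have i2 : IsProbabilityMeasure (gauss3.map T) :=
      Measure.isProbabilityMeasure_map hT.aemeasurable
    refine Measure.ext_of_charFunDual ?_
    ext L
    have hL : ∀ x : ℝ × ℝ, L x = L (1, 0) * x.1 + L (0, 1) * x.2 := fun x => by
      have : x = x.1 • ((1, 0) : ℝ × ℝ) + x.2 • ((0, 1) : ℝ × ℝ) := by ext <;> simp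
      conv_lhs => rw [this]
      rw [map_add, map_smul, map_smul, smul_eq_mul, smul_eq_mul]
      ring
    have hLm : Measurable fun x : ℝ × ℝ => Complex.exp (L x * Complex.I) := by
      have := L.continuous.measurable; fun_prop
    rw [charFunDual_apply, charFunDual_apply, integral_map (hX.prodMk hY).aemeasurable
      hLm.aestronglyMeasurable, integral_map hT.aemeasurable hLm.aestronglyMeasurable]
    set a := L (1, 0)
    set b := L (0, 1)
    -- The quadratic form equals `(a + b)² t + a² (q - t) + b² (q - t)`.
    have hw0 : 0 ≤ a ^ 2 * q + 2 * a * b * t + b ^ 2 * q := by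
      nlinarith [mul_nonneg (sq_nonneg (a + b)) ht0,
        mul_nonneg (sq_nonneg a) (sub_nonneg.2 htq), mul_nonneg (sq_nonneg b) (sub_nonneg.2 htq)]
    have h1 := integral_exp_of_hasLaw_gaussianReal (hXY a b (.mk _ hw0) rfl)
    have h2 := integral_exp_gauss3 ((a + b) * √t) (a * √(q - t)) (b * √(q - t))
    simp only [hL]
    rw [h1]
    have e : ∀ p : ℝ × ℝ × ℝ, a * (T p).1 + b * (T p).2 =
        (a + b) * √t * p.1 + a * √(q - t) * p.2.1 + b * √(q - t) * p.2.2 := fun p => by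
      simp only [T]; ring
    simp only [e]
    rw [h2]
    congr 2
    rw [NNReal.coe_mk, mul_pow, mul_pow, mul_pow, Real.sq_sqrt ht0, Real.sq_sqrt (sub_nonneg.2 htq)]
    ring
  have hf : Measurable fun x : ℝ × ℝ => Th β h x.1 * Th β h x.2 := by
    have := measurable_Th β h; fun_prop
  have h1 := integral_map (hX.prodMk hY).aemeasurable (μ := P) hf.aestronglyMeasurable
  have h2 := integral_map hT.aemeasurable (μ := gauss3) hf.aestronglyMeasurable
  rw [hlaw] at h1
  rw [psi_eq_integral_gauss3]
  exact h1.symm.trans h2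

end Bivariate

/-! ### The deterministic sequences -/

section Deterministic

variable {β h q : ℝ}

/-- For `q = 0` the fixed point equation would read `0 = tanh² h`. -/
theorem q_pos (hh : 0 < h) (hq : IsFixedPoint β h q) : 0 < q := by
  refine lt_of_le_of_ne hq.1 fun h0 => ?_
  have h1 := hq.2
  rw [← h0] at h1
  simp only [Real.sqrt_zero, mul_zero, zero_mul, add_zero, integral_const, probReal_univ,
    one_smul] at h1
  have h2 : 0 < Real.tanh h := by simpa using strictMono_tanh hh
  exact (pow_pos h2 2).ne h1

theorem q_le_one (hq : IsFixedPoint β h q) : q ≤ 1 := by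
  have h1 := hq.2
  rw [h1]
  have h2 := norm_integral_le_of_norm_le_const (μ := gaussianReal 0 1)
    (f := fun x => Real.tanh (h + β * √q * x) ^ 2) (C := 1) (ae_of_all _ fun x => by
      rw [Real.norm_eq_abs, abs_of_nonneg (sq_nonneg _)]; exact (Real.tanh_sq_lt_one _).le)
  rw [probReal_univ, mul_one] at h2
  exact (le_abs_self _).trans h2

/-- Symmetrize under `x ↦ -x`: `tanh (h + y) + tanh (h - y)` is nonnegative because `tanh` is odd
and increasing. The sign ensures `0 ≤ rho 1`, needed to use `rho` as a shared variance in `psi`. -/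
theorem gammaOne_nonneg (hh : 0 ≤ h) : 0 ≤ gammaOne β h q := by
  have hint : ∀ c : ℝ, Integrable (fun x => Real.tanh (h + c * x)) (gaussianReal 0 1) := fun c =>
    Integrable.of_bound (continuous_tanh.measurable.comp
      (by fun_prop : Measurable fun x => h + c * x)).aestronglyMeasurable 1
      (ae_of_all _ fun x => (Real.abs_tanh_lt_one _).le)
  have hneg : ∫ x, Real.tanh (h + β * √q * x) ∂(gaussianReal 0 1) =
      ∫ x, Real.tanh (h + -(β * √q) * x) ∂(gaussianReal 0 1) := by
    have h1 : HasLaw (fun x : ℝ => -x) (gaussianReal 0 1) (gaussianReal 0 1) := by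
      have := gaussianReal_neg (HasLaw.id (μ := gaussianReal 0 1))
      rw [neg_zero] at this
      exact this
    have h2 := h1.integral_comp (f := fun x => Real.tanh (h + β * √q * x))
      (hint (β * √q)).aestronglyMeasurable
    rw [← h2]
    refine integral_congr_ae (ae_of_all _ fun x => ?_)
    simp
  have hsum : 0 ≤ ∫ x, (Real.tanh (h + β * √q * x) + Real.tanh (h + -(β * √q) * x))
      ∂(gaussianReal 0 1) := by
    refine integral_nonneg fun x => ?_
    have : Real.tanh (-(h + β * √q * x)) ≤ Real.tanh (h + -(β * √q) * x) :=
      strictMono_tanh.monotone (by linarith)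
    rw [Real.tanh_neg] at this
    simp only [Pi.zero_apply]
    linarith
  rw [integral_add (hint _) (hint _), ← hneg] at hsum
  rw [gammaOne]
  linarith

theorem rho_nonneg (hh : 0 ≤ h) (k : ℕ) : 0 ≤ rho β h q k := by
  match k with
  | 0 => simp [rho]
  | 1 => exact mul_nonneg (Real.sqrt_nonneg _) (gammaOne_nonneg hh)
  | k + 2 => exact psi_nonneg _ _ _ _

theorem rho_succ {k : ℕ} (hk : 1 ≤ k) : rho β h q (k + 1) = psi β h q (rho β h q k) := by
  obtain ⟨k, rfl⟩ := Nat.exists_eq_add_of_le' hk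
  rw [rho]

variable (β h q) in
/-- `q - ∑_{s<k} γ_s²`. -/
def defect (k : ℕ) : ℝ := q - ∑ s ∈ Finset.Ico 1 k, gamma β h q s ^ 2

theorem defect_one : defect β h q 1 = q := by simp [defect]

theorem gamma_mul_sqrt_defect {k : ℕ} (hk : 1 ≤ k) (hpos : 0 < defect β h q k) :
    gamma β h q k * √(defect β h q k) =
      rho β h q k - ∑ s ∈ Finset.Ico 1 k, gamma β h q s ^ 2 := by
  obtain ⟨k, rfl⟩ := Nat.exists_eq_add_of_le' hk
  rcases k with _ | k
  · rw [zero_add, gamma_one, defect_one, rho]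
    simp [mul_comm]
  · rw [gamma_add_two, defect, div_mul_cancel₀]
    exact (Real.sqrt_pos.2 hpos).ne'

variable (β h q) in
/-- The coefficients of the field of level `k + 1` in terms of the Gaussian vectors. -/
def coef (k s : ℕ) : ℝ :=
  if s < k then gamma β h q s else if s = k then √(defect β h q k) else 0

/-- Padding with zeros puts the coefficients of all fields up to `l` on one index set, so that
variances and covariances become Euclidean inner products. -/
theorem sum_coef_mul {k l : ℕ} (hk : 1 ≤ k) (hkl : k ≤ l) (F : ℕ → ℝ) :
    ∑ s ∈ Finset.Ico 1 (l + 1), coef β h q k s * F s =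
      ∑ s ∈ Finset.Ico 1 k, gamma β h q s * F s + √(defect β h q k) * F k := by
  rw [← Finset.sum_Ico_consecutive _ hk (show k ≤ l + 1 by omega),
    Finset.sum_eq_sum_Ico_succ_bot (show k < l + 1 by omega)]
  have h1 : ∑ s ∈ Finset.Ico 1 k, coef β h q k s * F s =
      ∑ s ∈ Finset.Ico 1 k, gamma β h q s * F s :=
    Finset.sum_congr rfl fun s hs => by rw [coef, if_pos (Finset.mem_Ico.1 hs).2]
  have h2 : ∑ s ∈ Finset.Ico (k + 1) (l + 1), coef β h q k s * F s = 0 :=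
    Finset.sum_eq_zero fun s hs => by
      have := (Finset.mem_Ico.1 hs).1
      rw [coef, if_neg (by omega), if_neg (by omega), zero_mul]
  rw [h1, h2, add_zero, coef, if_neg (lt_irrefl k), if_pos rfl]

theorem sum_coef_sq {k l : ℕ} (hk : 1 ≤ k) (hkl : k ≤ l) (hpos : 0 ≤ defect β h q k) :
    ∑ s ∈ Finset.Ico 1 (l + 1), coef β h q k s * coef β h q k s = q := by
  rw [sum_coef_mul hk hkl, coef, if_neg (lt_irrefl k), if_pos rfl, Real.mul_self_sqrt hpos]
  have h1 : ∑ s ∈ Finset.Ico 1 k, gamma β h q s * coef β h q k s =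
      ∑ s ∈ Finset.Ico 1 k, gamma β h q s ^ 2 :=
    Finset.sum_congr rfl fun s hs => by rw [coef, if_pos (Finset.mem_Ico.1 hs).2, sq]
  rw [h1, defect]
  ring

/-- The common part contributes `∑ γ_s²` and the last coordinate `γ_k √(q - ∑ γ_s²)`. The recursion
for `gamma` is chosen to make the total equal to `rho k`. -/
theorem sum_coef_mul_coef {k l : ℕ} (hk : 1 ≤ k) (hkl : k < l) (hpos : 0 < defect β h q k) :
    ∑ s ∈ Finset.Ico 1 (l + 1), coef β h q k s * coef β h q l s = rho β h q k := by
  rw [sum_coef_mul hk hkl.le, coef, if_pos hkl, mul_comm _ (gamma β h q k),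
    gamma_mul_sqrt_defect hk hpos]
  have h1 : ∑ s ∈ Finset.Ico 1 k, gamma β h q s * coef β h q l s =
      ∑ s ∈ Finset.Ico 1 k, gamma β h q s ^ 2 :=
    Finset.sum_congr rfl fun s hs => by
      have := (Finset.mem_Ico.1 hs).2
      rw [coef, if_pos (by omega), sq]
  rw [h1]
  ring

/-- Cauchy-Schwarz: `rho k` is the inner product of two coefficient vectors of squared length `q`.
-/
theorem rho_le_q {k l : ℕ} (hk : 1 ≤ k) (hkl : k < l) (hq : 0 ≤ q) (hpos : 0 < defect β h q k)
    (hl : 0 ≤ defect β h q l) : rho β h q k ≤ q := by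
  have hcs := Finset.sum_mul_sq_le_sq_mul_sq (Finset.Ico 1 (l + 1)) (coef β h q k) (coef β h q l)
  have e1 := sum_coef_sq hk hkl.le hpos.le
  have e2 := sum_coef_sq (β := β) (h := h) (q := q) (hk.trans hkl.le) le_rfl hl
  simp only [← sq] at e1 e2
  rw [sum_coef_mul_coef hk hkl hpos, e1, e2, ← sq] at hcs
  exact le_of_sq_le_sq hcs hq

/-! ### The limiting variables -/

variable (β h q) in
/-- The Gaussian field in the limit `N → ∞`, as a function of the Gaussian coordinates. -/
def field (k : ℕ) (w : ℕ × Bool → ℝ) : ℝ :=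
  ∑ s ∈ Finset.Ico 1 k, gamma β h q s * w (s, true) + √(defect β h q k) * w (k, true)

variable (β h q) in
/-- The limiting variable for the coordinates of `m k`. -/
def mlim (k : ℕ) (w : ℕ × Bool → ℝ) : ℝ :=
  if k ≤ 1 then √q else Th β h (field β h q (k - 1) w)

theorem mlim_one (w : ℕ × Bool → ℝ) : mlim β h q 1 w = √q := by simp [mlim]

theorem mlim_succ {k : ℕ} (hk : 1 ≤ k) (w : ℕ × Bool → ℝ) :
    mlim β h q (k + 1) w = Th β h (field β h q k w) := by
  rw [mlim, if_neg (by omega), Nat.add_sub_cancel]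

theorem measurable_field (k : ℕ) : Measurable (field β h q k) := by
  unfold field; fun_prop

theorem measurable_mlim (k : ℕ) : Measurable (mlim β h q k) := by
  unfold mlim
  split_ifs
  · exact measurable_const
  · exact (measurable_Th β h).comp (measurable_field _)

theorem abs_mlim_le_one (hq : q ≤ 1) (k : ℕ) (w : ℕ × Bool → ℝ) : |mlim β h q k w| ≤ 1 := by
  unfold mlim
  split_ifs
  · rw [abs_of_nonneg (Real.sqrt_nonneg _)]; exact Real.sqrt_le_one.2 hq
  · exact abs_Th_le_one _ _ _

theorem hasLaw_sum_coord (k : ℕ) (a : ℕ → ℝ) {w : ℝ≥0}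
    (hw : (w : ℝ) = ∑ s ∈ Finset.Ico 1 (k + 1), a s ^ 2) :
    HasLaw (fun ω : Noise => ∑ s ∈ Finset.Ico 1 (k + 1), a s * ω 0 (s, true))
      (gaussianReal 0 w) noise :=
  hasLaw_sum_gaussianReal (v := 1) (X := fun (s : ℕ) (ω : Noise) => ω 0 (s, true))
    (fun s => hasLaw_coord (0, s, true))
    (iIndepFun_coord.precomp (g := fun s : ℕ => ((0 : ℕ), s, true)) fun s s' hs => by simpa using hs)
    _ a (by rw [hw]; simp)

theorem hasLaw_field {k l : ℕ} (hk : 1 ≤ k) (hkl : k < l) (hpos : 0 < defect β h q k)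
    (hl : 0 ≤ defect β h q l) (a b : ℝ) (w : ℝ≥0)
    (hw : (w : ℝ) = a ^ 2 * q + 2 * a * b * rho β h q k + b ^ 2 * q) :
    HasLaw (fun ω : Noise => a * field β h q k (ω 0) + b * field β h q l (ω 0))
      (gaussianReal 0 w) noise := by
  have hlaw := hasLaw_sum_coord l (fun s => a * coef β h q k s + b * coef β h q l s) (w := w) (by
    rw [hw, ← sum_coef_mul_coef hk hkl hpos]
    conv_lhs => enter [1, 1, 2]; rw [← sum_coef_sq hk hkl.le hpos.le]
    conv_lhs => enter [2, 2]; rw [← sum_coef_sq (hk.trans hkl.le) (le_refl l) hl]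
    rw [Finset.mul_sum, Finset.mul_sum, Finset.mul_sum, ← Finset.sum_add_distrib,
      ← Finset.sum_add_distrib]
    exact Finset.sum_congr rfl fun _ _ => by ring)
  refine hlaw.congr (ae_of_all _ fun ω => ?_)
  simp only [field]
  rw [← sum_coef_mul hk hkl.le, ← sum_coef_mul (hk.trans hkl.le) (le_refl l), Finset.mul_sum,
    Finset.mul_sum, ← Finset.sum_add_distrib]
  exact Finset.sum_congr rfl fun _ _ => by ring

theorem hasLaw_field_self {k : ℕ} (hk : 1 ≤ k) (hpos : 0 ≤ defect β h q k) (hq : 0 ≤ q) :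
    HasLaw (fun ω : Noise => field β h q k (ω 0)) (gaussianReal 0 (.mk q hq)) noise := by
  have hlaw := hasLaw_sum_coord k (coef β h q k) (w := .mk q hq) (by
    rw [NNReal.coe_mk]
    conv_lhs => rw [← sum_coef_sq hk le_rfl hpos]
    exact Finset.sum_congr rfl fun _ _ => by ring)
  refine hlaw.congr (ae_of_all _ fun ω => ?_)
  simp only [field]
  rw [← sum_coef_mul hk (le_refl k)]

theorem integral_mlim_mul_self (hq : IsFixedPoint β h q) {k : ℕ} (hk : 1 ≤ k)
    (hpos : ∀ l, 1 ≤ l → l < k → 0 < defect β h q l) :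
    ∫ ω, mlim β h q k (ω 0) * mlim β h q k (ω 0) ∂noise = q := by
  obtain ⟨k, rfl⟩ := Nat.exists_eq_add_of_le' hk
  rcases Nat.eq_zero_or_pos k with rfl | hk0
  · simp only [zero_add, mlim_one, Real.mul_self_sqrt hq.1, integral_const, probReal_univ, one_smul]
  · simp only [mlim_succ hk0]
    have := measurable_Th β h
    rw [integral_comp_of_hasLaw_gaussianReal (f := fun x => Th β h x * Th β h x)
      (hasLaw_field_self hk0 (hpos k hk0 (by omega)).le hq.1) (by fun_prop)]
    conv_rhs => rw [hq.2]
    simp only [NNReal.coe_mk, Th, sq, mul_assoc]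

/-- The fields behind levels `j` and `k` have covariance `rho (j - 1)`, and `psi` advances it to
`rho j`; for `j = 1` one factor is the constant `√q`. Positivity is assumed only below `k`, so the
identity can be used inside the induction that proves positivity. -/
theorem integral_mlim_mul (hh : 0 < h) (hq : IsFixedPoint β h q) {j k : ℕ} (hj : 1 ≤ j)
    (hjk : j < k) (hpos : ∀ l, 1 ≤ l → l < k → 0 < defect β h q l) :
    ∫ ω, mlim β h q k (ω 0) * mlim β h q j (ω 0) ∂noise = rho β h q j := by
  obtain ⟨k, rfl⟩ := Nat.exists_eq_add_of_le' (hj.trans hjk.le)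
  obtain ⟨j, rfl⟩ := Nat.exists_eq_add_of_le' hj
  have hk0 : 1 ≤ k := by omega
  rcases Nat.eq_zero_or_pos j with rfl | hj0
  · simp only [zero_add, mlim_one, mlim_succ hk0]
    rw [integral_mul_const, integral_comp_of_hasLaw_gaussianReal
      (hasLaw_field_self hk0 (hpos k hk0 (by omega)).le hq.1) (measurable_Th β h), rho, gammaOne,
      mul_comm]
    simp only [NNReal.coe_mk, Th, mul_assoc]
  · simp only [mlim_succ hk0, mlim_succ hj0]
    have hjpos := hpos j hj0 (by omega)
    have hkpos := hpos k hk0 (by omega)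
    rw [rho_succ hj0, ← integral_Th_mul_Th (P := noise) β h (rho_nonneg hh.le j)
      (rho_le_q hj0 (show j < k by omega) hq.1 hjpos hkpos.le)
      ((measurable_field j).comp (measurable_pi_apply 0))
      ((measurable_field k).comp (measurable_pi_apply 0))
      (hasLaw_field hj0 (by omega) hjpos hkpos.le)]
    exact integral_congr_ae (ae_of_all _ fun ω => mul_comm _ _)

end Deterministic

/-! ### Positivity of the defect -/

section Gram

variable {E : Type*} [NormedAddCommGroup E] [InnerProductSpace ℝ E]

open scoped RealInnerProductSpace

/-- Gram-Schmidt vectors with prescribed coefficients `c` and residual norms `√(d k)`. -/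
def gsVec (M : ℕ → E) (c d : ℕ → ℝ) (k : ℕ) : E :=
  (√(d k))⁻¹ • (M k - ∑ s ∈ (Finset.Ico 1 k).attach, c s.1 • gsVec M c d s.1)
termination_by k
decreasing_by exact (Finset.mem_Ico.1 s.2).2

theorem gsVec_eq (M : ℕ → E) (c d : ℕ → ℝ) (k : ℕ) : gsVec M c d k =
    (√(d k))⁻¹ • (M k - ∑ s ∈ Finset.Ico 1 k, c s • gsVec M c d s) := by
  rw [gsVec]
  congr 2
  exact Finset.sum_attach (Finset.Ico 1 k) fun s => c s • gsVec M c d s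

variable {M : ℕ → E} {c ρ : ℕ → ℝ} {q : ℝ} {n : ℕ}

/-- The prescribed `c` are the true Gram-Schmidt coefficients, because the inner products depend
only on the smaller index and `c` satisfies the same recursion. -/
theorem inner_gsVec (hM : ∀ i j, 1 ≤ j → j < i → i ≤ n → ⟪M i, M j⟫ = ρ j)
    (hd : ∀ j, 1 ≤ j → j < n → 0 < q - ∑ s ∈ Finset.Ico 1 j, c s ^ 2)
    (hc : ∀ j, 1 ≤ j → j < n → c j * √(q - ∑ s ∈ Finset.Ico 1 j, c s ^ 2) =
      ρ j - ∑ s ∈ Finset.Ico 1 j, c s ^ 2) {i j : ℕ} (hj : 1 ≤ j) (hji : j < i) (hi : i ≤ n) :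
    ⟪M i, gsVec M c (fun k => q - ∑ s ∈ Finset.Ico 1 k, c s ^ 2) j⟫ = c j := by
  induction j using Nat.strong_induction_on with
  | _ j ih =>
    have hpos := Real.sqrt_pos.2 (hd j hj (by omega))
    rw [gsVec_eq, inner_smul_right, inner_sub_right, hM i j hj hji hi, inner_sum,
      inv_mul_eq_div, div_eq_iff hpos.ne', hc j hj (by omega)]
    congr 1
    refine Finset.sum_congr rfl fun s hs => ?_
    obtain ⟨h1, h2⟩ := Finset.mem_Ico.1 hs
    rw [inner_smul_right, ih s h2 h1 (by omega), sq]

theorem inner_gsVec_gsVec (hM : ∀ i j, 1 ≤ j → j < i → i ≤ n → ⟪M i, M j⟫ = ρ j)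
    (hMq : ∀ i, 1 ≤ i → i ≤ n → ⟪M i, M i⟫ = q)
    (hd : ∀ j, 1 ≤ j → j < n → 0 < q - ∑ s ∈ Finset.Ico 1 j, c s ^ 2)
    (hc : ∀ j, 1 ≤ j → j < n → c j * √(q - ∑ s ∈ Finset.Ico 1 j, c s ^ 2) =
      ρ j - ∑ s ∈ Finset.Ico 1 j, c s ^ 2) {j : ℕ} (hj : 1 ≤ j) (hjn : j < n) :
    ⟪gsVec M c (fun k => q - ∑ s ∈ Finset.Ico 1 k, c s ^ 2) j,
      gsVec M c (fun k => q - ∑ s ∈ Finset.Ico 1 k, c s ^ 2) j⟫ = 1 ∧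
    ∀ s, 1 ≤ s → s < j → ⟪gsVec M c (fun k => q - ∑ s ∈ Finset.Ico 1 k, c s ^ 2) j,
      gsVec M c (fun k => q - ∑ s ∈ Finset.Ico 1 k, c s ^ 2) s⟫ = 0 := by
  set f := gsVec M c (fun k => q - ∑ s ∈ Finset.Ico 1 k, c s ^ 2) with hf
  have hMf : ∀ i j, 1 ≤ j → j < i → i ≤ n → ⟪M i, f j⟫ = c j := fun i j h1 h2 h3 =>
    inner_gsVec hM hd hc h1 h2 h3
  induction j using Nat.strong_induction_on with
  | _ j ih =>
    have hpos := hd j hj hjn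
    have horth : ∀ s, 1 ≤ s → s < j → ⟪f j, f s⟫ = 0 := by
      intro s h1 h2
      rw [hf, gsVec_eq, ← hf, real_inner_smul_left, inner_sub_left, hMf j s h1 h2 hjn.le,
        sum_inner, Finset.sum_eq_single (f := fun a => ⟪c a • f a, f s⟫) s, real_inner_smul_left, (ih s h2 h1 (by omega)).1,
        mul_one, sub_self, mul_zero]
      · intro r hr hrs
        obtain ⟨h3, h4⟩ := Finset.mem_Ico.1 hr
        rw [real_inner_smul_left]
        rcases lt_or_gt_of_ne hrs with hlt | hlt
        · rw [real_inner_comm, (ih s h2 h1 (by omega)).2 r h3 hlt, mul_zero]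
        · rw [(ih r h4 h3 (by omega)).2 s h1 hlt, mul_zero]
      · intro hn; exact absurd (Finset.mem_Ico.2 ⟨h1, h2⟩) hn
    refine ⟨?_, horth⟩
    have h1 : ⟪M j, f j⟫ = √(q - ∑ s ∈ Finset.Ico 1 j, c s ^ 2) := by
      rw [hf, gsVec_eq, ← hf, inner_smul_right, inner_sub_right, hMq j hj hjn.le, inner_sum]
      have : ∑ s ∈ Finset.Ico 1 j, ⟪M j, c s • f s⟫ = ∑ s ∈ Finset.Ico 1 j, c s ^ 2 :=
        Finset.sum_congr rfl fun s hs => by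
          obtain ⟨h1, h2⟩ := Finset.mem_Ico.1 hs
          rw [inner_smul_right, hMf j s h1 h2 hjn.le, sq]
      rw [this, inv_mul_eq_div, Real.div_sqrt]
    have h2 : ⟪∑ s ∈ Finset.Ico 1 j, c s • f s, f j⟫ = 0 := by
      rw [sum_inner]
      refine Finset.sum_eq_zero fun s hs => ?_
      obtain ⟨h1, h2⟩ := Finset.mem_Ico.1 hs
      rw [real_inner_smul_left, real_inner_comm, horth s h1 h2, mul_zero]
    refine (congrArg (fun y => ⟪y, f j⟫) (gsVec_eq M c _ j)).trans ?_
    rw [← hf, real_inner_smul_left, inner_sub_left, h1, h2, sub_zero,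
      inv_mul_cancel₀ (Real.sqrt_pos.2 hpos).ne']

/-- The next residual norm is positive as soon as some vector separates `M n` from the previous
vectors. -/
theorem sub_sum_sq_pos (hn : 1 ≤ n) (hM : ∀ i j, 1 ≤ j → j < i → i ≤ n → ⟪M i, M j⟫ = ρ j)
    (hMq : ∀ i, 1 ≤ i → i ≤ n → ⟪M i, M i⟫ = q)
    (hd : ∀ j, 1 ≤ j → j < n → 0 < q - ∑ s ∈ Finset.Ico 1 j, c s ^ 2)
    (hc : ∀ j, 1 ≤ j → j < n → c j * √(q - ∑ s ∈ Finset.Ico 1 j, c s ^ 2) =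
      ρ j - ∑ s ∈ Finset.Ico 1 j, c s ^ 2) {x : E} (hx : ∀ j, 1 ≤ j → j < n → ⟪M j, x⟫ = 0)
    (hxn : ⟪M n, x⟫ ≠ 0) : 0 < q - ∑ s ∈ Finset.Ico 1 n, c s ^ 2 := by
  set f := gsVec M c (fun k => q - ∑ s ∈ Finset.Ico 1 k, c s ^ 2) with hf
  have hfx : ∀ j, 1 ≤ j → j < n → ⟪f j, x⟫ = 0 := by
    intro j
    induction j using Nat.strong_induction_on with
    | _ j ih =>
      intro hj hjn
      rw [hf, gsVec_eq, ← hf, real_inner_smul_left, inner_sub_left, hx j hj hjn, sum_inner,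
        Finset.sum_eq_zero (f := fun a => ⟪c a • f a, x⟫), sub_zero, mul_zero]
      intro s hs
      obtain ⟨h1, h2⟩ := Finset.mem_Ico.1 hs
      rw [real_inner_smul_left, ih s h2 h1 (by omega), mul_zero]
  set Y := ∑ s ∈ Finset.Ico 1 n, c s • f s with hY
  have hYx : ⟪Y, x⟫ = 0 := by
    rw [hY, sum_inner]
    refine Finset.sum_eq_zero fun s hs => ?_
    obtain ⟨h1, h2⟩ := Finset.mem_Ico.1 hs
    rw [real_inner_smul_left, hfx s h1 h2, mul_zero]
  -- `x` is orthogonal to `Y` but not to `M n`. The remaining computation identifies the squared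
  -- norm of this difference with `q - ∑ c²`.
  have hne : M n - Y ≠ 0 := fun h0 => hxn (by
    have : ⟪M n - Y, x⟫ = 0 := by rw [h0, inner_zero_left]
    rwa [inner_sub_left, hYx, sub_zero] at this)
  have hMY : ⟪M n, Y⟫ = ∑ s ∈ Finset.Ico 1 n, c s ^ 2 := by
    rw [hY, inner_sum]
    refine Finset.sum_congr rfl fun s hs => ?_
    obtain ⟨h1, h2⟩ := Finset.mem_Ico.1 hs
    rw [inner_smul_right, inner_gsVec hM hd hc h1 h2 le_rfl, sq]
  have hYY : ⟪Y, Y⟫ = ∑ s ∈ Finset.Ico 1 n, c s ^ 2 := by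
    refine (congrArg (fun y => ⟪y, Y⟫) hY).trans ?_
    rw [sum_inner]
    refine Finset.sum_congr rfl fun s hs => ?_
    obtain ⟨h1, h2⟩ := Finset.mem_Ico.1 hs
    rw [real_inner_smul_left, hY, inner_sum, Finset.sum_eq_single s, inner_smul_right,
      (inner_gsVec_gsVec hM hMq hd hc h1 h2).1, mul_one, sq]
    · intro r hr hrs
      obtain ⟨h3, h4⟩ := Finset.mem_Ico.1 hr
      rw [inner_smul_right]
      rcases lt_or_gt_of_ne hrs with hlt | hlt
      · rw [(inner_gsVec_gsVec hM hMq hd hc h1 h2).2 r h3 hlt, mul_zero]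
      · rw [real_inner_comm, (inner_gsVec_gsVec hM hMq hd hc h3 h4).2 s h1 hlt, mul_zero]
    · intro hn'; exact absurd hs hn'
  have hpos : 0 < ⟪M n - Y, M n - Y⟫ := real_inner_self_pos.2 hne
  rw [inner_sub_left, inner_sub_right, inner_sub_right, hMq n hn le_rfl, real_inner_comm (M n) Y,
    hMY, hYY] at hpos
  linarith

end Gram

/-! ### The limiting variables as vectors in `L²` -/

section DefectPos

variable {β h q : ℝ}

theorem mlim_congr {k : ℕ} {w w' : ℕ × Bool → ℝ} (hw : ∀ s, s < k → w (s, true) = w' (s, true)) :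
    mlim β h q k w = mlim β h q k w' := by
  unfold mlim
  split_ifs with hk
  · rfl
  · rw [field, field, hw (k - 1) (by omega)]
    congr 2
    refine Finset.sum_congr rfl fun s hs => ?_
    have := (Finset.mem_Ico.1 hs).2
    rw [hw s (by omega)]

theorem memLp_mlim (hq : q ≤ 1) (k : ℕ) : MemLp (fun ω : Noise => mlim β h q k (ω 0)) 2 noise :=
  MemLp.of_bound ((measurable_mlim k).comp (measurable_pi_apply 0)).aestronglyMeasurable 1
    (ae_of_all _ fun _ => abs_mlim_le_one hq k _)

theorem memLp_coord (p : ℕ × ℕ × Bool) : MemLp (fun ω : Noise => ω p.1 p.2) 2 noise := by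
  have h1 : MemLp (id : ℝ → ℝ) 2 (noise.map fun ω => ω p.1 p.2) := by
    rw [(hasLaw_coord p).map_eq]
    exact memLp_id_gaussianReal 2
  exact (memLp_map_measure_iff aestronglyMeasurable_id (measurable_coord p).aemeasurable).1 h1

theorem integral_coord (p : ℕ × ℕ × Bool) : ∫ ω : Noise, ω p.1 p.2 ∂noise = 0 := by
  have h1 := (hasLaw_coord p).integral_comp (f := id) aestronglyMeasurable_id
  rw [Function.id_comp] at h1
  rw [h1]
  exact integral_id_gaussianReal

theorem inner_toLp_toLp {f g : Noise → ℝ} (hf : MemLp f 2 noise) (hg : MemLp g 2 noise) :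
    inner ℝ (hf.toLp f) (hg.toLp g) = ∫ ω, f ω * g ω ∂noise := by
  rw [L2.inner_def]
  refine integral_congr_ae ?_
  filter_upwards [hf.coeFn_toLp, hg.coeFn_toLp] with ω h1 h2
  rw [h1, h2]
  exact mul_comm _ _

/-- Functions of the coordinates of smaller index are uncorrelated with a coordinate. -/
theorem integral_mul_coord_eq_zero {k : ℕ} {F : (ℕ × Bool → ℝ) → ℝ} (hF : Measurable F)
    (hk : ∀ w w' : ℕ × Bool → ℝ, (∀ s, s < k → w (s, true) = w' (s, true)) → F w = F w') :
    ∫ ω : Noise, F (ω 0) * ω 0 (k, true) ∂noise = 0 := by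
  have hind : IndepFun (fun ω : Noise => F (ω 0)) (fun ω : Noise => ω 0 (k, true)) noise := by
    refine indepFun_of_disjoint (S := {p | p.2.1 < k}) (T := {p | p.2.1 = k})
      (hF.comp (measurable_pi_apply 0)) (by fun_prop) ?_ ?_ ?_
    · rw [Set.disjoint_left]
      intro p h1 h2
      exact (h1 : p.2.1 < k).ne h2
    · intro ω ω' hω
      exact hk _ _ fun s hs => hω (0, s, true) hs
    · intro ω ω' hω
      exact hω (0, k, true) rfl
  have h1 := hind.integral_fun_mul_eq_mul_integral
    (hF.comp (measurable_pi_apply 0)).aestronglyMeasurable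
    (measurable_coord (0, k, true)).aestronglyMeasurable
  rw [h1, integral_coord (0, k, true), mul_zero]

/-- Subtracting a term uncorrelated with the coordinate `w` leaves `(Th (a + b w) - Th a) w` with `b
> 0`, which is positive unless `w = 0`, a null event. -/
theorem integral_mlim_mul_coord_pos (hβ : 0 < β) {k : ℕ} (hk : 1 ≤ k)
    (hpos : 0 < defect β h q k) :
    0 < ∫ ω : Noise, mlim β h q (k + 1) (ω 0) * ω 0 (k, true) ∂noise := by
  -- The same variable with the newest coordinate removed.
  set F : (ℕ × Bool → ℝ) → ℝ := fun w =>
    Th β h (∑ s ∈ Finset.Ico 1 k, gamma β h q s * w (s, true)) with hFdef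
  have hF : Measurable F := (measurable_Th β h).comp (by fun_prop)
  have h0 := integral_mul_coord_eq_zero (k := k) hF fun w w' hw => by
    rw [hFdef]
    dsimp only
    congr 1
    refine Finset.sum_congr rfl fun s hs => ?_
    rw [hw s (Finset.mem_Ico.1 hs).2]
  have hx : Integrable (fun ω : Noise => ω 0 (k, true)) noise :=
    (memLp_coord (0, k, true)).integrable (by norm_num)
  have hi1 : Integrable (fun ω : Noise => mlim β h q (k + 1) (ω 0) * ω 0 (k, true)) noise := by
    simp only [mlim_succ hk]
    exact hx.bdd_mul (c := 1) (((measurable_Th β h).comp (measurable_field k)).comp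
      (measurable_pi_apply 0)).aestronglyMeasurable (ae_of_all _ fun _ => abs_Th_le_one _ _ _)
  have hi2 : Integrable (fun ω : Noise => F (ω 0) * ω 0 (k, true)) noise :=
    hx.bdd_mul (c := 1) (hF.comp (measurable_pi_apply 0)).aestronglyMeasurable
      (ae_of_all _ fun _ => abs_Th_le_one _ _ _)
  have hb := Real.sqrt_pos.2 hpos
  have key : ∀ ω : Noise, 0 ≤ mlim β h q (k + 1) (ω 0) * ω 0 (k, true) - F (ω 0) * ω 0 (k, true) ∧
      (mlim β h q (k + 1) (ω 0) * ω 0 (k, true) - F (ω 0) * ω 0 (k, true) = 0 →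
        ω 0 (k, true) = 0) := by
    intro ω
    rw [mlim_succ hk, field, ← sub_mul]
    have hmono := strictMono_Th hβ h
    rcases lt_trichotomy (ω 0 (k, true)) 0 with hlt | heq | hgt
    · have := hmono (show ∑ s ∈ Finset.Ico 1 k, gamma β h q s * ω 0 (s, true) +
        √(defect β h q k) * ω 0 (k, true) < ∑ s ∈ Finset.Ico 1 k, gamma β h q s * ω 0 (s, true) by
          nlinarith)
      have h2 := mul_pos_of_neg_of_neg (sub_neg.2 this) hlt
      exact ⟨h2.le, fun h3 => absurd h3 h2.ne'⟩
    · rw [heq]; simp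
    · have := hmono (show ∑ s ∈ Finset.Ico 1 k, gamma β h q s * ω 0 (s, true) <
        ∑ s ∈ Finset.Ico 1 k, gamma β h q s * ω 0 (s, true) + √(defect β h q k) * ω 0 (k, true) by
          nlinarith)
      have h2 := mul_pos (sub_pos.2 this) hgt
      exact ⟨h2.le, fun h3 => absurd h3 h2.ne'⟩
  have h1 := integral_sub hi1 hi2
  rw [h0, sub_zero] at h1
  rw [← h1]
  refine lt_of_le_of_ne (integral_nonneg fun ω => (key ω).1) fun hz => ?_
  rw [eq_comm, integral_eq_zero_iff_of_nonneg (fun ω => (key ω).1) (hi1.sub hi2)] at hz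
  have hne : ∀ᵐ ω ∂noise, ω 0 (k, true) ≠ 0 := by
    have h2 : ∀ᵐ x ∂(noise.map fun ω : Noise => ω 0 (k, true)), x ≠ 0 := by
      rw [(hasLaw_coord (0, k, true)).map_eq]
      have := nullSingletonClass_gaussianReal (μ := 0) (v := 1) one_ne_zero
      exact Measure.ae_ne _ _
    exact ae_of_ae_map (measurable_coord (0, k, true)).aemeasurable h2
  have hF : ∀ᵐ ω ∂noise, False := by
    filter_upwards [hz, hne] with ω h2 h3
    exact h3 ((key ω).2 h2)
  have := hF.exists
  simp at this

theorem defect_pos (hβ : 0 < β) (hh : 0 < h) (hq : IsFixedPoint β h q) {k : ℕ} (hk : 1 ≤ k) :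
    0 < defect β h q k := by
  induction k using Nat.strong_induction_on with
  | _ k ih =>
    obtain ⟨k, rfl⟩ := Nat.exists_eq_add_of_le' hk
    rcases Nat.eq_zero_or_pos k with rfl | hk0
    · rw [zero_add, defect_one]; exact q_pos hh hq
    · have hpos : ∀ l, 1 ≤ l → l < k + 1 → 0 < defect β h q l := fun l h1 h2 => ih l h2 h1
      have hq1 := q_le_one hq
      -- The separating vector is the coordinate of index `k`: it enters the field of level `k + 1`
      -- with coefficient `√(defect k) > 0` and is absent from every earlier variable.
      refine sub_sum_sq_pos (M := fun j => (memLp_mlim (β := β) (h := h) hq1 j).toLp) (ρ := rho β h q)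
        (x := (memLp_coord (0, k, true)).toLp) hk ?_ ?_ hpos ?_ ?_ ?_
      · intro i j hj hji hi
        rw [inner_toLp_toLp]
        exact integral_mlim_mul hh hq hj hji fun l h1 h2 => hpos l h1 (by omega)
      · intro i hi hik
        rw [inner_toLp_toLp]
        exact integral_mlim_mul_self hq hi fun l h1 h2 => hpos l h1 (by omega)
      · intro j hj hjk
        exact gamma_mul_sqrt_defect hj (hpos j hj hjk)
      · intro j hj hjk
        rw [inner_toLp_toLp]
        exact integral_mul_coord_eq_zero (measurable_mlim j) fun w w' hw =>
          mlim_congr fun s hs => hw s (by omega)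
      · rw [inner_toLp_toLp]
        exact (integral_mlim_mul_coord_pos hβ hk0 (hpos k hk0 (by omega))).ne'

end DefectPos

/-! ### Gram-Schmidt along the levels -/

section GramSchmidt

variable {N : ℕ} {β h q : ℝ} (g : Matrix (Fin N) (Fin N) ℝ)

variable (β h q) in
/-- The part of `m j` orthogonal to the previous directions. -/
def perp (j : ℕ) : Fin N → ℝ :=
  m β h q g j - ∑ s ∈ Finset.Ico 1 j, ip (m β h q g j) (φ β h q g s) • φ β h q g s

/-- The first direction fits the general formula too: normalizing the constant vector `√q` gives
`1`, provided `q > 0`. -/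
theorem φ_eq_perp (hN : 1 ≤ N) (hq : 0 < q) {j : ℕ} (hj : 1 ≤ j) :
    φ β h q g j = (nrm (perp β h q g j))⁻¹ • perp β h q g j := by
  obtain ⟨k, rfl⟩ := Nat.exists_eq_add_of_le' hj
  rcases Nat.eq_zero_or_pos k with rfl | hk
  · have h1 : perp β h q g (0 + 1) = fun _ => √q := by
      rw [perp, zero_add, Finset.Ico_self, Finset.sum_empty, sub_zero, m_one]
    have hq' := Real.sqrt_pos.2 hq
    rw [h1, nrm_const hN, abs_of_pos hq', zero_add, φ_one]
    ext i
    rw [Pi.smul_apply, smul_eq_mul, inv_mul_cancel₀ hq'.ne']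
  · rw [φ_succ β h q g hk, residual_level β h q g hk]
    rfl

theorem ip_perp_φ {j s : ℕ} (hs : 1 ≤ s) (hsj : s < j) :
    ip (perp β h q g j) (φ β h q g s) = 0 := by
  have H := orthoSys_φ β h q g
  have h1 := H.ip_self_mul hs (m β h q g j)
  rw [perp, ip_sub_left, ip_sum_left,
    Finset.sum_eq_single (f := fun a => ip (ip (m β h q g j) (φ β h q g a) • φ β h q g a)
      (φ β h q g s)) s, ip_smul_left, mul_comm, h1, sub_self]
  · intro a ha has
    rw [ip_smul_left, H.orth a s (Finset.mem_Ico.1 ha).1 hs has, mul_zero]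
  · intro hn; exact absurd (Finset.mem_Ico.2 ⟨hs, hsj⟩) hn

theorem ip_perp (x : Fin N → ℝ) (j : ℕ) : ip x (perp β h q g j) = ip x (m β h q g j) -
    ∑ s ∈ Finset.Ico 1 j, ip (m β h q g j) (φ β h q g s) * ip x (φ β h q g s) := by
  rw [perp, ip_sub_right, ip_sum_right]
  simp only [ip_smul_right]

theorem nrm_perp_sq (j : ℕ) : nrm (perp β h q g j) ^ 2 = ip (m β h q g j) (m β h q g j) -
    ∑ s ∈ Finset.Ico 1 j, ip (m β h q g j) (φ β h q g s) * ip (m β h q g j) (φ β h q g s) := by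
  rw [nrm_sq, ip_perp g (perp β h q g j) j, Finset.sum_eq_zero, sub_zero, ip_comm, ip_perp]
  intro s hs
  obtain ⟨h1, h2⟩ := Finset.mem_Ico.1 hs
  rw [ip_perp_φ g h1 h2, mul_zero]

theorem ip_φ_mul_nrm_perp (hN : 1 ≤ N) (hq : 0 < q) (x : Fin N → ℝ) {j : ℕ} (hj : 1 ≤ j) :
    ip x (φ β h q g j) * nrm (perp β h q g j) = ip x (m β h q g j) -
      ∑ s ∈ Finset.Ico 1 j, ip (m β h q g j) (φ β h q g s) * ip x (φ β h q g s) := by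
  rw [← ip_perp, φ_eq_perp g hN hq hj, ip_smul_right]
  rcases eq_or_ne (nrm (perp β h q g j)) 0 with h0 | h0
  -- If the residual has norm zero, Cauchy-Schwarz makes its inner product with `x` vanish, so the
  -- multiplied identity survives without division.
  · have := abs_ip_le x (perp β h q g j)
    rw [h0, mul_zero] at this
    rw [h0, mul_zero, abs_nonpos_iff.1 this]
  · field_simp

/-- The left side is nonzero only for a vanishing residual. It is then `1`, and the right side is
`d⁻¹ * d`. -/
theorem abs_one_sub_ip_φ_φ_le (hN : 1 ≤ N) (hq : 0 < q) {j : ℕ} (hj : 1 ≤ j) {d : ℝ}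
    (hd : 0 < d) : |1 - ip (φ β h q g j) (φ β h q g j)| ≤
      d⁻¹ * |nrm (perp β h q g j) ^ 2 - d| := by
  rw [φ_eq_perp g hN hq hj, ip_smul_left, ip_smul_right, ← nrm_sq]
  rcases eq_or_ne (nrm (perp β h q g j)) 0 with h0 | h0
  · rw [h0]
    simp [abs_of_pos hd, hd.ne']
  · have : (nrm (perp β h q g j))⁻¹ * ((nrm (perp β h q g j))⁻¹ * nrm (perp β h q g j) ^ 2) = 1 := by
      field_simp
    rw [this, sub_self, abs_zero]
    positivity

end GramSchmidt

/-- Division by a square root is stable. -/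
theorem abs_sub_le_of_mul_eq {x y n c d : ℝ} (hx : |x| ≤ 1) (hy : 0 ≤ y) (hd : 0 < d)
    (hxy : x * y = n) : |x - c| ≤ ((√d)⁻¹ + d⁻¹) * (|n - c * √d| + |y ^ 2 - d|) := by
  have hs := Real.sqrt_pos.2 hd
  have hss := Real.mul_self_sqrt hd.le
  -- First compare `y` with `√d` through their squares, then compare `x` with `c`; each stage costs
  -- one factor `(√d)⁻¹`.
  have h1 : |√d - y| * √d ≤ |y ^ 2 - d| := by
    have e : y ^ 2 - d = -((√d - y) * (√d + y)) := by linear_combination hss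
    rw [e, abs_neg, abs_mul, abs_of_pos (by positivity : 0 < √d + y)]
    exact mul_le_mul_of_nonneg_left (by linarith) (abs_nonneg _)
  have h2 : |x - c| * √d ≤ |√d - y| + |n - c * √d| := by
    have e : (x - c) * √d = x * (√d - y) + (n - c * √d) := by rw [← hxy]; ring
    rw [← abs_of_pos hs, ← abs_mul, abs_of_pos hs, e]
    refine (abs_add_le _ _).trans ?_
    rw [abs_mul]
    have := mul_le_mul_of_nonneg_right hx (abs_nonneg (√d - y))
    linarith
  have h3 : |√d - y| ≤ |y ^ 2 - d| * (√d)⁻¹ := by rwa [← div_eq_mul_inv, le_div_iff₀ hs]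
  have h4 : |x - c| ≤ (|√d - y| + |n - c * √d|) * (√d)⁻¹ := by rwa [← div_eq_mul_inv, le_div_iff₀ hs]
  have h5 : (√d)⁻¹ * (√d)⁻¹ = d⁻¹ := by rw [← mul_inv, hss]
  have h6 := mul_le_mul_of_nonneg_right h3 (inv_pos.2 hs).le
  rw [mul_assoc, h5] at h6
  have h7 := inv_pos.2 hs
  have h8 := inv_pos.2 hd
  nlinarith [abs_nonneg (n - c * √d), abs_nonneg (y ^ 2 - d),
    mul_nonneg h7.le (abs_nonneg (y ^ 2 - d)), mul_nonneg h8.le (abs_nonneg (n - c * √d))]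

/-! ### Convergence along the simulation -/

section Convergence

variable {β h q : ℝ}

variable (β h q) in
/-- The limiting variables sampled along the sites. -/
def mhat (N : ℕ) (ω : Noise) (k : ℕ) : Fin N → ℝ := fun i => mlim β h q k (ω i)

theorem nrm_mhat_le_one (hq : q ≤ 1) (N : ℕ) (ω : Noise) (k : ℕ) : nrm (mhat β h q N ω k) ≤ 1 :=
  nrm_le_one fun _ => abs_mlim_le_one hq k _

theorem nrm_m_le_one (hq : q ≤ 1) {N : ℕ} (g : Matrix (Fin N) (Fin N) ℝ) {k : ℕ} (hk : 1 ≤ k) :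
    nrm (m β h q g k) ≤ 1 :=
  nrm_le_one fun i => abs_m_le_one β h q g hq hk i

theorem abs_ip_m_φ_le_one (hq : q ≤ 1) {N : ℕ} (g : Matrix (Fin N) (Fin N) ℝ) {k s : ℕ}
    (hk : 1 ≤ k) (hs : 1 ≤ s) : |ip (m β h q g k) (φ β h q g s)| ≤ 1 :=
  (abs_ip_le _ _).trans
    (mul_le_one₀ (nrm_m_le_one hq g hk) (nrm_nonneg _) (nrm_φ_le_one β h q g hs))

theorem expClose_ip_mhat (hq : q ≤ 1) (i j : ℕ) :
    ExpClose noise (fun N ω => ip (mhat β h q N ω i) (mhat β h q N ω j))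
      fun _ _ => ∫ ω, mlim β h q i (ω 0) * mlim β h q j (ω 0) ∂noise :=
  expClose_average (F := fun w => mlim β h q i w * mlim β h q j w)
    ((measurable_mlim i).mul (measurable_mlim j)) fun w => by
      rw [abs_mul]
      exact mul_le_one₀ (abs_mlim_le_one hq i w) (abs_nonneg _) (abs_mlim_le_one hq j w)

variable {K : ℕ}

theorem expClose_ip_m_m (hq : q ≤ 1) {i j : ℕ} (hj : 1 ≤ j)
    (hAi : ExpClose noise (fun N ω => nrm (m β h q (simN N β h q ω K) i - mhat β h q N ω i))
      fun _ _ => 0)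
    (hAj : ExpClose noise (fun N ω => nrm (m β h q (simN N β h q ω K) j - mhat β h q N ω j))
      fun _ _ => 0) :
    ExpClose noise
      (fun N ω => ip (m β h q (simN N β h q ω K) i) (m β h q (simN N β h q ω K) j))
      fun _ _ => ∫ ω, mlim β h q i (ω 0) * mlim β h q j (ω 0) ∂noise := by
  refine ExpClose.trans ?_ (expClose_ip_mhat hq i j)
  refine hAi.of_abs_sub_le_add hAj (M := 1) fun N _ ω => ?_
  set x := m β h q (simN N β h q ω K) i
  set y := m β h q (simN N β h q ω K) j with hy
  set x' := mhat β h q N ω i with hx'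
  set y' := mhat β h q N ω j
  have e : ip x y - ip x' y' = ip (x - x') y + ip x' (y - y') := by
    rw [ip_sub_left, ip_sub_right]; ring
  have h1 := abs_ip_le (x - x') y
  have h2 := abs_ip_le x' (y - y')
  have h3 : nrm y ≤ 1 := nrm_m_le_one hq _ hj
  have h4 : nrm x' ≤ 1 := nrm_mhat_le_one hq _ _ _
  rw [e, one_mul, abs_of_nonneg (nrm_nonneg _), abs_of_nonneg (nrm_nonneg _)]
  refine (abs_add_le _ _).trans ?_
  have h5 := mul_le_mul_of_nonneg_left h3 (nrm_nonneg (x - x'))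
  have h6 := mul_le_mul_of_nonneg_right h4 (nrm_nonneg (y - y'))
  linarith

variable {n : ℕ}

theorem expClose_nrm_perp_sq (hβ : 0 < β) (hh : 0 < h) (hq : IsFixedPoint β h q)
    (hA : ∀ k, 1 ≤ k → k ≤ n → ExpClose noise
      (fun N ω => nrm (m β h q (simN N β h q ω K) k - mhat β h q N ω k)) fun _ _ => 0)
    {j : ℕ} (hj : 1 ≤ j) (hjn : j ≤ n)
    (hB : ∀ s, 1 ≤ s → s < j → ExpClose noise
      (fun N ω => ip (m β h q (simN N β h q ω K) j) (φ β h q (simN N β h q ω K) s))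
      fun _ _ => gamma β h q s) :
    ExpClose noise (fun N ω => nrm (perp β h q (simN N β h q ω K) j) ^ 2)
      fun _ _ => defect β h q j := by
  have hq1 := q_le_one hq
  have h1 := expClose_ip_m_m hq1 hj (hA j hj hjn) (hA j hj hjn)
  rw [integral_mlim_mul_self hq hj fun l hl _ => defect_pos hβ hh hq hl] at h1
  have h2 := ExpClose.sum (Finset.Ico 1 j) fun s hs =>
    have hs' := Finset.mem_Ico.1 hs
    (hB s hs'.1 hs'.2).mul (hB s hs'.1 hs'.2) fun N ω => abs_ip_m_φ_le_one hq1 _ hj hs'.1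
  have h3 := h1.sub h2
  simp only [nrm_perp_sq, defect, sq (gamma _ _ _ _)]
  exact h3

/-- The inner product with `φ j` times the residual norm of `m j` tends to `rho j - ∑ γ_s² = γ_j
√(defect j)`, while the squared norm tends to `defect j > 0`. The induction supplies the terms with
smaller `s`, for both `m i` and `m j`. -/
theorem expClose_ip_m_φ (hβ : 0 < β) (hh : 0 < h) (hq : IsFixedPoint β h q)
    (hA : ∀ k, 1 ≤ k → k ≤ n → ExpClose noise
      (fun N ω => nrm (m β h q (simN N β h q ω K) k - mhat β h q N ω k)) fun _ _ => 0)
    {i j : ℕ} (hj : 1 ≤ j) (hji : j < i) (hin : i ≤ n) :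
    ExpClose noise
      (fun N ω => ip (m β h q (simN N β h q ω K) i) (φ β h q (simN N β h q ω K) j))
      fun _ _ => gamma β h q j := by
  induction j using Nat.strong_induction_on generalizing i with
  | _ j ih =>
    have hq1 := q_le_one hq
    have hi : 1 ≤ i := by omega
    have hpos := defect_pos hβ hh hq hj
    have hδ := expClose_nrm_perp_sq hβ hh hq hA hj (by omega) fun s h1 h2 =>
      ih s h2 h1 h2 (by omega)
    have h1 := expClose_ip_m_m hq1 hj (hA i hi hin) (hA j hj (by omega))
    rw [integral_mlim_mul hh hq hj hji fun l hl _ => defect_pos hβ hh hq hl] at h1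
    have h2 := ExpClose.sum (Finset.Ico 1 j) fun s hs =>
      have hs' := Finset.mem_Ico.1 hs
      (ih s hs'.2 hs'.1 hs'.2 (by omega)).mul (ih s hs'.2 hs'.1 (by omega) hin) fun N ω =>
        abs_ip_m_φ_le_one hq1 (simN N β h q ω K) hi hs'.1
    have h3 := h1.sub h2
    have e : rho β h q j - ∑ s ∈ Finset.Ico 1 j, gamma β h q s * gamma β h q s =
        gamma β h q j * √(defect β h q j) := by
      rw [gamma_mul_sqrt_defect hj hpos]
      simp only [sq]
    rw [e] at h3
    exact h3.sub_self.of_abs_sub_le_add hδ.sub_self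
      (M := (√(defect β h q j))⁻¹ + (defect β h q j)⁻¹) fun N hN ω =>
        abs_sub_le_of_mul_eq (abs_ip_m_φ_le_one hq1 _ hi hj) (nrm_nonneg _) hpos
          (ip_φ_mul_nrm_perp _ hN (q_pos hh hq) _ hj)

theorem expClose_one_sub_ip_φ_φ (hβ : 0 < β) (hh : 0 < h) (hq : IsFixedPoint β h q)
    (hA : ∀ k, 1 ≤ k → k ≤ n → ExpClose noise
      (fun N ω => nrm (m β h q (simN N β h q ω K) k - mhat β h q N ω k)) fun _ _ => 0)
    {j : ℕ} (hj : 1 ≤ j) (hjn : j ≤ n) :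
    ExpClose noise
      (fun N ω => 1 - ip (φ β h q (simN N β h q ω K) j) (φ β h q (simN N β h q ω K) j))
      fun _ _ => 0 :=
  (expClose_nrm_perp_sq hβ hh hq hA hj hjn fun s h1 h2 =>
    expClose_ip_m_φ hβ hh hq hA h1 h2 hjn).sub_self.of_abs_sub_le
      (M := (defect β h q j)⁻¹) fun N hN ω => by
        rw [sub_zero]
        exact abs_one_sub_ip_φ_φ_le _ hN (q_pos hh hq) hj (defect_pos hβ hh hq hj)

/-! ### Comparison of the levels with i.i.d. limiting variables -/

variable (β h q K) in
/-- The size of the part of the fresh noise of step `s` along the directions already present. -/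
def overlap (N : ℕ) (ω : Noise) (s : ℕ) : ℝ :=
  ∑ r ∈ Finset.Ico 1 s, |ip (φ β h q (simN N β h q ω K) r) (noiseZ N ω s)| +
    |ip (φ β h q (simN N β h q ω K) s) (noiseV N ω s)|

theorem overlap_nonneg (N : ℕ) (ω : Noise) (s : ℕ) : 0 ≤ overlap β h q K N ω s :=
  add_nonneg (Finset.sum_nonneg fun _ _ => abs_nonneg _) (abs_nonneg _)

/-- All directions up to index `s` are fixed after `s - 1` steps and hence independent of the noise
of step `s`. -/
theorem expClose_overlap {s : ℕ} (hs : 1 ≤ s) (hsK : s ≤ K) :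
    ExpClose noise (fun N ω => overlap β h q K N ω s) fun _ _ => 0 := by
  obtain ⟨k, rfl⟩ := Nat.exists_eq_add_of_le' hs
  have hφ : ∀ (N : ℕ) (ω : Noise) (r : ℕ), 1 ≤ r → r ≤ k + 1 →
      φ β h q (simN N β h q ω K) r = φ β h q (simN N β h q ω k) r := fun N ω r h1 h2 =>
    φ_sim β h q _ _ h1 h2 (by omega)
  have h1 : ∀ r ∈ Finset.Ico 1 (k + 1), ExpClose noise
      (fun N ω => ip (φ β h q (simN N β h q ω K) r) (noiseZ N ω (k + 1))) fun _ _ => 0 := by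
    intro r hr
    obtain ⟨h1, h2⟩ := Finset.mem_Ico.1 hr
    simp only [fun N ω => hφ N ω r h1 h2.le]
    exact (expClose_ip_φ_noise β h q h1).1
  have h2 : ExpClose noise
      (fun N ω => ip (φ β h q (simN N β h q ω K) (k + 1)) (noiseV N ω (k + 1))) fun _ _ => 0 := by
    simp only [fun N ω => hφ N ω (k + 1) hs le_rfl]
    exact (expClose_ip_φ_noise β h q hs).2
  refine ((ExpClose.sum_abs _ h1).abs_add_abs h2).of_abs_sub_le (M := 1) fun N _ ω => ?_
  rw [sub_zero, one_mul, abs_of_nonneg (a := ∑ r ∈ _, _) (Finset.sum_nonneg fun _ _ => abs_nonneg _)]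
  rfl

theorem nrm_projC_mulVec_add_sub_le {N : ℕ} {u : ℕ → Fin N → ℝ}
    (hu : ∀ r, 1 ≤ r → nrm (u r) ≤ 1) (k : ℕ) (x y : Fin N → ℝ) :
    nrm (projC u k *ᵥ x + ip (u (k + 1)) y • u (k + 1) - x) ≤
      ∑ r ∈ Finset.Ico 1 (k + 1), |ip (u r) x| + |ip (u (k + 1)) y| := by
  have hcomp : ∀ (r : ℕ) (x : Fin N → ℝ), 1 ≤ r → nrm (ip (u r) x • u r) ≤ |ip (u r) x| :=
    fun r x hr => by
      rw [nrm_smul]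
      exact mul_le_of_le_one_right (abs_nonneg _) (hu r hr)
  have e : projC u k *ᵥ x + ip (u (k + 1)) y • u (k + 1) - x =
      ip (u (k + 1)) y • u (k + 1) - ∑ r ∈ Finset.Icc 1 k, ip (u r) x • u r := by
    rw [projC_mulVec]; abel
  have hI : Finset.Ico 1 (k + 1) = Finset.Icc 1 k := by ext r; simp
  rw [e, hI, add_comm (∑ r ∈ _, _)]
  refine (nrm_sub_le _ _).trans (add_le_add (hcomp _ _ (Nat.le_add_left 1 k))
    ((nrm_sum_le _ _).trans ?_))
  exact Finset.sum_le_sum fun r hr => hcomp r x (Finset.mem_Icc.1 hr).1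

theorem nrm_ζ_sub_le {N : ℕ} (ω : Noise) {s : ℕ} (hs : 1 ≤ s) (hsK : s ≤ K)
    (h1 : ip (φ β h q (simN N β h q ω K) s) (φ β h q (simN N β h q ω K) s) = 1) :
    nrm ((level β h q (simN N β h q ω K) s).ζ - noiseZ N ω s) ≤ overlap β h q K N ω s := by
  obtain ⟨k, rfl⟩ := Nat.exists_eq_add_of_le' hs
  have hφ : ∀ r, 1 ≤ r → r ≤ k + 1 →
      φ β h q (simN N β h q ω K) r = φ β h q (simN N β h q ω k) r := fun r h1 h2 =>
    φ_sim β h q _ _ h1 h2 (by omega)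
  have hζ := level_sim_ζ β h q (noiseZ N ω) (noiseV N ω) hsK
  rw [← simN, ← simN, ← hφ (k + 1) hs le_rfl, h1, one_smul,
    ← projC_congr fun r h2 h3 => hφ r h2 (Nat.le_succ_of_le h3)] at hζ
  rw [hζ]
  exact nrm_projC_mulVec_add_sub_le (fun r hr => nrm_φ_le_one β h q _ hr) k _ _

theorem fieldNext_eq {N : ℕ} {n : ℕ} (hn : 1 ≤ n) (L : ℕ → Level N) (i : Fin N) :
    fieldNext β h q n L i =
      h + β * ∑ s ∈ Finset.Ico 1 (n + 1), coef β h q n s * (L s).ζ i := by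
  rw [sum_coef_mul hn le_rfl, fieldNext, defect]
  ring

/-- Both sides apply `tanh`, which is 1-Lipschitz, to the same linear combination, once of the `ζ`
and once of the fresh vectors. -/
theorem nrm_m_sub_mhat_le {N : ℕ} (ω : Noise) (hn : 1 ≤ n) (hnK : n ≤ K)
    (h1 : ∀ s, 1 ≤ s → s ≤ n →
      ip (φ β h q (simN N β h q ω K) s) (φ β h q (simN N β h q ω K) s) = 1) :
    nrm (m β h q (simN N β h q ω K) (n + 1) - mhat β h q N ω (n + 1)) ≤
      (|β| * ∑ s ∈ Finset.Ico 1 (n + 1), |coef β h q n s|) *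
        ∑ s ∈ Finset.Ico 1 (n + 1), overlap β h q K N ω s := by
  set S := simN N β h q ω K with hS
  have h2 : nrm (m β h q S (n + 1) - mhat β h q N ω (n + 1)) ≤
      nrm (β • ∑ s ∈ Finset.Ico 1 (n + 1),
        coef β h q n s • ((level β h q S s).ζ - noiseZ N ω s)) := by
    refine nrm_le_of_abs_le fun i => ?_
    rw [Pi.sub_apply, m_succ β h q _ hn, mNext, mhat, mlim_succ hn, Th]
    refine (abs_tanh_sub_le _ _).trans (le_of_eq ?_)
    rw [fieldNext_eq hn, field, ← sum_coef_mul hn (le_refl n), Pi.smul_apply, Finset.sum_apply,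
      smul_eq_mul, add_sub_add_left_eq_sub, ← mul_sub, ← Finset.sum_sub_distrib]
    congr 2
    refine Finset.sum_congr rfl fun s _ => ?_
    rw [Pi.smul_apply, Pi.sub_apply, smul_eq_mul, mul_sub]
    rfl
  refine h2.trans ?_
  rw [nrm_smul, mul_assoc]
  refine mul_le_mul_of_nonneg_left ((nrm_sum_le _ _).trans ?_) (abs_nonneg _)
  rw [Finset.sum_mul]
  refine Finset.sum_le_sum fun s hs => ?_
  obtain ⟨h3, h4⟩ := Finset.mem_Ico.1 hs
  rw [nrm_smul]
  refine mul_le_mul_of_nonneg_left ?_ (abs_nonneg _)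
  exact (nrm_ζ_sub_le ω h3 (by omega) (h1 s h3 (by omega))).trans
    (Finset.single_le_sum (f := fun s => overlap β h q K N ω s)
      (fun s _ => overlap_nonneg N ω s) hs)

theorem ip_φ_φ_eq_zero_or_one {N : ℕ} (g : Matrix (Fin N) (Fin N) ℝ) {s : ℕ} (hs : 1 ≤ s) :
    ip (φ β h q g s) (φ β h q g s) = 0 ∨ ip (φ β h q g s) (φ β h q g s) = 1 := by
  have h1 := (orthoSys_φ β h q g).ip_self_mul hs (φ β h q g s)
  rcases eq_or_ne (ip (φ β h q g s) (φ β h q g s)) 0 with h0 | h0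
  · exact .inl h0
  · exact .inr (mul_left_cancel₀ h0 (h1.trans (mul_one _).symm))

theorem expClose_nrm_m_sub_mhat (hβ : 0 < β) (hh : 0 < h) (hq : IsFixedPoint β h q) {k : ℕ}
    (hk : 1 ≤ k) (hkK : k ≤ K + 1) : ExpClose noise
      (fun N ω => nrm (m β h q (simN N β h q ω K) k - mhat β h q N ω k)) fun _ _ => 0 := by
  induction k using Nat.strong_induction_on with
  | _ k ih =>
    obtain ⟨n, rfl⟩ := Nat.exists_eq_add_of_le' hk
    rcases Nat.eq_zero_or_pos n with rfl | hn
    · have : ∀ (N : ℕ) (ω : Noise),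
          nrm (m β h q (simN N β h q ω K) (0 + 1) - mhat β h q N ω (0 + 1)) = 0 := fun N ω => by
        have e : mhat β h q N ω (0 + 1) = fun _ => √q := by
          ext i; rw [mhat, zero_add, mlim_one]
        rw [e, zero_add, m_one, sub_self, nrm_zero]
      simp only [this]
      exact ExpClose.refl _
    · have hA : ∀ l, 1 ≤ l → l ≤ n → ExpClose noise
          (fun N ω => nrm (m β h q (simN N β h q ω K) l - mhat β h q N ω l)) fun _ _ => 0 :=
        fun l h1 h2 => ih l (by omega) h1 (by omega)
      have h1 := ExpClose.sum_abs (Finset.Ico 1 (n + 1)) fun s hs =>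
        have hs' := Finset.mem_Ico.1 hs
        expClose_overlap (β := β) (h := h) (q := q) (K := K) hs'.1 (by omega)
      have h2 := ExpClose.sum_abs (Finset.Ico 1 (n + 1)) fun s hs =>
        have hs' := Finset.mem_Ico.1 hs
        expClose_one_sub_ip_φ_φ hβ hh hq hA hs'.1 (Nat.le_of_lt_succ hs'.2)
      set C := |β| * ∑ s ∈ Finset.Ico 1 (n + 1), |coef β h q n s| with hC
      have hC0 : 0 ≤ C := mul_nonneg (abs_nonneg _) (Finset.sum_nonneg fun _ _ => abs_nonneg _)
      -- The constant `C` handles samples where all directions are unit vectors, and `2` handles the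
      -- others.
      refine h1.of_abs_sub_le_add h2 (M := C + 2) fun N _ ω => ?_
      have p1 : 0 ≤ ∑ s ∈ Finset.Ico 1 (n + 1), |overlap β h q K N ω s| :=
        Finset.sum_nonneg fun _ _ => abs_nonneg _
      have p2 : 0 ≤ ∑ s ∈ Finset.Ico 1 (n + 1),
          |1 - ip (φ β h q (simN N β h q ω K) s) (φ β h q (simN N β h q ω K) s)| :=
        Finset.sum_nonneg fun _ _ => abs_nonneg _
      rw [sub_zero, abs_of_nonneg (nrm_nonneg _), abs_of_nonneg p1, abs_of_nonneg p2]
      by_cases hall : ∀ s, 1 ≤ s → s ≤ n →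
          ip (φ β h q (simN N β h q ω K) s) (φ β h q (simN N β h q ω K) s) = 1
      · have h3 := nrm_m_sub_mhat_le ω hn (Nat.le_of_succ_le_succ hkK) hall
        simp only [abs_of_nonneg (overlap_nonneg N ω _)] at p1 ⊢
        nlinarith [mul_nonneg hC0 p2]
      · push Not at hall
        obtain ⟨s, hs1, hsn, hs⟩ := hall
        -- A direction that is not a unit vector is zero, so one defect term equals `1` and
        -- dominates the trivial bound `2` after multiplication by `C + 2`.
        have h0 := (ip_φ_φ_eq_zero_or_one (simN N β h q ω K) hs1).resolve_right hs
        have h3 := Finset.single_le_sum (f := fun s =>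
          |1 - ip (φ β h q (simN N β h q ω K) s) (φ β h q (simN N β h q ω K) s)|)
          (fun _ _ => abs_nonneg _) (Finset.mem_Ico.2 ⟨hs1, Nat.lt_succ_of_le hsn⟩)
        simp only [h0, sub_zero, abs_one] at h3
        have h4 := nrm_sub_le (m β h q (simN N β h q ω K) (n + 1)) (mhat β h q N ω (n + 1))
        have h5 := nrm_m_le_one (β := β) (h := h) (q_le_one hq) (simN N β h q ω K) hk
        have h6 := nrm_mhat_le_one (β := β) (h := h) (q_le_one hq) N ω (n + 1)
        nlinarith [mul_nonneg hC0 p1, mul_nonneg hC0 p2]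

end Convergence

/-! ### Transfer to the interaction matrix -/

theorem ExpClose.of_simN {Ω : Type*} [MeasurableSpace Ω] {P : Measure Ω} [IsProbabilityMeasure P]
    {β h q : ℝ} {g : (N : ℕ) → Ω → Matrix (Fin N) (Fin N) ℝ}
    (hg_law : ∀ (N : ℕ) (i j : Fin N),
      HasLaw (fun ω => g N ω i j) (gaussianReal 0 (1 / (N : ℝ≥0))) P)
    (hg_indep : ∀ N : ℕ, iIndepFun (fun (p : Fin N × Fin N) (ω : Ω) => g N ω p.1 p.2) P)
    (k : ℕ) {f : (N : ℕ) → Matrix (Fin N) (Fin N) ℝ → ℝ} (hf : ∀ N, Measurable (f N))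
    (hfk : ∀ (N : ℕ) (ω : Noise) (B : Matrix (Fin N) (Fin N) ℝ),
      f N (simFull β h q (noiseZ N ω) (noiseV N ω) k B) = f N (simN N β h q ω k)) {a : ℝ}
    (hS : ExpClose noise (fun N ω => f N (simN N β h q ω k)) fun _ _ => a) :
    ExpClose P (fun N ω => f N (g N ω)) fun _ _ => a := by
  obtain ⟨C, hC, c, hc, hP⟩ := hS
  refine ⟨C, hC, c, hc, fun N hN t ht => ?_⟩
  have hs : MeasurableSet {x : ℝ | t ≤ |x - a|} := measurableSet_le measurable_const (by fun_prop)
  exact (measureReal_eq_of_simN β h q (hg_law N) (hg_indep N) k (hf N) (hfk N) hs).le.trans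
    (hP N hN t ht)

end TAP

end

theorem proposition5 {Ω : Type*} [MeasurableSpace Ω] (P : Measure Ω) [IsProbabilityMeasure P]
    (β h q : ℝ) (hβ : 0 < β) (hh : 0 < h) (hq : TAP.IsFixedPoint β h q)
    (g : (N : ℕ) → Ω → Matrix (Fin N) (Fin N) ℝ)
    (hg_law : ∀ (N : ℕ) (i j : Fin N),
      HasLaw (fun ω => g N ω i j) (gaussianReal 0 (1 / (N : ℝ≥0))) P)
    (hg_indep : ∀ N : ℕ, iIndepFun (fun (p : Fin N × Fin N) (ω : Ω) => g N ω p.1 p.2) P) :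
    (∀ j k : ℕ, 1 ≤ j → j < k →
      TAP.ExpClose P
        (fun N ω => TAP.ip (TAP.m β h q (g N ω) k) (TAP.φ β h q (g N ω) j))
        (fun _ _ => TAP.gamma β h q j)) ∧
    (∀ k : ℕ, 1 ≤ k →
      TAP.ExpClose P
        (fun N ω => TAP.nrm (TAP.m β h q (g N ω) k) ^ 2)
        (fun _ _ => q)) ∧
    (∀ j k : ℕ, 1 ≤ j → j < k →
      TAP.ExpClose P
        (fun N ω => TAP.ip (TAP.m β h q (g N ω) k) (TAP.m β h q (g N ω) j))
        (fun _ _ => TAP.rho β h q j)) := by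
  -- Simulating `k` steps suffices, since they determine `m` and `φ` through level `k + 1`. The
  -- remaining steps compute the limits there and transfer the tail bounds to `g`.
  have hA : ∀ k l, 1 ≤ l → l ≤ k → TAP.ExpClose TAP.noise (fun N ω =>
      TAP.nrm (TAP.m β h q (TAP.simN N β h q ω k) l - TAP.mhat β h q N ω l)) fun _ _ => 0 :=
    fun k l h1 h2 => TAP.expClose_nrm_m_sub_mhat hβ hh hq h1 (by omega)
  have hpos : ∀ l, 1 ≤ l → 0 < TAP.defect β h q l := fun l => TAP.defect_pos hβ hh hq
  have hq1 := TAP.q_le_one hq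
  refine ⟨fun j k hj hjk => ?_, fun k hk => ?_, fun j k hj hjk => ?_⟩
  · refine TAP.ExpClose.of_simN hg_law hg_indep k
      (f := fun N S => TAP.ip (TAP.m β h q S k) (TAP.φ β h q S j))
      (fun N => TAP.measurable_ip (TAP.measurable_m β h q (by omega)) (TAP.measurable_φ β h q hj))
      (fun N ω B => ?_) (TAP.expClose_ip_m_φ hβ hh hq (hA k) hj hjk le_rfl)
    rw [TAP.m_simFull β h q _ _ B (by omega) (by omega), TAP.φ_simFull β h q _ _ B hj (by omega)]
    rfl
  · have h1 := TAP.expClose_ip_m_m hq1 hk (hA k k hk le_rfl) (hA k k hk le_rfl)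
    rw [TAP.integral_mlim_mul_self hq hk fun l hl _ => hpos l hl] at h1
    simp only [TAP.nrm_sq]
    refine TAP.ExpClose.of_simN hg_law hg_indep k
      (f := fun N S => TAP.ip (TAP.m β h q S k) (TAP.m β h q S k))
      (fun N => TAP.measurable_ip (TAP.measurable_m β h q hk) (TAP.measurable_m β h q hk))
      (fun N ω B => ?_) h1
    rw [TAP.m_simFull β h q _ _ B hk (by omega)]
    rfl
  · have h1 := TAP.expClose_ip_m_m hq1 hj (hA k k (by omega) le_rfl) (hA k j hj hjk.le)
    rw [TAP.integral_mlim_mul hh hq hj hjk fun l hl _ => hpos l hl] at h1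
    refine TAP.ExpClose.of_simN hg_law hg_indep k
      (f := fun N S => TAP.ip (TAP.m β h q S k) (TAP.m β h q S j))
      (fun N => TAP.measurable_ip (TAP.measurable_m β h q (by omega)) (TAP.measurable_m β h q hj))
      (fun N ω B => ?_) h1
    rw [TAP.m_simFull β h q _ _ B (by omega) (by omega), TAP.m_simFull β h q _ _ B hj (by omega)]
    rfl
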